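/- **Definitions.** An *abstract tropical curve* is a finite connected graph (loops and multiple edges allowed) with a length in $(0,\infty]$ on each edge, such that every edge of infinite length has an *infinite vertex* at one of its ends, where an infinite vertex has degree $1$ and lies on an edge of infinite length. A *subdivision* replaces an edge by two consecutive edges whose lengths add up to the original length (an infinite vertex stays on an edge of infinite length). An *elementary tropical modification* attaches an edge of infinite length at a finite vertex. A *tropical modification* of $\Gamma$ is any curve obtained from $\Gamma$ by a finite sequence of elementary tropical modifications, subdivisions and reverse subdivisions. Two abstract tropical curves are *isometric* if they are related by subdivisions and reverse subdivisions, up to isomorphism. A *smooth tropical curve* in $\mathbb R^2$ is a union of finitely many segments and rays which near each of its points is, up to translation and $\mathrm{GL}_2(\mathbb Z)$, either the union of the two rays generated by $e_1,-e_1$ or the union of the three rays generated by $e_1,e_2,-e_1-e_2$. A *nodal tropical curve* in $\mathbb R^2$ is defined in the same way, but may in addition have *nodes*, points near which it is the union of two distinct lines with primitive integral direction vectors $u$ and $v$; the *multiplicity* of such a node is $|\det(u,v)|$. A nodal (in particular, a smooth) tropical curve is regarded as an abstract tropical curve as follows: its segments are the finite edges, a segment with endpoints $p_1,p_2$ having the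 length $\alpha>0$ such that $p_1-p_2=\alpha w$ with $w\in\mathbb Z^2$ primitive; its rays are edges of infinite length ending at a new infinite vertex; and at each node there are two vertices of degree $2$, one on each of the two lines. An *embedding* (resp. *immersion*) of $\Gamma$ in $\mathbb R^2$ is a smooth (resp. nodal) tropical curve in $\mathbb R^2$ whose abstract tropical curve is isometric to a tropical modification of $\Gamma$. The *tropical crossing number* of $\Gamma$ is the minimum, over all immersions of $\Gamma$ in $\mathbb R^2$, of the number of nodes counted with multiplicity. **Proposition.** Let $\Gamma$ be the theta graph, that is, the abstract tropical curve with two vertices joined by three edges, and suppose that the three edges have the same finite length $\ell>0$. Then the tropical crossing number of $\Gamma$ is exactly $1$. In particular, $\Gamma$ has no smooth embedding in $\mathbb R^2$. -/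

import Mathlib

open scoped ENNReal Topology Matrix

namespace TropicalCrossing

/-! ### Abstract tropical curves -/

/-- An abstract tropical curve: a finite connected graph, loops and multiple edges allowed, whose
edges carry a length in `(0, ∞]`.  The graph is given by its half-edges: `vert h` is the vertex at
which the half-edge `h` is attached, and the edges are the pairs `{h, flip h}`.  An edge of infinite
length has an infinite vertex at one of its ends, and an infinite vertex has degree one and lies on
an edge of infinite length. -/
structure AbstractTropicalCurve where
  V : Type
  H : Type
  finite_V : Finite V
  finite_H : Finite H
  nonempty_V : Nonempty V
  vert : H → V
  flip : H → H
  flip_flip : ∀ h, flip (flip h) = h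
  flip_ne : ∀ h, flip h ≠ h
  connected : ∀ v w : V,
    Relation.ReflTransGen (fun a b => ∃ h, vert h = a ∧ vert (flip h) = b) v w
  len : H → ℝ≥0∞
  len_flip : ∀ h, len (flip h) = len h
  len_pos : ∀ h, 0 < len h
  /-- the vertices marked as infinite -/
  IsInf : V → Prop
  isInf_of_len : ∀ h, len h = ⊤ → IsInf (vert h) ∨ IsInf (vert (flip h))
  isInf_spec : ∀ v, IsInf v → ∃ h, (∀ k, vert k = v ↔ k = h) ∧ len h = ⊤

namespace AbstractTropicalCurve

/-- Isomorphism of abstract tropical curves. -/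
def Iso (G G' : AbstractTropicalCurve) : Prop :=
  ∃ (φ : G.V ≃ G'.V) (ψ : G.H ≃ G'.H),
    (∀ h, G'.vert (ψ h) = φ (G.vert h)) ∧
    (∀ h, G'.flip (ψ h) = ψ (G.flip h)) ∧
    (∀ h, G'.len (ψ h) = G.len h) ∧
    (∀ v, G'.IsInf (φ v) ↔ G.IsInf v)

/-- `G'` arises from `G` by one subdivision: the edge `{h₀, flip h₀}` is replaced by two consecutive
edges, through a new finite vertex (the image of `none`), whose lengths add up to the original
length.  The new vertex carries the two new half-edges (the images of `inr false` and `inr true`).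
That an end of an infinite edge stays on an infinite edge when it is an infinite vertex is part of
the definition of an abstract tropical curve, applied to `G'`. -/
def IsSubdivision (G G' : AbstractTropicalCurve) : Prop :=
  ∃ (h₀ : G.H) (φ : Option G.V ≃ G'.V) (ψ : G.H ⊕ Bool ≃ G'.H),
    (∀ h, G'.vert (ψ (Sum.inl h)) = φ (some (G.vert h))) ∧
    (∀ b, G'.vert (ψ (Sum.inr b)) = φ none) ∧
    G'.flip (ψ (Sum.inl h₀)) = ψ (Sum.inr false) ∧
    G'.flip (ψ (Sum.inl (G.flip h₀))) = ψ (Sum.inr true) ∧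
    (∀ h, h ≠ h₀ → h ≠ G.flip h₀ →
      G'.flip (ψ (Sum.inl h)) = ψ (Sum.inl (G.flip h)) ∧
      G'.len (ψ (Sum.inl h)) = G.len h) ∧
    G'.len (ψ (Sum.inl h₀)) + G'.len (ψ (Sum.inl (G.flip h₀))) = G.len h₀ ∧
    (∀ v, G'.IsInf (φ (some v)) ↔ G.IsInf v) ∧
    ¬ G'.IsInf (φ none)

/-- `G'` arises from `G` by an elementary tropical modification: an infinite edge, ending at a new
infinite vertex (the image of `none`), is attached at a finite vertex `v₀` of `G`. -/
def IsElementaryModification (G G' : AbstractTropicalCurve) : Prop :=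
  ∃ (v₀ : G.V) (φ : Option G.V ≃ G'.V) (ψ : G.H ⊕ Bool ≃ G'.H),
    ¬ G.IsInf v₀ ∧
    (∀ h, G'.vert (ψ (Sum.inl h)) = φ (some (G.vert h))) ∧
    G'.vert (ψ (Sum.inr false)) = φ (some v₀) ∧
    G'.vert (ψ (Sum.inr true)) = φ none ∧
    (∀ h, G'.flip (ψ (Sum.inl h)) = ψ (Sum.inl (G.flip h))) ∧
    G'.flip (ψ (Sum.inr false)) = ψ (Sum.inr true) ∧
    (∀ h, G'.len (ψ (Sum.inl h)) = G.len h) ∧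
    G'.len (ψ (Sum.inr false)) = ⊤ ∧
    (∀ v, G'.IsInf (φ (some v)) ↔ G.IsInf v) ∧
    G'.IsInf (φ none)

/-- One step of a tropical modification: an isomorphism, a subdivision, a reverse subdivision, or an
elementary tropical modification. -/
def ModificationStep (G G' : AbstractTropicalCurve) : Prop :=
  G.Iso G' ∨ G.IsSubdivision G' ∨ G'.IsSubdivision G ∨ G.IsElementaryModification G'

/-- `G'` is (up to isomorphism) a tropical modification of `G`: it is obtained from `G` by a finite
sequence of elementary tropical modifications, subdivisions and reverse subdivisions.  Since
subdivisions and reverse subdivisions are included, this says as well that `G'` is isometric to a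
tropical modification of `G`. -/
def IsModification (G G' : AbstractTropicalCurve) : Prop :=
  Relation.ReflTransGen ModificationStep G G'

end AbstractTropicalCurve

/-- The theta graph: two vertices joined by three edges, the `i`-th of which has length `ℓ i`. -/
noncomputable def theta (ℓ : Fin 3 → ℝ) (hℓ : ∀ i, 0 < ℓ i) : AbstractTropicalCurve where
  V := Bool
  H := Fin 3 × Bool
  finite_V := inferInstance
  finite_H := inferInstance
  nonempty_V := inferInstance
  vert h := h.2
  flip h := (h.1, !h.2)
  flip_flip := by simp
  flip_ne := by rintro ⟨i, b⟩ h; simp at h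
  connected := by
    intro v w
    by_cases h : v = w
    · subst h; exact .refl
    · exact .single ⟨(0, v), rfl, by cases v <;> cases w <;> simp_all⟩
  len h := ENNReal.ofReal (ℓ h.1)
  len_flip := by simp
  len_pos h := by simpa using hℓ h.1
  IsInf _ := False
  isInf_of_len := by simp
  isInf_spec := by simp

/-! ### Smooth and nodal tropical curves in the plane -/

/-- The plane `ℝ²`. -/
abbrev Plane : Type := Fin 2 → ℝ

/-- An integral vector as a vector of the plane. -/
def toPlane (u : Fin 2 → ℤ) : Plane := fun i => (u i : ℝ)

/-- A primitive integral vector: its entries have no common divisor. -/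
def IsPrimitive (u : Fin 2 → ℤ) : Prop := IsCoprime (u 0) (u 1)

/-- The determinant of the matrix with columns `u` and `v`. -/
def det₂ (u v : Fin 2 → ℤ) : ℤ := Matrix.det !![u 0, v 0; u 1, v 1]

/-- The union of the rays from the origin generated by the vectors in `S`. -/
def fan (S : Set (Fin 2 → ℤ)) : Set Plane := {x | ∃ u ∈ S, ∃ t : ℝ, 0 ≤ t ∧ x = t • toPlane u}

/-- The standard smooth models in `ℝ²`, of valence two (rays generated by `e₁` and `-e₁`)
and of valence three (rays generated by `e₁`, `e₂` and `-e₁ - e₂`). -/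
def IsStandardModel (M : Set Plane) : Prop :=
  M = fan {![1, 0], ![-1, 0]} ∨ M = fan {![1, 0], ![0, 1], ![-1, -1]}

/-- `C` coincides with the translate `p + M` in a neighborhood of `p`. -/
def LocallyAt (C : Set Plane) (p : Plane) (M : Set Plane) : Prop :=
  ∀ᶠ x in 𝓝 p, (x ∈ C ↔ x - p ∈ M)

/-- Near `p`, the set `C` is a standard smooth model up to translation and `GL₂(ℤ)`. -/
def IsSmoothAt (C : Set Plane) (p : Plane) : Prop :=
  ∃ (M : Set Plane) (A : GL (Fin 2) ℤ), IsStandardModel M ∧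
    LocallyAt C p ((fun x => (A : Matrix (Fin 2) (Fin 2) ℤ).map (Int.cast : ℤ → ℝ) *ᵥ x) '' M)

/-- Near `p`, the set `C` is the union of the two distinct lines through `p` parallel to the
primitive integral vectors `u` and `v`. -/
def IsNodeWith (C : Set Plane) (p : Plane) (u v : Fin 2 → ℤ) : Prop :=
  IsPrimitive u ∧ IsPrimitive v ∧ det₂ u v ≠ 0 ∧
    LocallyAt C p {x | ∃ t : ℝ, x = t • toPlane u ∨ x = t • toPlane v}

/-- `p` is a node of `C`. -/
def IsNode (C : Set Plane) (p : Plane) : Prop := ∃ u v, IsNodeWith C p u v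

/-- A closed bounded segment. -/
def IsSegment (s : Set Plane) : Prop := ∃ a b : Plane, s = segment ℝ a b

/-- A closed ray. -/
def IsRay (s : Set Plane) : Prop :=
  ∃ a v : Plane, v ≠ 0 ∧ s = {x | ∃ t : ℝ, 0 ≤ t ∧ x = a + t • v}

/-- A union of finitely many segments and rays. -/
def IsFiniteUnion (C : Set Plane) : Prop :=
  ∃ S : Set (Set Plane), S.Finite ∧ (∀ s ∈ S, IsSegment s ∨ IsRay s) ∧ C = ⋃₀ S

/-- A smooth tropical curve in `ℝ²`. -/
def IsSmoothCurve (C : Set Plane) : Prop :=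
  IsFiniteUnion C ∧ ∀ p ∈ C, IsSmoothAt C p

/-- A nodal tropical curve in `ℝ²`. -/
def IsNodalCurve (C : Set Plane) : Prop :=
  IsFiniteUnion C ∧ ∀ p ∈ C, IsSmoothAt C p ∨ IsNode C p

/-- The multiplicity `|det (u, v)|` of a node `p` of `C` at which the lines are parallel to the
primitive vectors `u` and `v`.  These are unique up to sign and order, so the set below has exactly
one element at a node; it is empty, and the value `0`, when `p` is not a node. -/
noncomputable def nodeMultiplicity (C : Set Plane) (p : Plane) : ℕ :=
  sInf {m | ∃ u v, IsNodeWith C p u v ∧ m = (det₂ u v).natAbs}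

/-- The number of nodes of `C`, counted with multiplicity: the sum of `nodeMultiplicity C p` over
all points `p`, as the supremum of the finite partial sums. -/
noncomputable def nodeCount (C : Set Plane) : ℕ∞ :=
  ⨆ S : Finset Plane, ∑ p ∈ S, (nodeMultiplicity C p : ℕ∞)

/-! ### The abstract tropical curve of a nodal tropical curve -/

/-- For a placement `pos` of the vertices of `G` and directions `dir` of its half-edges, the relative
interior of the segment or ray that leaves the vertex of `h` in the direction `dir h` and has the
length of the edge of `h`, measured in multiples of `dir h`. -/
def openEdge (G : AbstractTropicalCurve) (pos : G.V → Plane) (dir : G.H → Fin 2 → ℤ) (h : G.H) :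
    Set Plane :=
  {x | ∃ t : ℝ, 0 < t ∧ ENNReal.ofReal t < G.len h ∧ x = pos (G.vert h) + t • toPlane (dir h)}

/-- `G` is the abstract tropical curve given by the nodal (or smooth) tropical curve `C`, for some way
of cutting `C` into segments and rays.  The finite vertices of `G` lie on `C` (the value of `pos` at
an infinite vertex plays no role); an edge with finite ends is a segment, and its length is its
length in multiples of a primitive integral vector; an edge with an infinite vertex is a ray.
The vertices and the relative interiors of the edges are pairwise disjoint, except that two vertices
of `G` lie over every node of `C`: each of them has degree two and is an end of the two edges
along one of the two lines at the node. -/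
structure Resolution (G : AbstractTropicalCurve) (C : Set Plane) where
  pos : G.V → Plane
  dir : G.H → Fin 2 → ℤ
  dir_primitive : ∀ h, IsPrimitive (dir h)
  dir_flip : ∀ h, dir (G.flip h) = - dir h
  finite_end : ∀ h, ¬ G.IsInf (G.vert h) ∨ ¬ G.IsInf (G.vert (G.flip h))
  pos_flip : ∀ h, G.len h ≠ ⊤ →
    pos (G.vert (G.flip h)) = pos (G.vert h) + (G.len h).toReal • toPlane (dir h)
  image_eq : C = {x | ∃ v, ¬ G.IsInf v ∧ x = pos v} ∪
    {x | ∃ h, ¬ G.IsInf (G.vert h) ∧ x ∈ openEdge G pos dir h}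
  edge_disjoint : ∀ h k, ¬ G.IsInf (G.vert h) → ¬ G.IsInf (G.vert k) → k ≠ h → k ≠ G.flip h →
    Disjoint (openEdge G pos dir h) (openEdge G pos dir k)
  vert_not_mem_edge : ∀ v h, ¬ G.IsInf v → ¬ G.IsInf (G.vert h) → pos v ∉ openEdge G pos dir h
  isNode_of_pos_eq : ∀ v w, ¬ G.IsInf v → ¬ G.IsInf w → v ≠ w → pos v = pos w → IsNode C (pos v)
  resolved : ∀ v, ¬ G.IsInf v → IsNode C (pos v) →
    ∃ h k, h ≠ k ∧ (∀ l, G.vert l = v ↔ l = h ∨ l = k) ∧ dir k = - dir h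

/-- The abstract tropical curve of `C` is isometric to a tropical modification of `Γ`. -/
def Realizes (C : Set Plane) (Γ : AbstractTropicalCurve) : Prop :=
  ∃ G : AbstractTropicalCurve, Γ.IsModification G ∧ Nonempty (Resolution G C)

/-- `C` is a (smooth) embedding of `Γ` in `ℝ²`. -/
def IsPlanarEmbedding (Γ : AbstractTropicalCurve) (C : Set Plane) : Prop :=
  IsSmoothCurve C ∧ Realizes C Γ

/-- `C` is an immersion of `Γ` in `ℝ²`. -/
def IsImmersion (Γ : AbstractTropicalCurve) (C : Set Plane) : Prop :=
  IsNodalCurve C ∧ Realizes C Γ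

/-- The tropical crossing number: the minimum over all planar immersions of the number of nodes
counted with multiplicity (`⊤` if there is no immersion). -/
noncomputable def crossingNumber (Γ : AbstractTropicalCurve) : ℕ∞ :=
  ⨅ (C : Set Plane) (_ : IsImmersion Γ C), nodeCount C

end TropicalCrossing

/-! Lower bound. The integral cycles of an abstract tropical curve, with the energy ∑ length · ω²,
form a lattice which tropical modifications do not change (`IsModification.cycleIsometric`); for the
theta graph with equal lengths it is the hexagonal lattice. A smooth plane curve is the corner locus
of a convex piecewise affine function with integral slopes, `height`. The slopes of the regions span
the Newton polygon, the curve is dual to a unimodular subdivision of it, and so every interior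
lattice point of the polygon is the slope of a bounded region (`exists_slope`). The boundary loops
of the bounded regions are a basis of the cycles (`card_bounded`). A smooth realization of the theta
graph thus has exactly two bounded regions, with slopes n₁ and n₂.

The lattice point 2n₁ - n₂ is not interior, as it would give a third bounded region. Hence some
covector v₁ takes the value 1 on n₁ - n₂ and is at most 1 on n - n₁ for all slopes n
(`exists_dual`); likewise there is v₂ for the exchanged pair. Pairing the closed boundary polygon of
the first region with v₁ shows that the common boundary is at most half of the perimeter, with
equality only if v₁ is 1 on n - n₁ for every other neighbour n (`two_mul_shared_le`). In the
hexagonal lattice the loops have norms N₁, N₂ and polar form Q with 4N₁N₂ - Q² = 3, and the two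
inequalities read -Q ≤ N₁, N₂. This forces N₁ = N₂ = 1 and Q = -1, so equality holds twice
(`energy_relation`). The third regions at the two ends of the common boundary then satisfy the
equations for both covectors, which is impossible (`no_dual_pair`).

No Jordan curve theorem is needed for the regions: a flow with values in an abelian group has as
potential the total flow across the part of a sweeping line below a point (`sweep`). The irrational
slope of the sweeping lines makes them transversal to all edges. A flow of affine forms yields the
height; a cycle yields its coefficients in the basis of loops.

Upper bound. An explicit curve, with edges cut into 15 units, immerses the graph with a single node
of multiplicity one (`exists_immersion`). -/

namespace TropicalCrossing

/-! ### The lattice of cycles and its invariance under tropical modification -/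

namespace AbstractTropicalCurve

noncomputable instance (G : AbstractTropicalCurve) : Fintype G.H :=
  haveI := G.finite_H
  Fintype.ofFinite _

noncomputable instance (G : AbstractTropicalCurve) : Fintype G.V :=
  haveI := G.finite_V
  Fintype.ofFinite _

open Classical in
/-- The integral cycles of an abstract tropical curve. -/
def cycles (G : AbstractTropicalCurve) : AddSubgroup (G.H → ℤ) where
  carrier := {ω | (∀ h, ω (G.flip h) = - ω h) ∧ ∀ v, ∑ h, (if G.vert h = v then ω h else 0) = 0}
  zero_mem' := by simp
  add_mem' := by
    rintro a b ⟨ha, ha'⟩ ⟨hb, hb'⟩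
    refine ⟨fun h => by simp [ha, hb]; ring, fun v => ?_⟩
    have : ∀ h, (if G.vert h = v then (a + b) h else 0) =
        (if G.vert h = v then a h else 0) + (if G.vert h = v then b h else 0) := by
      intro h; split_ifs <;> simp
    simp only [this, Finset.sum_add_distrib, ha', hb', add_zero]
  neg_mem' := by
    rintro a ⟨ha, ha'⟩
    refine ⟨fun h => by simp [ha], fun v => ?_⟩
    have : ∀ h, (if G.vert h = v then (-a) h else 0) = - (if G.vert h = v then a h else 0) := by
      intro h; split_ifs <;> simp
    simp only [this, Finset.sum_neg_distrib, ha', neg_zero]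

open Classical in
theorem mem_cycles {G : AbstractTropicalCurve} {ω : G.H → ℤ} : ω ∈ G.cycles ↔
    (∀ h, ω (G.flip h) = - ω h) ∧ ∀ v, ∑ h, (if G.vert h = v then ω h else 0) = 0 := Iff.rfl

/-- The energy of a cycle: each edge counts twice. -/
noncomputable def energy (G : AbstractTropicalCurve) (ω : G.H → ℤ) : ℝ :=
  ∑ h, (G.len h).toReal * (ω h : ℝ) ^ 2

/-- An energy preserving isomorphism between the groups of cycles exists. -/
def CycleIsometric (G G' : AbstractTropicalCurve) : Prop :=
  ∃ e : G.cycles ≃+ G'.cycles, ∀ ω, G'.energy (e ω) = G.energy ω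

theorem CycleIsometric.refl (G : AbstractTropicalCurve) : G.CycleIsometric G :=
  ⟨AddEquiv.refl _, fun _ => rfl⟩

theorem CycleIsometric.symm {G G' : AbstractTropicalCurve} (h : G.CycleIsometric G') :
    G'.CycleIsometric G := by
  obtain ⟨e, he⟩ := h
  exact ⟨e.symm, fun ω => by rw [← he, e.apply_symm_apply]⟩

theorem CycleIsometric.trans {G G' G'' : AbstractTropicalCurve} (h : G.CycleIsometric G')
    (h' : G'.CycleIsometric G'') : G.CycleIsometric G'' := by
  obtain ⟨e, he⟩ := h
  obtain ⟨e', he'⟩ := h'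
  exact ⟨e.trans e', fun ω => by rw [AddEquiv.trans_apply, he', he]⟩

/-- A cycle vanishes on the edge of an infinite vertex. -/
theorem eq_zero_of_isInf {G : AbstractTropicalCurve} {ω : G.H → ℤ} (hω : ω ∈ G.cycles) {h : G.H}
    (hh : G.IsInf (G.vert h)) : ω h = 0 := by
  classical
  obtain ⟨k, hk, -⟩ := G.isInf_spec _ hh
  obtain rfl := (hk h).1 rfl
  have := hω.2 (G.vert h)
  simpa [hk] using this

/-- A cycle vanishes on the edges of infinite length. -/
theorem eq_zero_of_len_eq_top {G : AbstractTropicalCurve} {ω : G.H → ℤ} (hω : ω ∈ G.cycles)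
    {h : G.H} (hh : G.len h = ⊤) : ω h = 0 := by
  rcases G.isInf_of_len h hh with h1 | h1
  · exact eq_zero_of_isInf hω h1
  · have := eq_zero_of_isInf hω h1
    rw [hω.1] at this
    simpa using this

/-- For isomorphisms, subdivisions and elementary modifications alike, the comparison map restricts
a cycle of `G'` to the half-edges of `G`. -/
theorem cycleIsometric_of_restrict {G G' : AbstractTropicalCurve} (r : (G'.H → ℤ) →+ (G.H → ℤ))
    (hr : ∀ ω ∈ G'.cycles, r ω ∈ G.cycles) (hinj : ∀ ω ∈ G'.cycles, r ω = 0 → ω = 0)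
    (hsurj : ∀ ω ∈ G.cycles, ∃ ω' ∈ G'.cycles, r ω' = ω)
    (hE : ∀ ω ∈ G'.cycles, G'.energy ω = G.energy (r ω)) : G.CycleIsometric G' := by
  let f : G'.cycles →+ G.cycles := (r.comp G'.cycles.subtype).codRestrict G.cycles
    (fun ω => hr ω.1 ω.2)
  have hf : Function.Bijective f := by
    refine ⟨(injective_iff_map_eq_zero f).2 fun ω h => ?_, fun ω => ?_⟩
    · exact Subtype.ext (hinj ω.1 ω.2 (congrArg Subtype.val h))
    · obtain ⟨ω', h1, h2⟩ := hsurj ω.1 ω.2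
      exact ⟨⟨ω', h1⟩, Subtype.ext h2⟩
  exact CycleIsometric.symm ⟨AddEquiv.ofBijective f hf, fun ω => (hE ω.1 ω.2).symm⟩

theorem Iso.cycleIsometric {G G' : AbstractTropicalCurve} (h : G.Iso G') :
    G.CycleIsometric G' := by
  classical
  obtain ⟨φ, ψ, h1, h2, h3, -⟩ := h
  have key : ∀ (ω : G'.H → ℤ) (v : G.V), ∑ h, (if G.vert h = v then ω (ψ h) else 0) =
      ∑ h, (if G'.vert h = φ v then ω h else 0) := by
    intro ω v
    rw [← ψ.sum_comp]
    simp [h1]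
  refine cycleIsometric_of_restrict ⟨⟨fun ω h => ω (ψ h), rfl⟩, fun _ _ => rfl⟩ ?_ ?_ ?_ ?_
  · rintro ω ⟨ha, hb⟩
    exact ⟨fun h => by simp [← h2, ha], fun v => (key ω v).trans (hb _)⟩
  · intro ω _ h0
    funext h
    simpa using congrFun h0 (ψ.symm h)
  · rintro ω ⟨ha, hb⟩
    refine ⟨fun h => ω (ψ.symm h), ⟨fun h => ?_, fun v => ?_⟩, by funext h; simp⟩
    · obtain ⟨h, rfl⟩ := ψ.surjective h
      simp [h2, ha]
    · obtain ⟨v, rfl⟩ := φ.surjective v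
      have := key (fun h => ω (ψ.symm h)) v
      rw [← this]
      simpa using hb v
  · intro ω _
    simp only [energy, AddMonoidHom.coe_mk, ZeroHom.coe_mk]
    rw [← ψ.sum_comp]
    simp [h3]

/-- Balance at the new vertex of degree two forces the same flow through both halves of the divided
edge, and the energies agree because the lengths add up. -/
theorem IsSubdivision.cycleIsometric {G G' : AbstractTropicalCurve} (h : G.IsSubdivision G') :
    G.CycleIsometric G' := by
  classical
  obtain ⟨h₀, φ, ψ, hv1, hv2, hf1, hf2, hother, hlen, -, -⟩ := h
  have hf1' : G'.flip (ψ (Sum.inr false)) = ψ (Sum.inl h₀) := by rw [← hf1, G'.flip_flip]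
  have hf2' : G'.flip (ψ (Sum.inr true)) = ψ (Sum.inl (G.flip h₀)) := by rw [← hf2, G'.flip_flip]
  have hne := G.flip_ne h₀
  have key : ∀ (ω : G'.H → ℤ) (v : G.V), ∑ h, (if G'.vert h = φ (some v) then ω h else 0) =
      ∑ h, (if G.vert h = v then ω (ψ (Sum.inl h)) else 0) := by
    intro ω v
    rw [← ψ.sum_comp]
    simp [hv1, hv2]
  have key0 : ∀ (ω : G'.H → ℤ), ∑ h, (if G'.vert h = φ none then ω h else 0) =
      ω (ψ (Sum.inr true)) + ω (ψ (Sum.inr false)) := by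
    intro ω
    rw [← ψ.sum_comp]
    simp [hv1, hv2]
  have hR : ∀ ω ∈ G'.cycles, (fun h => ω (ψ (Sum.inl h))) ∈ G.cycles := by
    rintro ω ⟨ha, hb⟩
    have e0 := (key0 ω).symm.trans (hb _)
    have e1 := ha (ψ (Sum.inl h₀))
    have e2 := ha (ψ (Sum.inl (G.flip h₀)))
    rw [hf1] at e1
    rw [hf2] at e2
    refine ⟨fun h => ?_, fun v => (key ω v).symm.trans (hb _)⟩
    by_cases c1 : h = h₀
    · subst c1; linarith
    by_cases c2 : h = G.flip h₀
    · subst c2; simp only [G.flip_flip]; linarith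
    · simp only [← (hother h c1 c2).1, ha]
  refine cycleIsometric_of_restrict ⟨⟨fun ω h => ω (ψ (Sum.inl h)), rfl⟩, fun _ _ => rfl⟩ hR ?_ ?_ ?_
  · rintro ω ⟨ha, hb⟩ h0
    have h0' : ∀ h, ω (ψ (Sum.inl h)) = 0 := fun h => congrFun h0 h
    funext h
    obtain ⟨h, rfl⟩ := ψ.surjective h
    rcases h with h | b
    · exact h0' h
    · cases b
      · rw [← hf1, ha, h0']; rfl
      · rw [← hf2, ha, h0']; rfl
  · rintro ω ⟨ha, hb⟩
    -- Antisymmetry dictates the values at the new vertex: `inr false` is opposite to `h₀`, and `inr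
    -- true` to `flip h₀`, where the cycle is `-ω h₀`.
    let ω' : G'.H → ℤ := fun h => Sum.elim ω (fun b => cond b (ω h₀) (- ω h₀)) (ψ.symm h)
    have w1 : ∀ h, ω' (ψ (Sum.inl h)) = ω h := fun h => by simp [ω']
    have w2 : ω' (ψ (Sum.inr true)) = ω h₀ := by simp [ω']
    have w3 : ω' (ψ (Sum.inr false)) = - ω h₀ := by simp [ω']
    refine ⟨ω', ⟨fun h => ?_, fun v => ?_⟩, by funext h; exact w1 h⟩
    · obtain ⟨h, rfl⟩ := ψ.surjective h
      rcases h with h | b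
      · by_cases c1 : h = h₀
        · subst c1; rw [hf1, w3, w1]
        by_cases c2 : h = G.flip h₀
        · subst c2; rw [hf2, w2, w1, ha]; simp
        · rw [(hother h c1 c2).1, w1, w1, ha]
      · cases b
        · rw [hf1', w1, w3]; simp
        · rw [hf2', w1, w2, ha]
    · obtain ⟨v, rfl⟩ := φ.surjective v
      rcases v with _ | v
      · rw [key0, w2, w3]; simp
      · rw [key]; simp only [w1]; exact hb v
  · intro ω hω
    have hω' := hR ω hω
    obtain ⟨ha, hb⟩ := hω
    simp only [energy, AddMonoidHom.coe_mk, ZeroHom.coe_mk]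
    rw [← ψ.sum_comp, Fintype.sum_sum_type, Fintype.sum_bool]
    have e1 := ha (ψ (Sum.inl h₀))
    have e2 := ha (ψ (Sum.inl (G.flip h₀)))
    have e3 := hω'.1 h₀
    simp only at e3
    rw [hf1] at e1
    rw [hf2] at e2
    have l1 : G'.len (ψ (Sum.inr false)) = G'.len (ψ (Sum.inl h₀)) := by rw [← hf1, G'.len_flip]
    have l2 : G'.len (ψ (Sum.inr true)) = G'.len (ψ (Sum.inl (G.flip h₀))) := by
      rw [← hf2, G'.len_flip]
    rw [e1, e2, l1, l2, e3]
    have split : ∀ g : G.H → ℝ, ∑ h, g h = g h₀ + g (G.flip h₀) +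
        ∑ h ∈ (Finset.univ.erase h₀).erase (G.flip h₀), g h := by
      intro g
      rw [add_assoc, Finset.add_sum_erase _ _ (by simp [hne]), Finset.add_sum_erase _ _ (by simp)]
    rw [split, split]
    have rest : ∑ h ∈ (Finset.univ.erase h₀).erase (G.flip h₀),
        (G'.len (ψ (Sum.inl h))).toReal * (ω (ψ (Sum.inl h)) : ℝ) ^ 2 =
        ∑ h ∈ (Finset.univ.erase h₀).erase (G.flip h₀),
        (G.len h).toReal * (ω (ψ (Sum.inl h)) : ℝ) ^ 2 := by
      refine Finset.sum_congr rfl fun h hh => ?_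
      simp only [Finset.mem_erase, Finset.mem_univ, and_true] at hh
      rw [(hother h hh.2 hh.1).2]
    rw [rest, G.len_flip, ← hlen, e3]
    -- `toReal` is not additive at infinite length, but there the cycle vanishes.
    by_cases ht : G.len h₀ = ⊤
    · have : ω (ψ (Sum.inl h₀)) = 0 := eq_zero_of_len_eq_top hω' ht
      simp [this]
    · rw [← hlen, ENNReal.add_eq_top, not_or] at ht
      rw [ENNReal.toReal_add ht.1 ht.2]
      push_cast
      ring

/-- An attached infinite edge carries no flow, since one of its ends has degree one. -/
theorem IsElementaryModification.cycleIsometric {G G' : AbstractTropicalCurve}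
    (h : G.IsElementaryModification G') : G.CycleIsometric G' := by
  classical
  obtain ⟨v₀, φ, ψ, -, hv1, hv2, hv3, hf1, hf2, hlen, hlt, -, hinf⟩ := h
  have hf2' : G'.flip (ψ (Sum.inr true)) = ψ (Sum.inr false) := by rw [← hf2, G'.flip_flip]
  have key : ∀ (ω : G'.H → ℤ), ω (ψ (Sum.inr false)) = 0 → ∀ (v : G.V),
      ∑ h, (if G'.vert h = φ (some v) then ω h else 0) =
      ∑ h, (if G.vert h = v then ω (ψ (Sum.inl h)) else 0) := by
    intro ω h0 v
    rw [← ψ.sum_comp]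
    simp [hv1, hv2, hv3, h0]
  have key0 : ∀ (ω : G'.H → ℤ), ∑ h, (if G'.vert h = φ none then ω h else 0) =
      ω (ψ (Sum.inr true)) := by
    intro ω
    rw [← ψ.sum_comp]
    simp [hv1, hv2, hv3]
  have hlt' : G'.len (ψ (Sum.inr true)) = ⊤ := by rw [← hf2, G'.len_flip, hlt]
  refine cycleIsometric_of_restrict ⟨⟨fun ω h => ω (ψ (Sum.inl h)), rfl⟩, fun _ _ => rfl⟩
    ?_ ?_ ?_ ?_
  · rintro ω hω
    have z := eq_zero_of_len_eq_top hω hlt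
    exact ⟨fun h => by simp [← hf1, hω.1], fun v => (key ω z v).symm.trans (hω.2 _)⟩
  · rintro ω hω h0
    funext h
    obtain ⟨h, rfl⟩ := ψ.surjective h
    rcases h with h | b
    · exact congrFun h0 h
    · cases b
      · exact eq_zero_of_len_eq_top hω hlt
      · exact eq_zero_of_len_eq_top hω hlt'
  · rintro ω ⟨ha, hb⟩
    let ω' : G'.H → ℤ := fun h => Sum.elim ω (fun _ => 0) (ψ.symm h)
    have w1 : ∀ h, ω' (ψ (Sum.inl h)) = ω h := fun h => by simp [ω']
    have w2 : ∀ b, ω' (ψ (Sum.inr b)) = 0 := fun b => by simp [ω']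
    refine ⟨ω', ⟨fun h => ?_, fun v => ?_⟩, by funext h; exact w1 h⟩
    · obtain ⟨h, rfl⟩ := ψ.surjective h
      rcases h with h | b
      · rw [hf1, w1, w1, ha]
      · cases b
        · rw [hf2, w2, w2]; rfl
        · rw [hf2', w2, w2]; rfl
    · obtain ⟨v, rfl⟩ := φ.surjective v
      rcases v with _ | v
      · rw [key0, w2]
      · rw [key _ (w2 _)]; simp only [w1]; exact hb v
  · intro ω hω
    simp only [energy, AddMonoidHom.coe_mk, ZeroHom.coe_mk]
    rw [← ψ.sum_comp, Fintype.sum_sum_type, Fintype.sum_bool]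
    simp [hlen, eq_zero_of_len_eq_top hω hlt, eq_zero_of_len_eq_top hω hlt']

theorem IsModification.cycleIsometric {G G' : AbstractTropicalCurve} (h : G.IsModification G') :
    G.CycleIsometric G' := by
  induction h with
  | refl => exact CycleIsometric.refl G
  | tail _ hs ih =>
    refine ih.trans ?_
    rcases hs with h | h | h | h
    · exact h.cycleIsometric
    · exact h.cycleIsometric
    · exact h.cycleIsometric.symm
    · exact h.cycleIsometric

end AbstractTropicalCurve

/-! ### The cycle lattice of the theta graph -/

open AbstractTropicalCurve

/-- The cycles of the theta graph with edges of equal length form a hexagonal lattice. -/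
theorem exists_addEquiv_cycles_theta (ℓ : Fin 3 → ℝ) (hℓ : ∀ i, 0 < ℓ i) (heq : ∀ i j, ℓ i = ℓ j) :
    ∃ e : (ℤ × ℤ) ≃+ (theta ℓ hℓ).cycles, ∀ x y : ℤ, (theta ℓ hℓ).energy (e (x, y)) =
      4 * ℓ 0 * ((x : ℝ) ^ 2 - x * y + (y : ℝ) ^ 2) := by
  classical
  -- `energy` and `cycles` sum over a noncomputable enumeration of the half-edges; it is exchanged
  -- for the standard one of `Fin 3 × Bool`.
  have hsum : ∀ {M : Type} [AddCommMonoid M] (g : (theta ℓ hℓ).H → M), ∑ h, g h =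
      ∑ h : Fin 3 × Bool, g h := by
    intro M _ g
    exact Finset.sum_congr (Finset.ext fun _ => iff_of_true (@Finset.mem_univ _ (_) _)
      (@Finset.mem_univ (Fin 3 × Bool) _ _)) fun _ _ => rfl
  -- The flows out of the vertex `true` are x, y - x and -y, with x² + (y - x)² + y² = 2(x² - xy +
  -- y²); each edge counts twice in the energy.
  let w : ℤ × ℤ → (theta ℓ hℓ).H → ℤ := fun p h =>
    (if h.2 then 1 else -1) * (![p.1, p.2 - p.1, - p.2] h.1)
  have hw : ∀ p, w p ∈ (theta ℓ hℓ).cycles := by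
    intro p
    refine ⟨?_, ?_⟩
    · rintro ⟨i, b⟩
      cases b <;> simp [w, theta]
    · intro v
      rw [hsum]
      simp only [theta, w, Fintype.sum_prod_type, Fin.sum_univ_three, Fintype.sum_bool]
      cases v <;> simp <;> ring
  let f : ℤ × ℤ →+ (theta ℓ hℓ).cycles :=
    { toFun := fun p => ⟨w p, hw p⟩
      map_zero' := by
        refine Subtype.ext (funext fun ⟨i, b⟩ => ?_)
        change w 0 (i, b) = 0
        fin_cases i <;> simp [w]
      map_add' := by
        rintro p q
        refine Subtype.ext (funext fun ⟨i, b⟩ => ?_)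
        change w (p + q) (i, b) = w p (i, b) + w q (i, b)
        fin_cases i <;> simp [w] <;> split_ifs <;> ring }
  have hf : Function.Bijective f := by
    refine ⟨(injective_iff_map_eq_zero f).2 ?_, ?_⟩
    · rintro ⟨x, y⟩ h
      have h' : w (x, y) = 0 := congrArg Subtype.val h
      have h1 : w (x, y) (0, true) = 0 := congrFun h' (0, true)
      have h2 : w (x, y) (2, true) = 0 := congrFun h' (2, true)
      simp [w] at h1 h2
      rw [h1, h2]; rfl
    · rintro ⟨ω, hω⟩
      refine ⟨(ω (0, true), - ω (2, true)), Subtype.ext ?_⟩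
      have h1 : ∀ i, ω (i, false) = - ω (i, true) := fun i => hω.1 (i, true)
      have h2 := hω.2 true
      rw [hsum] at h2
      simp only [theta, Fintype.sum_prod_type, Fin.sum_univ_three, Fintype.sum_bool] at h2
      simp at h2
      funext ⟨i, b⟩
      change w (ω (0, true), - ω (2, true)) (i, b) = ω (i, b)
      fin_cases i <;> cases b <;> simp [w, h1] <;> linarith
  refine ⟨AddEquiv.ofBijective f hf, fun x y => ?_⟩
  change (theta ℓ hℓ).energy (w (x, y)) = _
  rw [energy, hsum]
  have l0 : ∀ i, (ENNReal.ofReal (ℓ i)).toReal = ℓ 0 := fun i => by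
    rw [ENNReal.toReal_ofReal (hℓ i).le, heq i 0]
  simp only [theta, w, Fintype.sum_prod_type, Fin.sum_univ_three, Fintype.sum_bool, l0]
  simp
  ring

/-! ### Integral vectors and the local models of smooth points and nodes -/

open AbstractTropicalCurve Filter

theorem det₂_eq (u v : Fin 2 → ℤ) : det₂ u v = u 0 * v 1 - u 1 * v 0 := by
  simp [det₂, Matrix.det_fin_two_of]; ring

@[simp] theorem toPlane_apply (u : Fin 2 → ℤ) (i : Fin 2) : toPlane u i = (u i : ℝ) := rfl

theorem toPlane_neg (u : Fin 2 → ℤ) : toPlane (-u) = - toPlane u := by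
  ext i; simp

theorem IsPrimitive.ne_zero {u : Fin 2 → ℤ} (h : IsPrimitive u) : u ≠ 0 := by
  rintro rfl
  obtain ⟨a, b, hab⟩ := h
  simp at hab

theorem IsPrimitive.toPlane_ne_zero {u : Fin 2 → ℤ} (h : IsPrimitive u) : toPlane u ≠ 0 := by
  intro h0
  apply h.ne_zero
  funext i
  simpa using congrFun h0 i

theorem isPrimitive_of_det {u v : Fin 2 → ℤ} (h : det₂ u v = 1) : IsPrimitive u := by
  rw [det₂_eq] at h
  exact ⟨v 1, - v 0, by linarith⟩

theorem isPrimitive_of_det' {u v : Fin 2 → ℤ} (h : det₂ u v = 1) : IsPrimitive v := by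
  rw [det₂_eq] at h
  exact ⟨-u 1, u 0, by linarith⟩

theorem isPrimitive_neg {u : Fin 2 → ℤ} (h : IsPrimitive u) : IsPrimitive (-u) := by
  obtain ⟨a, b, hab⟩ := h
  exact ⟨-a, -b, by simp; linarith⟩

/-- A primitive vector has a Bézout companion. -/
theorem IsPrimitive.exists_det {u : Fin 2 → ℤ} (h : IsPrimitive u) : ∃ v, det₂ u v = 1 := by
  obtain ⟨a, b, hab⟩ := h
  exact ⟨![-b, a], by rw [det₂_eq]; simp; linarith⟩

theorem eq_or_eq_neg_of_parallel {u v : Fin 2 → ℤ} (hu : IsPrimitive u) (hv : IsPrimitive v)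
    (h : det₂ u v = 0) : v = u ∨ v = -u := by
  obtain ⟨w, hw⟩ := hu.exists_det
  obtain ⟨w', hw'⟩ := hv.exists_det
  rw [det₂_eq] at *
  -- `v = κ u` with `κ` an integer dividing one
  set κ := v 0 * w 1 - v 1 * w 0 with hκ
  have e0 : v 0 = κ * u 0 := by rw [hκ]; linear_combination (-v 0) * hw + w 0 * h
  have e1 : v 1 = κ * u 1 := by rw [hκ]; linear_combination (-v 1) * hw + w 1 * h
  have : κ * (u 0 * w' 1 - u 1 * w' 0) = 1 := by
    rw [e0, e1] at hw'; linear_combination hw'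
  rcases Int.isUnit_iff.1 (IsUnit.of_mul_eq_one _ this) with h1 | h1
  · left; funext i; fin_cases i <;> simp [e0, e1, h1]
  · right; funext i; fin_cases i <;> simp [e0, e1, h1]

theorem eq_of_toPlane_eq_smul {u v : Fin 2 → ℤ} (hu : IsPrimitive u) (hv : IsPrimitive v) {r : ℝ}
    (hr : 0 ≤ r) (h : toPlane v = r • toPlane u) : v = u := by
  have h0 : (v 0 : ℝ) = r * u 0 := by simpa using congrFun h 0
  have h1 : (v 1 : ℝ) = r * u 1 := by simpa using congrFun h 1
  have hd : det₂ u v = 0 := by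
    rw [det₂_eq]
    have : (u 0 : ℝ) * v 1 - u 1 * v 0 = 0 := by rw [h0, h1]; ring
    exact_mod_cast this
  rcases eq_or_eq_neg_of_parallel hu hv hd with h2 | h2
  · exact h2
  · exfalso
    have hne := hu.toPlane_ne_zero
    have : (1 + r) • toPlane u = 0 := by
      rw [add_smul, one_smul, ← h, h2, toPlane_neg]; simp
    rcases smul_eq_zero.1 this with h3 | h3
    · linarith
    · exact hne h3

/-- The local form of a smooth curve, with explicit primitive vectors. -/
theorem IsSmoothAt.exists_rays {C : Set Plane} {p : Plane} (h : IsSmoothAt C p) :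
    ∃ S : Set (Fin 2 → ℤ), LocallyAt C p {x | ∃ u ∈ S, ∃ t : ℝ, 0 ≤ t ∧ x = t • toPlane u} ∧
      ∃ a b, det₂ a b = 1 ∧ (S = {a, -a} ∨ S = {a, b, -(a + b)}) := by
  obtain ⟨M, A, hM, hl⟩ := h
  have hmap : ∀ u : Fin 2 → ℤ, (A : Matrix (Fin 2) (Fin 2) ℤ).map (Int.cast : ℤ → ℝ) *ᵥ toPlane u =
      toPlane ((A : Matrix (Fin 2) (Fin 2) ℤ) *ᵥ u) := by
    intro u; ext i
    fin_cases i <;> simp [Matrix.mulVec, dotProduct, Fin.sum_univ_two]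
  have himg : ∀ S : Set (Fin 2 → ℤ),
      (fun x => (A : Matrix (Fin 2) (Fin 2) ℤ).map (Int.cast : ℤ → ℝ) *ᵥ x) '' (fan S) =
      {x | ∃ u ∈ (fun u => (A : Matrix (Fin 2) (Fin 2) ℤ) *ᵥ u) '' S, ∃ t : ℝ, 0 ≤ t ∧
        x = t • toPlane u} := by
    intro S; ext x
    constructor
    · rintro ⟨_, ⟨u, hu, t, ht, rfl⟩, rfl⟩
      exact ⟨_, ⟨u, hu, rfl⟩, t, ht, by simp only [Matrix.mulVec_smul, hmap]⟩
    · rintro ⟨_, ⟨u, hu, rfl⟩, t, ht, rfl⟩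
      exact ⟨_, ⟨u, hu, t, ht, rfl⟩, by simp only [Matrix.mulVec_smul, hmap]⟩
  set a := (A : Matrix (Fin 2) (Fin 2) ℤ) *ᵥ ![1, 0] with ha
  set b := (A : Matrix (Fin 2) (Fin 2) ℤ) *ᵥ ![0, 1] with hb
  have hdet : det₂ a b = 1 ∨ det₂ a b = -1 := by
    have h1 : IsUnit (A : Matrix (Fin 2) (Fin 2) ℤ).det :=
      (Matrix.isUnit_iff_isUnit_det _).1 A.isUnit
    have : det₂ a b = (A : Matrix (Fin 2) (Fin 2) ℤ).det := by
      rw [det₂_eq, Matrix.det_fin_two, ha, hb]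
      simp [Matrix.mulVec, dotProduct, Fin.sum_univ_two]; ring
    rw [this]
    exact Int.isUnit_iff.1 h1
  have hna : (A : Matrix (Fin 2) (Fin 2) ℤ) *ᵥ ![-1, 0] = -a := by
    rw [ha, ← Matrix.mulVec_neg]; congr 1; simp
  have hnab : (A : Matrix (Fin 2) (Fin 2) ℤ) *ᵥ ![-1, -1] = -(a + b) := by
    rw [ha, hb, ← Matrix.mulVec_add, ← Matrix.mulVec_neg]; congr 1; simp
  rcases hM with rfl | rfl
  · rw [himg] at hl
    refine ⟨_, hl, ?_⟩
    rw [Set.image_pair, hna]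
    -- Determinant -1 is corrected by replacing b by -b for the line, and by exchanging a and b for
    -- the tripod.
    rcases hdet with h1 | h1
    · exact ⟨a, b, h1, Or.inl rfl⟩
    · exact ⟨a, -b, by rw [det₂_eq] at *; simp; linarith, Or.inl rfl⟩
  · rw [himg] at hl
    refine ⟨_, hl, ?_⟩
    rw [Set.image_insert_eq, Set.image_pair, hnab]
    rcases hdet with h1 | h1
    · exact ⟨a, b, h1, Or.inr rfl⟩
    · exact ⟨b, a, by rw [det₂_eq] at *; linarith, Or.inr (by rw [Set.insert_comm, add_comm])⟩

theorem LocallyAt.eventually_smul {C : Set Plane} {p : Plane} {K : Set Plane} (h : LocallyAt C p K)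
    (x : Plane) : ∀ᶠ t in 𝓝[>] (0 : ℝ), (p + t • x ∈ C ↔ t • x ∈ K) := by
  have : Tendsto (fun t : ℝ => p + t • x) (𝓝[>] 0) (𝓝 p) := by
    have hc : Continuous fun t : ℝ => p + t • x := by fun_prop
    have := hc.tendsto 0
    simp only [zero_smul, add_zero] at this
    exact this.mono_left nhdsWithin_le_nhds
  filter_upwards [this.eventually h] with t ht
  rw [ht, add_sub_cancel_left]

/-- A smooth point is not a node. -/
theorem IsSmoothAt.not_isNode {C : Set Plane} {p : Plane} (h : IsSmoothAt C p) : ¬ IsNode C p := by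
  obtain ⟨S, hS, a, b, hab, hSab⟩ := h.exists_rays
  rintro ⟨u, v, hu, hv, huv, hl⟩
  -- A primitive vector along one of the lines of the node is one of the rays of the smooth model.
  have key : ∀ w : Fin 2 → ℤ, IsPrimitive w →
      (∀ t : ℝ, t • toPlane w ∈ {x | ∃ t : ℝ, x = t • toPlane u ∨ x = t • toPlane v}) → w ∈ S := by
    intro w hw hmem
    have h1 := hS.eventually_smul (toPlane w)
    have h2 := hl.eventually_smul (toPlane w)
    obtain ⟨t, ⟨e1, e2⟩, ht⟩ := ((h1.and h2).and self_mem_nhdsWithin).exists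
    obtain ⟨u', hu', s, hs, e⟩ := e1.1 (e2.2 (hmem t))
    have ht' : (0 : ℝ) < t := ht
    have hprim : IsPrimitive u' := by
      have ha := isPrimitive_of_det hab
      have hb := isPrimitive_of_det' hab
      have hc : IsPrimitive (-(a + b)) := isPrimitive_of_det (v := -b) (by
        rw [det₂_eq] at *; simp; linarith)
      rcases hSab with rfl | rfl
      · rcases hu' with rfl | rfl
        · exact ha
        · exact isPrimitive_neg ha
      · rcases hu' with rfl | rfl | rfl
        · exact ha
        · exact hb
        · exact hc
    have : toPlane w = (t⁻¹ * s) • toPlane u' := by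
      rw [mul_smul, ← e, smul_smul, inv_mul_cancel₀ ht'.ne', one_smul]
    rw [eq_of_toPlane_eq_smul hprim hw (by positivity) this]
    exact hu'
  have m1 := key u hu fun t => ⟨t, Or.inl rfl⟩
  have m2 := key (-u) (isPrimitive_neg hu) fun t => ⟨-t, Or.inl (by rw [toPlane_neg]; simp)⟩
  have m3 := key v hv fun t => ⟨t, Or.inr rfl⟩
  rw [det₂_eq] at hab huv
  -- If the rays are a and -a, then u and v are parallel. A tripod contains no two opposite vectors,
  -- so it cannot contain both u and -u.
  rcases hSab with rfl | rfl
  · apply huv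
    rcases m1 with h1 | h1 <;> rcases m3 with h3 | h3 <;> rw [h1, h3] <;>
      first | ring1 | (simp only [Pi.neg_apply]; ring1)
  · rcases m1 with h1 | h1 | h1 <;> rcases m2 with h2 | h2 | h2 <;>
    · have e0 := congrFun h1 0
      have e1 := congrFun h1 1
      have f0 := congrFun h2 0
      have f1 := congrFun h2 1
      simp only [Pi.neg_apply, Pi.add_apply] at e0 e1 f0 f1
      first
      | (have z0 : a 0 = 0 := by omega
         have z1 : a 1 = 0 := by omega
         have : (0 : ℤ) = 1 := by linear_combination hab - b 1 * z0 + b 0 * z1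
         omega)
      | (have z0 : b 0 = 0 := by omega
         have z1 : b 1 = 0 := by omega
         have : (0 : ℤ) = 1 := by linear_combination hab - a 0 * z1 + a 1 * z0
         omega)
      | (have z0 : a 0 = - b 0 := by omega
         have z1 : a 1 = - b 1 := by omega
         have : (0 : ℤ) = 1 := by linear_combination hab - b 1 * z0 + b 0 * z1
         omega)

/-! ### From resolutions of smooth curves to plane graphs -/

/-- The finite part of an abstract tropical curve placed in the plane without crossings, balanced
and unimodular at every finite vertex. -/
structure PlaneGraph (G : AbstractTropicalCurve) where
  pos : G.V → Plane
  dir : G.H → Fin 2 → ℤ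
  dir_primitive : ∀ h, IsPrimitive (dir h)
  dir_flip : ∀ h, dir (G.flip h) = - dir h
  finite_end : ∀ h, ¬ G.IsInf (G.vert h) ∨ ¬ G.IsInf (G.vert (G.flip h))
  pos_flip : ∀ h, G.len h ≠ ⊤ →
    pos (G.vert (G.flip h)) = pos (G.vert h) + (G.len h).toReal • toPlane (dir h)
  edge_disjoint : ∀ h k, ¬ G.IsInf (G.vert h) → ¬ G.IsInf (G.vert k) → k ≠ h → k ≠ G.flip h →
    Disjoint (openEdge G pos dir h) (openEdge G pos dir k)
  vert_not_mem_edge : ∀ v h, ¬ G.IsInf v → ¬ G.IsInf (G.vert h) → pos v ∉ openEdge G pos dir h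
  pos_inj : ∀ v w, ¬ G.IsInf v → ¬ G.IsInf w → pos v = pos w → v = w
  star : ∀ v, ¬ G.IsInf v →
    (∃ k k', k' ≠ k ∧ (∀ h, G.vert h = v ↔ h = k ∨ h = k') ∧ dir k' = - dir k) ∨
    (∃ k₁ k₂ k₃, k₁ ≠ k₂ ∧ k₂ ≠ k₃ ∧ k₁ ≠ k₃ ∧ (∀ h, G.vert h = v ↔ h = k₁ ∨ h = k₂ ∨ h = k₃) ∧
      det₂ (dir k₁) (dir k₂) = 1 ∧ dir k₃ = -(dir k₁ + dir k₂))

theorem AbstractTropicalCurve.not_isInf_of_len_ne_top {G : AbstractTropicalCurve} {h : G.H}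
    (hh : G.len h ≠ ⊤) : ¬ G.IsInf (G.vert h) := by
  intro hi
  obtain ⟨k, hk, hk'⟩ := G.isInf_spec _ hi
  obtain rfl := (hk h).1 rfl
  exact hh hk'

section Extract

variable {G : AbstractTropicalCurve} {C : Set Plane}

theorem Resolution.mem_iff (R : Resolution G C) {x : Plane} : x ∈ C ↔
    (∃ v, ¬ G.IsInf v ∧ x = R.pos v) ∨
      ∃ h, ¬ G.IsInf (G.vert h) ∧ x ∈ openEdge G R.pos R.dir h :=
  Set.ext_iff.1 R.image_eq x

theorem Resolution.eventually_mem_openEdge (R : Resolution G C) {h : G.H} :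
    ∀ᶠ t in 𝓝[>] (0 : ℝ), R.pos (G.vert h) + t • toPlane (R.dir h) ∈ openEdge G R.pos R.dir h := by
  have h1 : Tendsto (fun t : ℝ => ENNReal.ofReal t) (𝓝[>] 0) (𝓝 0) := by
    have := ENNReal.continuous_ofReal.tendsto 0
    rw [ENNReal.ofReal_zero] at this
    exact this.mono_left nhdsWithin_le_nhds
  filter_upwards [h1.eventually_lt_const (G.len_pos h), self_mem_nhdsWithin] with t h1 h2
  exact ⟨t, h2, h1, rfl⟩

/-- Two half-edges leaving a vertex in the same direction would overlap close to it. -/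
theorem Resolution.dir_injOn (R : Resolution G C) {h k : G.H} (hv : G.vert h = G.vert k)
    (hf : ¬ G.IsInf (G.vert h)) (hd : R.dir h = R.dir k) : h = k := by
  by_contra hne
  have hk : k ≠ G.flip h := by
    rintro rfl
    rw [R.dir_flip] at hd
    apply (R.dir_primitive h).ne_zero
    funext i
    have := congrFun hd i
    simp at this ⊢
    omega
  have hdis := R.edge_disjoint h k hf (hv ▸ hf) (Ne.symm hne) hk
  obtain ⟨t, h1, h2⟩ := (R.eventually_mem_openEdge (h := h)).and
    (R.eventually_mem_openEdge (h := k)) |>.exists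
  rw [hv, hd] at h1
  exact Set.disjoint_left.1 hdis h1 h2

/-- The claim is clear unless `v` is on the line of `h` and `d` is parallel to it. Then `v` has a
parameter τ outside the open interval of the edge. If τ is an end of that interval, injectivity
makes `v` an end of `h`, and `d` points away from the edge because it is not the direction of a
half-edge at `v`. -/
theorem Resolution.eventually_not_mem_openEdge (R : Resolution G C)
    (hinj : ∀ v w, ¬ G.IsInf v → ¬ G.IsInf w → R.pos v = R.pos w → v = w)
    {v : G.V} (hv : ¬ G.IsInf v) {d : Fin 2 → ℤ} (hd : IsPrimitive d)
    (hno : ∀ h, G.vert h = v → R.dir h ≠ d) {h : G.H} (hh : ¬ G.IsInf (G.vert h)) :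
    ∀ᶠ t in 𝓝[>] (0 : ℝ), R.pos v + t • toPlane d ∉ openEdge G R.pos R.dir h := by
  set b := R.pos (G.vert h) with hb
  set e := R.dir h with he
  have hcont : Continuous fun t : ℝ => (e 0 : ℝ) * ((R.pos v + t • toPlane d) 1 - b 1) -
      e 1 * ((R.pos v + t • toPlane d) 0 - b 0) := by fun_prop
  have hmem : ∀ x, x ∈ openEdge G R.pos R.dir h → (e 0 : ℝ) * (x 1 - b 1) - e 1 * (x 0 - b 0) = 0 := by
    rintro x ⟨t, -, -, rfl⟩
    simp [← hb, ← he]; ring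
  by_cases h1 : (e 0 : ℝ) * (R.pos v 1 - b 1) - e 1 * (R.pos v 0 - b 0) = 0
  swap
  · have := (hcont.tendsto 0).eventually_ne (b₂ := 0) (by simpa using h1)
    filter_upwards [this.filter_mono nhdsWithin_le_nhds] with t ht hm
    exact ht (hmem _ hm)
  by_cases h2 : det₂ e d = 0
  swap
  · filter_upwards [self_mem_nhdsWithin] with t ht hm
    have h3 := hmem _ hm
    simp at h3
    rw [det₂_eq] at h2
    have h4 : t * ((e 0 : ℝ) * d 1 - e 1 * d 0) = 0 := by linear_combination h3 - h1
    rcases mul_eq_zero.1 h4 with h5 | h5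
    · exact (ne_of_gt ht) h5
    · exact h2 (by exact_mod_cast h5)
  obtain ⟨w, hw⟩ := (R.dir_primitive h).exists_det
  rw [← he, det₂_eq] at hw
  have hw' : (e 0 : ℝ) * w 1 - e 1 * w 0 = 1 := by exact_mod_cast hw
  obtain ⟨τ, hτ⟩ : ∃ τ : ℝ, R.pos v = b + τ • toPlane e := by
    refine ⟨(R.pos v 0 - b 0) * w 1 - (R.pos v 1 - b 1) * w 0, ?_⟩
    ext i; fin_cases i
    · simp; linear_combination (-(R.pos v 0 - b 0)) * hw' + w 0 * h1
    · simp; linear_combination (-(R.pos v 1 - b 1)) * hw' + w 1 * h1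
  have huniq : ∀ s s' : ℝ, b + s • toPlane e = b + s' • toPlane e → s = s' := by
    intro s s' hs
    exact smul_left_injective ℝ (R.dir_primitive h).toPlane_ne_zero (add_left_cancel hs)
  -- membership in terms of the parameter
  have hedge : ∀ s : ℝ, b + s • toPlane e ∈ openEdge G R.pos R.dir h →
      0 < s ∧ ENNReal.ofReal s < G.len h := by
    rintro s ⟨t, ht1, ht2, hs⟩
    have := huniq _ _ hs
    subst this
    exact ⟨ht1, ht2⟩
  have hnot : ¬ (0 < τ ∧ ENNReal.ofReal τ < G.len h) := fun hc =>
    R.vert_not_mem_edge v h hv hh (by rw [hτ]; exact ⟨τ, hc.1, hc.2, rfl⟩)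
  have hτv : τ = 0 → G.vert h = v := fun h0 =>
    hinj _ _ hh hv (by rw [hτ, h0]; simp [hb])
  have hτw : 0 < τ → ENNReal.ofReal τ = G.len h → G.vert (G.flip h) = v := fun h0 h1 => by
    have hl : G.len h ≠ ⊤ := by rw [← h1]; exact ENNReal.ofReal_ne_top
    refine hinj _ _ (not_isInf_of_len_ne_top (by rwa [G.len_flip])) hv ?_
    rw [R.pos_flip h hl, hτ, ← h1, ENNReal.toReal_ofReal h0.le]
  have evlen : ∀ ε : ℝ, G.len h < ENNReal.ofReal τ →
      ∀ᶠ t in 𝓝[>] (0 : ℝ), G.len h < ENNReal.ofReal (τ + ε * t) := by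
    intro ε hlt
    have hc : Continuous fun t : ℝ => ENNReal.ofReal (τ + ε * t) :=
      ENNReal.continuous_ofReal.comp (by fun_prop)
    have := (hc.tendsto 0).eventually_const_lt (u := G.len h) (by simpa using hlt)
    exact this.filter_mono nhdsWithin_le_nhds
  have evneg : ∀ ε : ℝ, τ < 0 → ∀ᶠ t in 𝓝[>] (0 : ℝ), τ + ε * t < 0 := by
    intro ε hlt
    have hc : Continuous fun t : ℝ => τ + ε * t := by fun_prop
    have := (hc.tendsto 0).eventually_lt_const (u := 0) (by simpa using hlt)
    exact this.filter_mono nhdsWithin_le_nhds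
  have main : ∀ ε : ℝ, (toPlane d = ε • toPlane e) → (τ = 0 → ε < 0) →
      (0 < τ → ENNReal.ofReal τ = G.len h → 0 < ε) →
      ∀ᶠ t in 𝓝[>] (0 : ℝ), R.pos v + t • toPlane d ∉ openEdge G R.pos R.dir h := by
    intro ε hε c0 c1
    have hx : ∀ t : ℝ, R.pos v + t • toPlane d = b + (τ + ε * t) • toPlane e := by
      intro t; rw [hτ, hε, add_smul, smul_smul, mul_comm ε t, add_assoc]
    rcases lt_trichotomy τ 0 with h3 | h3 | h3
    · filter_upwards [evneg ε h3] with t ht hm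
      rw [hx] at hm
      exact absurd (hedge _ hm).1 (not_lt.2 ht.le)
    · filter_upwards [self_mem_nhdsWithin] with t ht hm
      rw [hx] at hm
      have := (hedge _ hm).1
      have ht' : (0 : ℝ) < t := ht
      have := mul_neg_of_neg_of_pos (c0 h3) ht'
      linarith
    · have h4 : G.len h ≤ ENNReal.ofReal τ := not_lt.1 fun hc => hnot ⟨h3, hc⟩
      rcases h4.lt_or_eq with h5 | h5
      · filter_upwards [evlen ε h5] with t ht hm
        rw [hx] at hm
        exact absurd (hedge _ hm).2 (not_lt.2 ht.le)
      · filter_upwards [self_mem_nhdsWithin] with t ht hm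
        rw [hx] at hm
        have h6 := (hedge _ hm).2
        rw [h5] at h6
        have ht' : (0 : ℝ) < t := ht
        have h7 := mul_pos (c1 h3 h5.symm) ht'
        exact absurd h6 (not_lt.2 (ENNReal.ofReal_le_ofReal (by linarith)))
  rcases eq_or_eq_neg_of_parallel (R.dir_primitive h) hd h2 with h3 | h3
  · refine main 1 (by rw [h3, one_smul]) (fun h0 => ?_) (fun _ _ => one_pos)
    exact absurd h3.symm (hno h (hτv h0))
  · refine main (-1) (by rw [h3, toPlane_neg]; simp [he]) (fun _ => by norm_num) (fun h0 h1 => ?_)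
    exact absurd (by rw [R.dir_flip, h3]) (hno (G.flip h) (hτw h0 h1))

/-- In a direction of no half-edge at `v`, points close to `v` avoid each of the finitely many edges
and vertices, hence the curve. -/
theorem Resolution.exists_dir_eq (R : Resolution G C)
    (hinj : ∀ v w, ¬ G.IsInf v → ¬ G.IsInf w → R.pos v = R.pos w → v = w)
    {v : G.V} (hv : ¬ G.IsInf v) {d : Fin 2 → ℤ} (hd : IsPrimitive d)
    (hC : ∀ᶠ t in 𝓝[>] (0 : ℝ), R.pos v + t • toPlane d ∈ C) : ∃ h, G.vert h = v ∧ R.dir h = d := by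
  by_contra! hno
  have := G.finite_H
  have := G.finite_V
  have h1 : ∀ᶠ t in 𝓝[>] (0 : ℝ), ∀ h, ¬ G.IsInf (G.vert h) →
      R.pos v + t • toPlane d ∉ openEdge G R.pos R.dir h := by
    rw [eventually_all]
    intro h
    by_cases hh : G.IsInf (G.vert h)
    · exact Eventually.of_forall fun _ h0 => absurd hh h0
    · filter_upwards [R.eventually_not_mem_openEdge hinj hv hd hno hh] with t ht _ using ht
  have h2 : ∀ᶠ t in 𝓝[>] (0 : ℝ), ∀ w, ¬ G.IsInf w → R.pos v + t • toPlane d ≠ R.pos w := by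
    rw [eventually_all]
    intro w
    by_cases hw : w = v
    · filter_upwards [self_mem_nhdsWithin] with t ht _ he
      rw [hw] at he
      rcases smul_eq_zero.1 (add_eq_left.1 he) with h3 | h3
      · exact (ne_of_gt ht) h3
      · exact hd.toPlane_ne_zero h3
    · by_cases hw' : G.IsInf w
      · exact Eventually.of_forall fun _ h0 => absurd hw' h0
      · have hc : Continuous fun t : ℝ => R.pos v + t • toPlane d := by fun_prop
        have := (hc.tendsto 0).eventually_ne (b₂ := R.pos w)
          (by simpa using fun h0 => hw (hinj _ _ hw' hv h0.symm))
        filter_upwards [this.filter_mono nhdsWithin_le_nhds] with t ht _ using ht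
  obtain ⟨t, ⟨ht1, ht2⟩, ht3⟩ := ((h1.and h2).and hC).exists
  rcases R.mem_iff.1 ht3 with ⟨w, hw, e⟩ | ⟨h, hh, hm⟩
  · exact ht2 w hw e
  · exact ht1 h hh hm

/-- A resolution of a smooth curve is a plane graph. -/
def Resolution.toPlaneGraph (R : Resolution G C) (hC : ∀ p ∈ C, IsSmoothAt C p) : PlaneGraph G :=
  -- Two vertices at one point would make it a node, which a smooth point is not.
  have hinj : ∀ v w, ¬ G.IsInf v → ¬ G.IsInf w → R.pos v = R.pos w → v = w := by
    intro v w hv hw he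
    by_contra hne
    have hm : R.pos v ∈ C := R.mem_iff.2 <| Or.inl ⟨v, hv, rfl⟩
    exact (hC _ hm).not_isNode (R.isNode_of_pos_eq v w hv hw hne he)
  { pos := R.pos
    dir := R.dir
    dir_primitive := R.dir_primitive
    dir_flip := R.dir_flip
    finite_end := R.finite_end
    pos_flip := R.pos_flip
    edge_disjoint := R.edge_disjoint
    vert_not_mem_edge := R.vert_not_mem_edge
    pos_inj := hinj
    star := by
      intro v hv
      have hm : R.pos v ∈ C := R.mem_iff.2 <| Or.inl ⟨v, hv, rfl⟩
      obtain ⟨S, hS, a, b, hab, hSab⟩ := (hC _ hm).exists_rays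
      have ha := isPrimitive_of_det hab
      have hb := isPrimitive_of_det' hab
      have hc : IsPrimitive (-(a + b)) := isPrimitive_of_det (v := -b) (by
        rw [det₂_eq] at *; simp; linarith)
      have hprim : ∀ u ∈ S, IsPrimitive u := by
        rcases hSab with rfl | rfl
        · rintro u (rfl | rfl)
          · exact ha
          · exact isPrimitive_neg ha
        · rintro u (rfl | rfl | rfl)
          · exact ha
          · exact hb
          · exact hc
      have h1 : ∀ u ∈ S, ∃ h, G.vert h = v ∧ R.dir h = u := by
        intro u hu
        refine R.exists_dir_eq hinj hv (hprim u hu) ?_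
        filter_upwards [hS.eventually_smul (toPlane u), self_mem_nhdsWithin] with t ht ht0
        exact ht.2 ⟨u, hu, t, (le_of_lt ht0), rfl⟩
      have h2 : ∀ h, G.vert h = v → R.dir h ∈ S := by
        rintro h rfl
        obtain ⟨t, ⟨e1, e2⟩, ht⟩ := (((hS.eventually_smul (toPlane (R.dir h))).and
          (R.eventually_mem_openEdge (h := h))).and self_mem_nhdsWithin).exists
        have e3 : R.pos (G.vert h) + t • toPlane (R.dir h) ∈ C :=
          R.mem_iff.2 <| Or.inr ⟨h, hv, e2⟩
        obtain ⟨u, hu, s, hs, e⟩ := e1.1 e3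
        have ht' : (0 : ℝ) < t := ht
        have : toPlane (R.dir h) = (t⁻¹ * s) • toPlane u := by
          rw [mul_smul, ← e, smul_smul, inv_mul_cancel₀ ht'.ne', one_smul]
        rw [eq_of_toPlane_eq_smul (hprim u hu) (R.dir_primitive h) (by positivity) this]
        exact hu
      have hdist : ∀ k k', R.dir k ≠ R.dir k' → k ≠ k' := fun k k' h0 h1 => h0 (by rw [h1])
      rw [det₂_eq] at hab
      rcases hSab with rfl | rfl
      · left
        obtain ⟨k, hk, hka⟩ := h1 a (by simp)
        obtain ⟨k', hk', hka'⟩ := h1 (-a) (by simp)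
        refine ⟨k, k', hdist _ _ ?_, fun h => ⟨fun hh => ?_, ?_⟩, by rw [hka, hka']⟩
        · rw [hka, hka']
          intro h0
          have e0 := congrFun h0 0
          have e1 := congrFun h0 1
          simp only [Pi.neg_apply] at e0 e1
          have z0 : a 0 = 0 := by omega
          have z1 : a 1 = 0 := by omega
          simp [z0, z1] at hab
        · rcases h2 h hh with h3 | h3
          · left; exact R.dir_injOn (by rw [hh, hk]) (by rw [hh]; exact hv) (by rw [h3, hka])
          · right; exact R.dir_injOn (by rw [hh, hk']) (by rw [hh]; exact hv) (by rw [h3, hka'])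
        · rintro (rfl | rfl)
          · exact hk
          · exact hk'
      · right
        obtain ⟨k, hk, hka⟩ := h1 a (by simp)
        obtain ⟨k', hk', hka'⟩ := h1 b (by simp)
        obtain ⟨k'', hk'', hka''⟩ := h1 (-(a + b)) (by simp)
        refine ⟨k, k', k'', hdist _ _ ?_, hdist _ _ ?_, hdist _ _ ?_, fun h => ⟨fun hh => ?_, ?_⟩,
          by rw [hka, hka', det₂_eq]; exact hab, by rw [hka, hka', hka'']⟩
        · rw [hka, hka']
          intro h0
          rw [h0] at hab
          have : (0 : ℤ) = 1 := by linear_combination hab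
          omega
        · rw [hka', hka'']
          intro h0
          have e0 := congrFun h0 0
          have e1 := congrFun h0 1
          simp only [Pi.neg_apply, Pi.add_apply] at e0 e1
          have z0 : a 0 = - 2 * b 0 := by omega
          have z1 : a 1 = - 2 * b 1 := by omega
          have : (0 : ℤ) = 1 := by linear_combination hab - b 1 * z0 + b 0 * z1
          omega
        · rw [hka, hka'']
          intro h0
          have e0 := congrFun h0 0
          have e1 := congrFun h0 1
          simp only [Pi.neg_apply, Pi.add_apply] at e0 e1
          have z0 : b 0 = - 2 * a 0 := by omega
          have z1 : b 1 = - 2 * a 1 := by omega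
          have : (0 : ℤ) = 1 := by linear_combination hab - a 0 * z1 + a 1 * z0
          omega
        · rcases h2 h hh with h3 | h3 | h3
          · left; exact R.dir_injOn (by rw [hh, hk]) (by rw [hh]; exact hv) (by rw [h3, hka])
          · right; left
            exact R.dir_injOn (by rw [hh, hk']) (by rw [hh]; exact hv) (by rw [h3, hka'])
          · right; right
            exact R.dir_injOn (by rw [hh, hk'']) (by rw [hh]; exact hv) (by rw [h3, hka''])
        · rintro (rfl | rfl | rfl)
          · exact hk
          · exact hk'
          · exact hk'' }

end Extract

/-! ### Sweeping lines, sides and edges -/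

/-- A linear form without integral zeros, used as the sweeping direction. -/
noncomputable def lev (x : Plane) : ℝ := x 0 + √2 * x 1

theorem continuous_lev : Continuous lev := by unfold lev; fun_prop

/-- Irrationality of √2. Hence no edge lies in a sweeping line, and every half-edge points strictly
upwards or strictly downwards. -/
theorem lev_toPlane_ne_zero {d : Fin 2 → ℤ} (hd : d ≠ 0) : lev (toPlane d) ≠ 0 := by
  intro h
  simp only [lev, toPlane_apply] at h
  by_cases h1 : d 1 = 0
  · apply hd
    funext i
    fin_cases i
    · simpa [h1] using h
    · exact h1
  · apply irrational_sqrt_two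
    refine ⟨-(d 0 : ℚ) / d 1, ?_⟩
    have : (d 1 : ℝ) ≠ 0 := by exact_mod_cast h1
    push_cast
    field_simp
    linarith

/-- The determinant of an integral vector and a vector of the plane. -/
def cr (d : Fin 2 → ℤ) (y : Plane) : ℝ := d 0 * y 1 - d 1 * y 0

theorem continuous_cr (d : Fin 2 → ℤ) : Continuous (cr d) := by unfold cr; fun_prop

theorem cr_neg_left (d : Fin 2 → ℤ) (y : Plane) : cr (-d) y = - cr d y := by
  simp [cr]; ring

theorem cr_sub (d : Fin 2 → ℤ) (x y : Plane) : cr d (x - y) = cr d x - cr d y := by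
  simp [cr]; ring

theorem lev_sub (x y : Plane) : lev (x - y) = lev x - lev y := by
  simp [lev]; ring

theorem lev_smul_eq {d : Fin 2 → ℤ} {y : Plane} (h : cr d y = 0) :
    lev (toPlane d) • y = lev y • toPlane d := by
  simp only [cr] at h
  ext i
  fin_cases i
  · simp [lev]; linear_combination -√2 * h
  · simp [lev]; linear_combination h

/-- On a sweeping line the second coordinate serves as a parameter; it decides on which side of an
upward edge ending on that line a point lies. -/
theorem cr_of_lev_eq {d : Fin 2 → ℤ} {x y : Plane} (h : lev x = lev y) :
    cr d (x - y) = (x 1 - y 1) * lev (toPlane d) := by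
  simp only [lev] at h
  simp [lev, cr]; linear_combination (-(d 1 : ℝ)) * h

theorem eq_of_lev_eq {x y : Plane} (h : lev x = lev y) (h1 : x 1 = y 1) : x = y := by
  ext i
  fin_cases i
  · simp only [lev, h1] at h; simpa using h
  · exact h1

namespace PlaneGraph

variable {G : AbstractTropicalCurve} (P : PlaneGraph G)

open Classical in
/-- A finite end of an edge. -/
noncomputable def base (h : G.H) : Plane :=
  if G.IsInf (G.vert h) then P.pos (G.vert (G.flip h)) else P.pos (G.vert h)

/-- The affine form vanishing on the line of an edge, positive to its left. -/
noncomputable def side (h : G.H) (x : Plane) : ℝ := cr (P.dir h) (x - P.base h)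

theorem continuous_side (h : G.H) : Continuous (P.side h) :=
  (continuous_cr _).comp (by fun_prop)

theorem len_ne_top {h : G.H} (h1 : ¬ G.IsInf (G.vert h)) (h2 : ¬ G.IsInf (G.vert (G.flip h))) :
    G.len h ≠ ⊤ := fun ht => (G.isInf_of_len h ht).elim h1 h2

theorem side_of_vert {h : G.H} (h1 : ¬ G.IsInf (G.vert h)) (x : Plane) :
    P.side h x = cr (P.dir h) (x - P.pos (G.vert h)) := by
  rw [side, base, if_neg h1]

theorem side_of_flip {h : G.H} (h1 : ¬ G.IsInf (G.vert (G.flip h))) (x : Plane) :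
    P.side h x = cr (P.dir h) (x - P.pos (G.vert (G.flip h))) := by
  by_cases h2 : G.IsInf (G.vert h)
  · rw [side, base, if_pos h2]
  · rw [P.side_of_vert h2, P.pos_flip h (len_ne_top h2 h1)]
    simp [cr]; ring

theorem side_flip (h : G.H) (x : Plane) : P.side (G.flip h) x = - P.side h x := by
  rcases P.finite_end h with h1 | h1
  · rw [P.side_of_vert h1, P.side_of_flip (by rwa [G.flip_flip]), G.flip_flip, P.dir_flip,
      cr_neg_left]
  · rw [P.side_of_flip h1, P.side_of_vert h1, P.dir_flip, cr_neg_left]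

theorem side_sub (h : G.H) (x z : Plane) : P.side h x - P.side h z = cr (P.dir h) (x - z) := by
  simp [side, cr]; ring

theorem side_of_eq_zero {h : G.H} {z : Plane} (hz : P.side h z = 0) (x : Plane) :
    P.side h x = cr (P.dir h) (x - z) := by
  rw [← P.side_sub, hz, sub_zero]

theorem lev_dir_ne_zero (h : G.H) : lev (toPlane (P.dir h)) ≠ 0 :=
  lev_toPlane_ne_zero (P.dir_primitive h).ne_zero

theorem lev_dir_flip (h : G.H) :
    lev (toPlane (P.dir (G.flip h))) = - lev (toPlane (P.dir h)) := by
  rw [P.dir_flip]; simp [lev]; ring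

/-- The relative interior of an edge. -/
def edge (h : G.H) : Set Plane := {x | P.side h x = 0 ∧
  (¬ G.IsInf (G.vert h) → 0 < lev (toPlane (P.dir h)) * (lev x - lev (P.pos (G.vert h)))) ∧
  (¬ G.IsInf (G.vert (G.flip h)) →
    0 < lev (toPlane (P.dir (G.flip h))) * (lev x - lev (P.pos (G.vert (G.flip h)))))}

theorem edge_flip (h : G.H) : P.edge (G.flip h) = P.edge h := by
  ext x
  simp only [edge, Set.mem_ofPred_eq, side_flip, G.flip_flip, neg_eq_zero]
  tauto

/-- The parameter of a point on the edge is a ratio of values of `lev`. So bounds on the parameter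
become bounds on levels, which treat the two ends alike. -/
theorem mem_edge_iff {h : G.H} (hh : ¬ G.IsInf (G.vert h)) (x : Plane) :
    x ∈ P.edge h ↔ x ∈ openEdge G P.pos P.dir h := by
  have hd := P.lev_dir_ne_zero h
  have hd2 : 0 < lev (toPlane (P.dir h)) ^ 2 := by positivity
  have hend : ∀ t : ℝ, 0 < t → (ENNReal.ofReal t < G.len h ↔ (¬ G.IsInf (G.vert (G.flip h)) →
      0 < lev (toPlane (P.dir (G.flip h))) * (lev (P.pos (G.vert h) + t • toPlane (P.dir h))
        - lev (P.pos (G.vert (G.flip h)))))) := by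
    intro t ht
    by_cases hi : G.IsInf (G.vert (G.flip h))
    · have : G.len h = ⊤ := by
        by_contra hl
        exact not_isInf_of_len_ne_top (h := G.flip h) (by rwa [G.len_flip]) hi
      simp [this, hi]
    · have hl := len_ne_top hh hi
      have e : lev (toPlane (P.dir (G.flip h))) * (lev (P.pos (G.vert h) + t • toPlane (P.dir h))
        - lev (P.pos (G.vert (G.flip h)))) =
          lev (toPlane (P.dir h)) ^ 2 * ((G.len h).toReal - t) := by
        rw [P.pos_flip h hl, P.lev_dir_flip]
        simp [lev]; ring
      rw [e, mul_pos_iff_of_pos_left hd2, sub_pos, ENNReal.ofReal_lt_iff_lt_toReal ht.le hl]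
      simp [hi]
  constructor
  · rintro ⟨h1, h2, h3⟩
    rw [P.side_of_vert hh] at h1
    set t := lev (x - P.pos (G.vert h)) / lev (toPlane (P.dir h)) with ht
    have hx : x = P.pos (G.vert h) + t • toPlane (P.dir h) := by
      have := lev_smul_eq h1
      rw [ht, div_eq_inv_mul, mul_smul, ← this, smul_smul, inv_mul_cancel₀ hd, one_smul]
      abel
    have ht0 : 0 < t := by
      have := h2 hh
      rw [← lev_sub] at this
      rw [ht, ← mul_div_mul_left _ _ hd, ← sq]
      positivity
    refine ⟨t, ht0, (hend t ht0).2 ?_, hx⟩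
    rw [← hx]; exact h3
  · rintro ⟨t, ht0, hl, rfl⟩
    refine ⟨?_, fun _ => ?_, (hend t ht0).1 hl⟩
    · rw [P.side_of_vert hh]; simp [cr]; ring
    · have : lev (toPlane (P.dir h)) *
          (lev (P.pos (G.vert h) + t • toPlane (P.dir h)) - lev (P.pos (G.vert h))) =
          lev (toPlane (P.dir h)) ^ 2 * t := by simp [lev]; ring
      rw [this]; positivity

theorem eq_of_mem_edge {h k : G.H} {x : Plane} (hx : x ∈ P.edge h) (hx' : x ∈ P.edge k) :
    k = h ∨ k = G.flip h := by
  by_contra! hne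
  have key : ∀ h k : G.H, ¬ G.IsInf (G.vert h) → ¬ G.IsInf (G.vert k) → x ∈ P.edge h →
      x ∈ P.edge k → k ≠ h → k ≠ G.flip h → False := by
    intro h k hh hk h1 h2 h3 h4
    exact Set.disjoint_left.1 (P.edge_disjoint h k hh hk h3 h4) ((P.mem_edge_iff hh x).1 h1)
      ((P.mem_edge_iff hk x).1 h2)
  have h2 : G.flip k ≠ G.flip h := fun h0 => hne.1 (by rw [← G.flip_flip k, h0, G.flip_flip])
  have h3 : G.flip k ≠ h := fun h0 => hne.2 (by rw [← h0, G.flip_flip])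
  rcases P.finite_end h with a | a <;> rcases P.finite_end k with b | b
  · exact key _ _ a b hx hx' hne.1 hne.2
  · exact key _ _ a b hx (by rwa [P.edge_flip]) h3 h2
  · exact key _ _ a b (by rwa [P.edge_flip]) hx' hne.2 (by rw [G.flip_flip]; exact hne.1)
  · exact key _ _ a b (by rwa [P.edge_flip]) (by rwa [P.edge_flip]) h2 (by rwa [G.flip_flip])

theorem pos_not_mem_edge {v : G.V} (hv : ¬ G.IsInf v) (h : G.H) : P.pos v ∉ P.edge h := by
  intro hm
  rcases P.finite_end h with a | a
  · exact P.vert_not_mem_edge v h hv a ((P.mem_edge_iff a _).1 hm)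
  · rw [← P.edge_flip] at hm
    exact P.vert_not_mem_edge v _ hv a ((P.mem_edge_iff a _).1 hm)

/-! ### Flows and their potentials -/

open Classical in
/-- A flow with values in `M`: antisymmetric, and balanced at the finite vertices. -/
def IsFlow {M : Type} [AddCommGroup M] (G : AbstractTropicalCurve) (W : G.H → M) : Prop :=
  (∀ h, W (G.flip h) = - W h) ∧
    ∀ v, ¬ G.IsInf v → ∑ h, (if G.vert h = v then W h else 0) = 0

/-- The half-edge `h` points upwards and its edge separates `x` from the lower end of the sweeping
line through `x`. -/
def Below (h : G.H) (x : Plane) : Prop :=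
  0 < lev (toPlane (P.dir h)) ∧ (¬ G.IsInf (G.vert h) → lev (P.pos (G.vert h)) ≤ lev x) ∧
  (¬ G.IsInf (G.vert (G.flip h)) → lev x < lev (P.pos (G.vert (G.flip h)))) ∧ 0 < P.side h x

variable {M : Type} [AddCommGroup M]

open Classical in
/-- The potential of a flow: the total flow across the lower part of the sweeping line. -/
noncomputable def sweep (W : G.H → M) (x : Plane) : M := ∑ h, if P.Below h x then W h else 0

open Classical in
/-- The contribution of a half-edge at the vertex `z` to the potential near `z`. -/
noncomputable def starTerm (W : G.H → M) (z : Plane) (k : G.H) (x : Plane) : M :=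
  if 0 < lev (toPlane (P.dir k)) then
    (if lev z ≤ lev x ∧ 0 < cr (P.dir k) (x - z) then W k else 0)
  else (if lev x < lev z ∧ cr (P.dir k) (x - z) < 0 then - W k else 0)

open Classical in
/-- The contribution near `z` of a half-edge at a vertex on the sweeping line through `z`. -/
noncomputable def levelTerm (W : G.H → M) (z : Plane) (k : G.H) (x : Plane) : M :=
  if ¬ G.IsInf (G.vert k) ∧ lev (P.pos (G.vert k)) = lev z then
    (if P.pos (G.vert k) = z then P.starTerm W z k x else
      if lev z ≤ lev x ∧ P.pos (G.vert k) 1 < z 1 then W k else 0)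
  else 0

theorem lev_lt_of_up {h : G.H} (hu : 0 < lev (toPlane (P.dir h))) (h1 : ¬ G.IsInf (G.vert h))
    (h2 : ¬ G.IsInf (G.vert (G.flip h))) :
    lev (P.pos (G.vert h)) < lev (P.pos (G.vert (G.flip h))) := by
  have hl := len_ne_top h1 h2
  have h0 : 0 < (G.len h).toReal := ENNReal.toReal_pos (G.len_pos h).ne' hl
  rw [P.pos_flip h hl]
  have : lev (P.pos (G.vert h) + (G.len h).toReal • toPlane (P.dir h)) =
      lev (P.pos (G.vert h)) + (G.len h).toReal * lev (toPlane (P.dir h)) := by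
    simp [lev]; ring
  rw [this]
  have := mul_pos h0 hu
  linarith

-- Only levels matter. An edge strictly above or strictly below the level of `z` is not counted near
-- `z`; an edge crossing that level away from `z` has a locally constant indicator; an edge through
-- `z` contributes its jump. The remaining case, an end on the level of `z`, is recorded by
-- `levelTerm`.
open Classical in
theorem exists_below_eq {W : G.H → M} (hW : IsFlow G W) (z : Plane) {h : G.H}
    (hu : 0 < lev (toPlane (P.dir h))) :
    ∃ c, ∀ᶠ x in 𝓝 z, (if P.Below h x then W h else 0) = c +
      (if z ∈ P.edge h ∧ 0 < cr (P.dir h) (x - z) then W h else 0) +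
      (P.levelTerm W z h x + P.levelTerm W z (G.flip h) x) := by
  have hL := continuous_lev.tendsto z
  have hS := (P.continuous_side h).tendsto z
  have hnu : ¬ 0 < lev (toPlane (P.dir (G.flip h))) := by
    rw [P.lev_dir_flip]; linarith
  by_cases c1 : ¬ G.IsInf (G.vert h) ∧ lev z ≤ lev (P.pos (G.vert h))
  · obtain ⟨ha, c1⟩ := c1
    have hz : z ∉ P.edge h := by
      rintro ⟨-, h2, -⟩
      have := h2 ha
      rw [mul_pos_iff_of_pos_left hu] at this
      linarith
    have k2 : ∀ x, P.levelTerm W z (G.flip h) x = 0 := by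
      intro x
      rw [levelTerm, if_neg]
      rintro ⟨hb, hb'⟩
      have := P.lev_lt_of_up hu ha hb
      linarith
    rcases c1.lt_or_eq with c1 | c1
    · refine ⟨0, ?_⟩
      filter_upwards [hL.eventually_lt_const c1] with x hx
      rw [k2, if_neg (fun hb => absurd (hb.2.1 ha) (not_le.2 hx)), if_neg (fun hc => hz hc.1),
        levelTerm, if_neg (fun hc => c1.ne' hc.2)]
      simp
    · have hend : ∀ᶠ x in 𝓝 z, ¬ G.IsInf (G.vert (G.flip h)) →
          lev x < lev (P.pos (G.vert (G.flip h))) := by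
        by_cases hb : G.IsInf (G.vert (G.flip h))
        · exact Eventually.of_forall fun _ h0 => absurd hb h0
        · have := P.lev_lt_of_up hu ha hb
          rw [← c1] at this
          filter_upwards [hL.eventually_lt_const this] with x hx _ using hx
      refine ⟨0, ?_⟩
      by_cases hpz : P.pos (G.vert h) = z
      · filter_upwards [hend] with x hx
        rw [k2, if_neg (c := z ∈ P.edge h ∧ _) (fun hc => hz hc.1), levelTerm, if_pos (c := _ ∧ lev _ = lev z) ⟨ha, c1.symm⟩, if_pos hpz, starTerm,
          if_pos hu, zero_add, zero_add, add_zero]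
        refine if_congr ?_ rfl rfl
        rw [Below, P.side_of_vert ha, hpz]
        exact ⟨fun hh => ⟨hh.2.1 ha, hh.2.2.2⟩, fun hh => ⟨hu, fun _ => hh.1, hx, hh.2⟩⟩
      · have hsz : P.side h z = (z 1 - P.pos (G.vert h) 1) * lev (toPlane (P.dir h)) := by
          rw [P.side_of_vert ha, cr_of_lev_eq c1]
        have hne : z 1 ≠ P.pos (G.vert h) 1 := fun h0 => hpz (eq_of_lev_eq c1 h0).symm
        have hs : ∀ᶠ x in 𝓝 z, (0 < P.side h x ↔ P.pos (G.vert h) 1 < z 1) := by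
          rcases hne.lt_or_gt with h0 | h0
          · have : P.side h z < 0 := by
              rw [hsz]; exact mul_neg_of_neg_of_pos (by linarith) hu
            filter_upwards [hS.eventually_lt_const this] with x hx
            exact iff_of_false (by linarith) (by linarith)
          · have : 0 < P.side h z := by
              rw [hsz]; exact mul_pos (by linarith) hu
            filter_upwards [hS.eventually_const_lt this] with x hx
            exact iff_of_true hx h0
        filter_upwards [hend, hs] with x hx hs
        rw [k2, if_neg (c := z ∈ P.edge h ∧ _) (fun hc => hz hc.1), levelTerm,
          if_pos (c := _ ∧ lev _ = lev z) ⟨ha, c1.symm⟩, if_neg hpz, zero_add, zero_add, add_zero]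
        refine if_congr ?_ rfl rfl
        rw [Below, hs, ← c1]
        exact ⟨fun hh => ⟨hh.2.1 ha, hh.2.2.2⟩, fun hh => ⟨hu, fun _ => hh.1, hx, hh.2⟩⟩
  have c1' : ¬ G.IsInf (G.vert h) → lev (P.pos (G.vert h)) < lev z := fun ha =>
    not_le.1 fun h0 => c1 ⟨ha, h0⟩
  have k1 : ∀ x, P.levelTerm W z h x = 0 := by
    intro x
    rw [levelTerm, if_neg]
    rintro ⟨ha, hb⟩
    exact (c1' ha).ne hb
  have hstart : ∀ᶠ x in 𝓝 z, ¬ G.IsInf (G.vert h) → lev (P.pos (G.vert h)) ≤ lev x := by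
    by_cases ha : G.IsInf (G.vert h)
    · exact Eventually.of_forall fun _ h0 => absurd ha h0
    · filter_upwards [hL.eventually_const_lt (c1' ha)] with x hx _ using hx.le
  by_cases c2 : ¬ G.IsInf (G.vert (G.flip h)) ∧ lev (P.pos (G.vert (G.flip h))) ≤ lev z
  · obtain ⟨hb, c2⟩ := c2
    have hz : z ∉ P.edge h := by
      rintro ⟨-, -, h2⟩
      have := h2 hb
      rw [P.lev_dir_flip, neg_mul, ← mul_neg, mul_pos_iff_of_pos_left hu] at this
      linarith
    rcases c2.lt_or_eq with c2 | c2
    · refine ⟨0, ?_⟩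
      filter_upwards [hL.eventually_const_lt c2] with x hx
      rw [k1, if_neg (fun hb' => absurd (hb'.2.2.1 hb) (not_lt.2 hx.le)), if_neg (fun hc => hz hc.1),
        levelTerm, if_neg (fun hc => c2.ne hc.2)]
      simp
    · by_cases hpz : P.pos (G.vert (G.flip h)) = z
      · refine ⟨0, ?_⟩
        filter_upwards [hstart] with x hx
        rw [k1, if_neg (c := z ∈ P.edge h ∧ _) (fun hc => hz hc.1), levelTerm, if_pos (c := _ ∧ lev _ = lev z) ⟨hb, c2⟩,
          if_pos hpz, starTerm, if_neg hnu, zero_add, zero_add, zero_add, hW.1, neg_neg]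
        refine if_congr ?_ rfl rfl
        rw [Below, P.side_of_flip hb, hpz, P.dir_flip, cr_neg_left, neg_lt_zero]
        exact ⟨fun hh => ⟨hh.2.2.1 hb, hh.2.2.2⟩, fun hh => ⟨hu, hx, fun _ => hh.1, hh.2⟩⟩
      · have hsz : P.side h z = (z 1 - P.pos (G.vert (G.flip h)) 1) * lev (toPlane (P.dir h)) := by
          rw [P.side_of_flip hb, cr_of_lev_eq c2.symm]
        have hne : z 1 ≠ P.pos (G.vert (G.flip h)) 1 := fun h0 => hpz (eq_of_lev_eq c2.symm h0).symm
        have hs : ∀ᶠ x in 𝓝 z, (0 < P.side h x ↔ P.pos (G.vert (G.flip h)) 1 < z 1) := by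
          rcases hne.lt_or_gt with h0 | h0
          · have : P.side h z < 0 := by
              rw [hsz]; exact mul_neg_of_neg_of_pos (by linarith) hu
            filter_upwards [hS.eventually_lt_const this] with x hx
            exact iff_of_false (by linarith) (by linarith)
          · have : 0 < P.side h z := by
              rw [hsz]; exact mul_pos (by linarith) hu
            filter_upwards [hS.eventually_const_lt this] with x hx
            exact iff_of_true hx h0
        -- An edge whose upper end is below `z` on the sweeping line counts until that level is
        -- reached; from there on `W (flip h) = -W h` in `levelTerm` cancels the constant.
        refine ⟨if P.pos (G.vert (G.flip h)) 1 < z 1 then W h else 0, ?_⟩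
        filter_upwards [hstart, hs] with x hx hs
        rw [k1, if_neg (c := z ∈ P.edge h ∧ _) (fun hc => hz hc.1), levelTerm,
          if_pos (c := _ ∧ lev _ = lev z) ⟨hb, c2⟩, if_neg hpz, add_zero, zero_add, hW.1]
        have hB : P.Below h x ↔ lev x < lev z ∧ P.pos (G.vert (G.flip h)) 1 < z 1 := by
          rw [Below, hs, ← c2]
          exact ⟨fun hh => ⟨hh.2.2.1 hb, hh.2.2.2⟩, fun hh => ⟨hu, hx, fun _ => hh.1, hh.2⟩⟩
        simp only [hB]
        by_cases q1 : P.pos (G.vert (G.flip h)) 1 < z 1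
        · by_cases q2 : lev x < lev z
          · simp [q1, q2, not_le.2 q2]
          · simp [q1, q2, not_lt.1 q2]
        · simp [q1]
  have c2' : ¬ G.IsInf (G.vert (G.flip h)) → lev z < lev (P.pos (G.vert (G.flip h))) := fun ha =>
    not_le.1 fun h0 => c2 ⟨ha, h0⟩
  have k2 : ∀ x, P.levelTerm W z (G.flip h) x = 0 := by
    intro x
    rw [levelTerm, if_neg]
    rintro ⟨ha, hb⟩
    exact (c2' ha).ne' hb
  have hend : ∀ᶠ x in 𝓝 z, ¬ G.IsInf (G.vert (G.flip h)) →
      lev x < lev (P.pos (G.vert (G.flip h))) := by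
    by_cases ha : G.IsInf (G.vert (G.flip h))
    · exact Eventually.of_forall fun _ h0 => absurd ha h0
    · filter_upwards [hL.eventually_lt_const (c2' ha)] with x hx _ using hx
  by_cases hsz : P.side h z = 0
  · have hz : z ∈ P.edge h := by
      refine ⟨hsz, fun ha => mul_pos hu (sub_pos.2 (c1' ha)), fun hb => ?_⟩
      rw [P.lev_dir_flip, neg_mul, ← mul_neg]
      exact mul_pos hu (by have := c2' hb; linarith)
    refine ⟨0, ?_⟩
    filter_upwards [hstart, hend] with x h1 h2
    rw [k1, k2, zero_add, add_zero, add_zero]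
    refine if_congr ?_ rfl rfl
    rw [Below, P.side_of_eq_zero hsz]
    exact ⟨fun hh => ⟨hz, hh.2.2.2⟩, fun hh => ⟨hu, h1, h2, hh.2⟩⟩
  · have hz : z ∉ P.edge h := fun h0 => hsz h0.1
    have hs : ∀ᶠ x in 𝓝 z, (0 < P.side h x ↔ 0 < P.side h z) := by
      rcases lt_or_gt_of_ne hsz with h0 | h0
      · filter_upwards [hS.eventually_lt_const h0] with x hx
        exact iff_of_false (by linarith) (by linarith)
      · filter_upwards [hS.eventually_const_lt h0] with x hx
        exact iff_of_true hx h0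
    refine ⟨if 0 < P.side h z then W h else 0, ?_⟩
    filter_upwards [hstart, hend, hs] with x h1 h2 h3
    rw [k1, k2, add_zero, if_neg (c := z ∈ P.edge h ∧ _) (fun hc => hz hc.1), add_zero, add_zero]
    refine if_congr ?_ rfl rfl
    rw [Below, h3]
    exact ⟨fun hh => hh.2.2.2, fun hh => ⟨hu, h1, h2, hh⟩⟩

open Classical in
/-- The local form of the potential. -/
theorem exists_sweep_eq {W : G.H → M} (hW : IsFlow G W) (z : Plane) :
    ∃ c, ∀ᶠ x in 𝓝 z, P.sweep W x = c +
      (∑ h, if 0 < lev (toPlane (P.dir h)) ∧ z ∈ P.edge h ∧ 0 < cr (P.dir h) (x - z)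
        then W h else 0) +
      ∑ k, if ¬ G.IsInf (G.vert k) ∧ P.pos (G.vert k) = z then P.starTerm W z k x else 0 := by
  have h1 : ∀ h, ∃ c, ∀ᶠ x in 𝓝 z, (if P.Below h x then W h else 0) = c +
      (if 0 < lev (toPlane (P.dir h)) ∧ z ∈ P.edge h ∧ 0 < cr (P.dir h) (x - z) then W h else 0) +
      ((if 0 < lev (toPlane (P.dir h)) then P.levelTerm W z h x else 0) +
      (if 0 < lev (toPlane (P.dir h)) then P.levelTerm W z (G.flip h) x else 0)) := by
    intro h
    by_cases hu : 0 < lev (toPlane (P.dir h))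
    · obtain ⟨c, hc⟩ := P.exists_below_eq hW z hu
      refine ⟨c, ?_⟩
      filter_upwards [hc] with x hx
      rw [hx]
      simp [hu]
    · refine ⟨0, Eventually.of_forall fun x => ?_⟩
      rw [if_neg fun hb => hu hb.1]
      simp [hu]
  choose c hc using h1
  refine ⟨∑ h, c h, ?_⟩
  filter_upwards [eventually_all.2 hc] with x hx
  rw [sweep, Finset.sum_congr rfl fun h _ => hx h, Finset.sum_add_distrib, Finset.sum_add_distrib]
  congr 1
  rw [Finset.sum_add_distrib]
  -- Upper ends are reindexed by `flip`, so that every half-edge contributes its `levelTerm` exactly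
  -- once.
  have e1 : ∑ h, (if 0 < lev (toPlane (P.dir h)) then P.levelTerm W z (G.flip h) x else 0) =
      ∑ h, (if 0 < lev (toPlane (P.dir h)) then 0 else P.levelTerm W z h x) := by
    refine Finset.sum_nbij' G.flip G.flip (by simp) (by simp) (by simp [G.flip_flip])
      (by simp [G.flip_flip]) fun h _ => ?_
    rw [P.lev_dir_flip]
    rcases lt_or_gt_of_ne (P.lev_dir_ne_zero h) with h0 | h0
    · rw [if_neg (by linarith), if_pos (by linarith)]
    · rw [if_pos h0, if_neg (by linarith)]
  rw [e1, ← Finset.sum_add_distrib]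
  have e2 : ∀ h, (if 0 < lev (toPlane (P.dir h)) then P.levelTerm W z h x else 0) +
      (if 0 < lev (toPlane (P.dir h)) then 0 else P.levelTerm W z h x) = P.levelTerm W z h x := by
    intro h; split_ifs <;> simp
  rw [Finset.sum_congr rfl fun h _ => e2 h]
  have e3 : ∀ h, P.levelTerm W z h x =
      (if ¬ G.IsInf (G.vert h) ∧ P.pos (G.vert h) = z then P.starTerm W z h x else 0) +
      ∑ v, (if ¬ G.IsInf v ∧ lev (P.pos v) = lev z ∧ P.pos v ≠ z ∧ lev z ≤ lev x ∧ P.pos v 1 < z 1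
        then (if G.vert h = v then W h else 0) else 0) := by
    intro h
    have : ∀ v, (if ¬ G.IsInf v ∧ lev (P.pos v) = lev z ∧ P.pos v ≠ z ∧ lev z ≤ lev x ∧
        P.pos v 1 < z 1 then (if G.vert h = v then W h else 0) else 0) =
        if G.vert h = v then (if ¬ G.IsInf v ∧ lev (P.pos v) = lev z ∧ P.pos v ≠ z ∧
          lev z ≤ lev x ∧ P.pos v 1 < z 1 then W h else 0) else 0 := by
      intro v; split_ifs <;> rfl
    simp only [this, Finset.sum_ite_eq, Finset.mem_univ, if_true, levelTerm]
    by_cases a : G.IsInf (G.vert h)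
    · simp [a]
    by_cases b : P.pos (G.vert h) = z
    · simp [a, b]
    by_cases c : lev (P.pos (G.vert h)) = lev z
    · simp [a, b, c]
    · simp [a, b, c]
  rw [Finset.sum_congr rfl fun h _ => e3 h, Finset.sum_add_distrib, Finset.sum_comm]
  -- The half-edges at a vertex on the sweeping line, other than at `z`, cancel by balance.
  have e4 : ∀ v, ∑ h, (if ¬ G.IsInf v ∧ lev (P.pos v) = lev z ∧ P.pos v ≠ z ∧ lev z ≤ lev x ∧
      P.pos v 1 < z 1 then (if G.vert h = v then W h else 0) else 0) = 0 := by
    intro v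
    split_ifs with h0
    · exact hW.2 v h0.1
    · simp
  rw [Finset.sum_congr rfl fun v _ => e4 v]
  simp

end PlaneGraph

/-! ### The potential near edges and vertices -/

/-- A vertex with two upward half-edges and one downward: the first two count above the vertex (0 ≤
l), the third below it, and -W₃ = W₁ + W₂ makes the values fit in the sector bordered by the second
and third half-edge. The value zero is written W₁ - W₁ to match the pattern c, c + W₂, c - W₁ of
`TripodAt`. -/
theorem star_sum_eq_of_pos {M : Type} [AddCommGroup M] {W₁ W₂ W₃ : M} (hW : W₁ + W₂ + W₃ = 0)
    {p₁ p₂ : ℝ} (h₁ : 0 < p₁) (h₂ : 0 < p₂) {a₁ a₂ a₃ l : ℝ} (ha : a₁ + a₂ + a₃ = 0)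
    (hl : l = a₁ * p₂ - a₂ * p₁) {T₁ T₂ T₃ : M}
    (t₁ : (0 ≤ l ∧ 0 < a₁ → T₁ = W₁) ∧ (¬(0 ≤ l ∧ 0 < a₁) → T₁ = 0))
    (t₂ : (0 ≤ l ∧ 0 < a₂ → T₂ = W₂) ∧ (¬(0 ≤ l ∧ 0 < a₂) → T₂ = 0))
    (t₃ : (l < 0 ∧ a₃ < 0 → T₃ = -W₃) ∧ (¬(l < 0 ∧ a₃ < 0) → T₃ = 0)) :
    (T₁ + T₂ + T₃ = W₁ ∧ 0 ≤ a₁ ∧ a₂ ≤ 0) ∨ (T₁ + T₂ + T₃ = W₁ + W₂ ∧ 0 ≤ a₂ ∧ a₃ ≤ 0) ∨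
      (T₁ + T₂ + T₃ = W₁ - W₁ ∧ 0 ≤ a₃ ∧ a₁ ≤ 0) := by
  have e3 : -W₃ = W₁ + W₂ := by rw [neg_eq_iff_add_eq_zero, add_comm]; exact hW
  rcases le_or_gt 0 l with c | c
  · rw [t₃.2 fun h => absurd h.1 (not_lt.2 c)]
    rcases le_or_gt a₁ 0 with c1 | c1 <;> rcases le_or_gt a₂ 0 with c2 | c2
    · rw [t₁.2 fun h => absurd h.2 (not_lt.2 c1), t₂.2 fun h => absurd h.2 (not_lt.2 c2)]
      right; right; exact ⟨by simp, by linarith, c1⟩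
    · exfalso
      have := mul_nonneg (neg_nonneg.2 c1) h₂.le
      have := mul_pos c2 h₁
      linarith
    · rw [t₁.1 ⟨c, c1⟩, t₂.2 fun h => absurd h.2 (not_lt.2 c2)]
      left; exact ⟨by simp, c1.le, c2⟩
    · rw [t₁.1 ⟨c, c1⟩, t₂.1 ⟨c, c2⟩]
      right; left; exact ⟨by simp, c2.le, by linarith⟩
  · rw [t₁.2 fun h => absurd h.1 (not_le.2 c), t₂.2 fun h => absurd h.1 (not_le.2 c)]
    rcases lt_or_ge a₃ 0 with c3 | c3
    · rw [t₃.1 ⟨c, c3⟩]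
      right; left; refine ⟨by simp [e3], ?_, c3.le⟩
      by_contra! c2
      have := mul_pos (neg_pos.2 c2) h₁
      have := mul_pos (show 0 < a₁ by linarith) h₂
      linarith
    · rw [t₃.2 fun h => absurd h.2 (not_lt.2 c3)]
      right; right; refine ⟨by simp, c3, ?_⟩
      by_contra! c2
      have := mul_pos (show 0 < -a₂ by linarith) h₁
      have := mul_pos c2 h₂
      linarith

/-- The mirrored case of two downward half-edges; here the base value c of the pattern is -W₂. -/
theorem star_sum_eq_of_neg {M : Type} [AddCommGroup M] {W₁ W₂ W₃ : M} (hW : W₁ + W₂ + W₃ = 0)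
    {p₁ p₂ : ℝ} (h₁ : p₁ < 0) (h₂ : p₂ < 0) {a₁ a₂ a₃ l : ℝ} (ha : a₁ + a₂ + a₃ = 0)
    (hl : l = a₁ * p₂ - a₂ * p₁) {T₁ T₂ T₃ : M}
    (t₁ : (l < 0 ∧ a₁ < 0 → T₁ = -W₁) ∧ (¬(l < 0 ∧ a₁ < 0) → T₁ = 0))
    (t₂ : (l < 0 ∧ a₂ < 0 → T₂ = -W₂) ∧ (¬(l < 0 ∧ a₂ < 0) → T₂ = 0))
    (t₃ : (0 ≤ l ∧ 0 < a₃ → T₃ = W₃) ∧ (¬(0 ≤ l ∧ 0 < a₃) → T₃ = 0)) :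
    (T₁ + T₂ + T₃ = -W₂ ∧ 0 ≤ a₁ ∧ a₂ ≤ 0) ∨ (T₁ + T₂ + T₃ = -W₂ + W₂ ∧ 0 ≤ a₂ ∧ a₃ ≤ 0) ∨
      (T₁ + T₂ + T₃ = -W₂ - W₁ ∧ 0 ≤ a₃ ∧ a₁ ≤ 0) := by
  have e3 : W₃ = -W₂ - W₁ := by
    rw [← sub_eq_zero, ← hW]; abel
  rcases lt_or_ge l 0 with c | c
  · rw [t₃.2 fun h => absurd h.1 (not_le.2 c)]
    rcases lt_or_ge a₁ 0 with c1 | c1 <;> rcases lt_or_ge a₂ 0 with c2 | c2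
    · rw [t₁.1 ⟨c, c1⟩, t₂.1 ⟨c, c2⟩]
      right; right; exact ⟨by abel, by linarith, c1.le⟩
    · exfalso
      have := mul_pos_of_neg_of_neg c1 h₂
      have := mul_nonneg c2 (neg_pos.2 h₁).le
      linarith
    · rw [t₁.2 fun h => absurd h.2 (not_lt.2 c1), t₂.1 ⟨c, c2⟩]
      left; exact ⟨by simp, c1, c2.le⟩
    · rw [t₁.2 fun h => absurd h.2 (not_lt.2 c1), t₂.2 fun h => absurd h.2 (not_lt.2 c2)]
      right; left; exact ⟨by simp, c2, by linarith⟩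
  · rw [t₁.2 fun h => absurd h.1 (not_lt.2 c), t₂.2 fun h => absurd h.1 (not_lt.2 c)]
    have key : a₂ < 0 → 0 < a₁ → False := fun c2 c1 => by
      have := mul_pos_of_neg_of_neg c2 h₁
      have := mul_pos c1 (neg_pos.2 h₂)
      linarith
    rcases le_or_gt a₃ 0 with c3 | c3
    · rw [t₃.2 fun h => absurd h.2 (not_lt.2 c3)]
      right; left; refine ⟨by simp, ?_, c3⟩
      by_contra! c2
      exact key c2 (by linarith)
    · rw [t₃.1 ⟨c, c3⟩, e3]
      right; right; refine ⟨by simp, c3.le, ?_⟩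
      by_contra! c2
      exact key (by linarith) c2

theorem lev_eq_of_det {d₁ d₂ : Fin 2 → ℤ} (h : det₂ d₁ d₂ = 1) (y : Plane) :
    lev y = cr d₁ y * lev (toPlane d₂) - cr d₂ y * lev (toPlane d₁) := by
  rw [det₂_eq] at h
  have h' : (d₁ 0 : ℝ) * d₂ 1 - d₁ 1 * d₂ 0 = 1 := by exact_mod_cast h
  simp only [lev, cr, toPlane_apply]
  linear_combination (-(y 0) - √2 * y 1) * h'

namespace PlaneGraph

variable {G : AbstractTropicalCurve} (P : PlaneGraph G)

/-- The points of the plane curve. -/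
def support : Set Plane := {x | (∃ v, ¬ G.IsInf v ∧ P.pos v = x) ∨ ∃ h, x ∈ P.edge h}

open Classical in
theorem sum_vert_two {M : Type} [AddCommMonoid M] {v : G.V} {k k' : G.H} (hne : k' ≠ k)
    (hv : ∀ h, G.vert h = v ↔ h = k ∨ h = k') (g : G.H → M) :
    ∑ h, (if G.vert h = v then g h else 0) = g k + g k' := by
  simp only [hv]
  rw [← Finset.sum_filter]
  have : Finset.univ.filter (fun h => h = k ∨ h = k') = {k, k'} := by ext; simp
  rw [this, Finset.sum_pair hne.symm]

open Classical in
theorem sum_vert_three {M : Type} [AddCommMonoid M] {v : G.V} {k₁ k₂ k₃ : G.H} (h₁₂ : k₁ ≠ k₂)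
    (h₂₃ : k₂ ≠ k₃) (h₁₃ : k₁ ≠ k₃) (hv : ∀ h, G.vert h = v ↔ h = k₁ ∨ h = k₂ ∨ h = k₃)
    (g : G.H → M) : ∑ h, (if G.vert h = v then g h else 0) = g k₁ + g k₂ + g k₃ := by
  simp only [hv]
  rw [← Finset.sum_filter]
  have : Finset.univ.filter (fun h => h = k₁ ∨ h = k₂ ∨ h = k₃) = {k₁, k₂, k₃} := by ext; simp
  rw [this, Finset.sum_insert (by simp [h₁₂, h₁₃]), Finset.sum_pair h₂₃, add_assoc]

/-- Near `z` the curve is the line of the half-edge `k`. -/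
def LineAt (k : G.H) (z : Plane) : Prop :=
  ∀ (M : Type) [AddCommGroup M] (W : G.H → M), IsFlow G W → ∃ c, ∀ᶠ x in 𝓝 z,
    (P.sweep W x = c ∧ cr (P.dir k) (x - z) ≤ 0) ∨
    (P.sweep W x = c + W k ∧ 0 ≤ cr (P.dir k) (x - z))

/-- Near `z` the curve is a tripod formed by `k₁`, `k₂`, `k₃` in counterclockwise order. -/
def TripodAt (k₁ k₂ k₃ : G.H) (z : Plane) : Prop :=
  ∀ (M : Type) [AddCommGroup M] (W : G.H → M), IsFlow G W → ∃ c, ∀ᶠ x in 𝓝 z,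
    (P.sweep W x = c ∧ 0 ≤ cr (P.dir k₁) (x - z) ∧ cr (P.dir k₂) (x - z) ≤ 0) ∨
    (P.sweep W x = c + W k₂ ∧ 0 ≤ cr (P.dir k₂) (x - z) ∧ cr (P.dir k₃) (x - z) ≤ 0) ∨
    (P.sweep W x = c - W k₁ ∧ 0 ≤ cr (P.dir k₃) (x - z) ∧ cr (P.dir k₁) (x - z) ≤ 0)

variable {P}

theorem LineAt.flip {k k' : G.H} {z : Plane} (h : P.LineAt k z) (hd : P.dir k' = - P.dir k)
    (hW : ∀ (M : Type) [AddCommGroup M] (W : G.H → M), IsFlow G W → W k' = - W k) :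
    P.LineAt k' z := by
  intro M _ W hf
  obtain ⟨c, hc⟩ := h M W hf
  refine ⟨c + W k, ?_⟩
  filter_upwards [hc] with x hx
  rw [hd, cr_neg_left, hW M W hf]
  rcases hx with hx | hx
  · right; exact ⟨by rw [hx.1]; abel, by linarith [hx.2]⟩
  · left; exact ⟨hx.1, by linarith [hx.2]⟩

variable (P)

theorem not_mem_edge_of_pos {v : G.V} (hv : ¬ G.IsInf v) {z : Plane} (hz : P.pos v = z) (h : G.H) :
    z ∉ P.edge h := hz ▸ P.pos_not_mem_edge hv h

theorem eventually_sweep_const {M : Type} [AddCommGroup M] {W : G.H → M} (hW : IsFlow G W)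
    {z : Plane} (hz : z ∉ P.support) : ∃ c, ∀ᶠ x in 𝓝 z, P.sweep W x = c := by
  classical
  obtain ⟨c, hc⟩ := P.exists_sweep_eq hW z
  refine ⟨c, ?_⟩
  filter_upwards [hc] with x hx
  rw [hx, Finset.sum_eq_zero, Finset.sum_eq_zero]
  · simp
  · intro k _
    rw [if_neg]
    rintro ⟨h1, h2⟩
    exact hz (Or.inl ⟨_, h1, h2⟩)
  · intro h _
    rw [if_neg]
    rintro ⟨-, h2, -⟩
    exact hz (Or.inr ⟨_, h2⟩)

theorem lineAt_of_mem_edge {k : G.H} {z : Plane} (hz : z ∈ P.edge k) : P.LineAt k z := by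
  classical
  have key : ∀ k, z ∈ P.edge k → 0 < lev (toPlane (P.dir k)) → P.LineAt k z := by
    intro k hz hu M _ W hW
    obtain ⟨c, hc⟩ := P.exists_sweep_eq hW z
    refine ⟨c, ?_⟩
    filter_upwards [hc] with x hx
    have h1 : ∑ k, (if ¬ G.IsInf (G.vert k) ∧ P.pos (G.vert k) = z then P.starTerm W z k x else 0)
        = 0 := by
      refine Finset.sum_eq_zero fun k' _ => if_neg ?_
      rintro ⟨h1, h2⟩
      exact P.not_mem_edge_of_pos h1 h2 k hz
    have h2 : ∑ h, (if 0 < lev (toPlane (P.dir h)) ∧ z ∈ P.edge h ∧ 0 < cr (P.dir h) (x - z)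
        then W h else 0) = if 0 < cr (P.dir k) (x - z) then W k else 0 := by
      rw [Finset.sum_eq_single k]
      · simp [hu, hz]
      · intro h _ hne
        rw [if_neg]
        rintro ⟨a, b, -⟩
        rcases P.eq_of_mem_edge hz b with e | e
        · exact hne e
        · rw [e, P.lev_dir_flip] at a; linarith
      · simp
    rw [hx, h1, h2, add_zero]
    rcases lt_or_ge 0 (cr (P.dir k) (x - z)) with c | c
    · right; exact ⟨by rw [if_pos c], c.le⟩
    · left; exact ⟨by rw [if_neg (not_lt.2 c), add_zero], c⟩
  rcases lt_or_gt_of_ne (P.lev_dir_ne_zero k) with h0 | h0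
  · have h1 := key (G.flip k) (by rwa [P.edge_flip]) (by rw [P.lev_dir_flip]; linarith)
    exact h1.flip (by rw [P.dir_flip, neg_neg]) (fun M _ W hf => by rw [hf.1, neg_neg])
  · exact key k hz h0

open Classical in
theorem exists_sweep_eq_star {M : Type} [AddCommGroup M] {W : G.H → M} (hW : IsFlow G W)
    {v : G.V} (hv : ¬ G.IsInf v) : ∃ c, ∀ᶠ x in 𝓝 (P.pos v), P.sweep W x = c +
      ∑ k, if G.vert k = v then P.starTerm W (P.pos v) k x else 0 := by
  obtain ⟨c, hc⟩ := P.exists_sweep_eq hW (P.pos v)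
  refine ⟨c, ?_⟩
  filter_upwards [hc] with x hx
  rw [hx, Finset.sum_eq_zero, add_zero]
  · congr 1
    refine Finset.sum_congr rfl fun k _ => ?_
    refine if_congr ⟨fun h => P.pos_inj _ _ h.1 hv h.2, ?_⟩ rfl rfl
    rintro rfl
    exact ⟨hv, rfl⟩
  · intro h _
    rw [if_neg]
    rintro ⟨-, h2, -⟩
    exact P.pos_not_mem_edge hv h h2

theorem starTerm_up {M : Type} [AddCommGroup M] (W : G.H → M) {k : G.H}
    (hu : 0 < lev (toPlane (P.dir k))) (z x : Plane) :
    (0 ≤ lev (x - z) ∧ 0 < cr (P.dir k) (x - z) → P.starTerm W z k x = W k) ∧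
    (¬(0 ≤ lev (x - z) ∧ 0 < cr (P.dir k) (x - z)) → P.starTerm W z k x = 0) := by
  rw [starTerm, if_pos hu, lev_sub, sub_nonneg]
  exact ⟨fun h => if_pos h, fun h => if_neg h⟩

theorem starTerm_down {M : Type} [AddCommGroup M] (W : G.H → M) {k : G.H}
    (hu : lev (toPlane (P.dir k)) < 0) (z x : Plane) :
    (lev (x - z) < 0 ∧ cr (P.dir k) (x - z) < 0 → P.starTerm W z k x = - W k) ∧
    (¬(lev (x - z) < 0 ∧ cr (P.dir k) (x - z) < 0) → P.starTerm W z k x = 0) := by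
  rw [starTerm, if_neg (not_lt.2 hu.le), lev_sub, sub_neg]
  exact ⟨fun h => if_pos h, fun h => if_neg h⟩

/-- The upward half-edge counts above the level of the vertex, the downward one below it. By balance
both contribute the same value on the same side of the line. -/
theorem lineAt_pos {v : G.V} (hv : ¬ G.IsInf v) {k k' : G.H} (hne : k' ≠ k)
    (hk : ∀ h, G.vert h = v ↔ h = k ∨ h = k') (hd : P.dir k' = - P.dir k) :
    P.LineAt k (P.pos v) := by
  classical
  have hWk : ∀ (M : Type) [AddCommGroup M] (W : G.H → M), IsFlow G W → W k + W k' = 0 := by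
    intro M _ W hW
    rw [← sum_vert_two hne hk W]; exact hW.2 v hv
  have key : ∀ k k', k' ≠ k → (∀ h, G.vert h = v ↔ h = k ∨ h = k') → P.dir k' = - P.dir k →
      0 < lev (toPlane (P.dir k)) → P.LineAt k (P.pos v) := by
    intro k k' hne hk hd hu M _ W hW
    obtain ⟨c, hc⟩ := P.exists_sweep_eq_star hW hv
    refine ⟨c, ?_⟩
    filter_upwards [hc] with x hx
    rw [hx, sum_vert_two hne hk]
    have hu' : lev (toPlane (P.dir k')) < 0 := by
      rw [hd, toPlane_neg]
      have : lev (-toPlane (P.dir k)) = - lev (toPlane (P.dir k)) := by simp [lev]; ring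
      linarith
    have t1 := P.starTerm_up W hu (P.pos v) x
    have t2 := P.starTerm_down W hu' (P.pos v) x
    have hk' : - W k' = W k := by
      rw [neg_eq_iff_add_eq_zero, add_comm, ← sum_vert_two hne hk W]; exact hW.2 v hv
    rw [hd, cr_neg_left, neg_lt_zero, hk'] at t2
    rcases lt_or_ge 0 (cr (P.dir k) (x - P.pos v)) with c1 | c1
    · right
      refine ⟨?_, c1.le⟩
      rcases le_or_gt 0 (lev (x - P.pos v)) with c2 | c2
      · rw [t1.1 ⟨c2, c1⟩, t2.2 fun h => absurd h.1 (not_lt.2 c2), add_zero]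
      · rw [t2.1 ⟨c2, c1⟩, t1.2 fun h => absurd h.1 (not_le.2 c2), zero_add]
    · left
      refine ⟨?_, c1⟩
      rw [t1.2 fun h => absurd h.2 (not_lt.2 c1), t2.2 fun h => absurd h.2 (not_lt.2 c1)]
      simp
  rcases lt_or_gt_of_ne (P.lev_dir_ne_zero k) with h0 | h0
  · have h1 := key k' k hne.symm (fun h => by rw [hk, or_comm]) (by rw [hd, neg_neg]) (by
      rw [hd, toPlane_neg]
      have : lev (-toPlane (P.dir k)) = - lev (toPlane (P.dir k)) := by simp [lev]; ring
      linarith)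
    exact h1.flip (by rw [hd, neg_neg]) (fun M _ W hf => by
      rw [eq_neg_iff_add_eq_zero]; exact hWk M W hf)
  · exact key k k' hne hk hd h0

/-- Only the sector carrying the base value changes; balance identifies c + W k₃ with c - W k₂ - W
k₁. -/
theorem TripodAt.rotate {k₁ k₂ k₃ : G.H} {z : Plane} (h : P.TripodAt k₂ k₃ k₁ z)
    (hW : ∀ (M : Type) [AddCommGroup M] (W : G.H → M), IsFlow G W → W k₁ + W k₂ + W k₃ = 0) :
    P.TripodAt k₁ k₂ k₃ z := by
  intro M _ W hf
  obtain ⟨c, hc⟩ := h M W hf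
  have hs := hW M W hf
  have e : c + W k₃ = c - W k₂ - W k₁ := by
    rw [← sub_eq_zero, ← hs]; abel
  refine ⟨c - W k₂, ?_⟩
  filter_upwards [hc] with x hx
  rcases hx with hx | hx | hx
  · right; left; exact ⟨by rw [hx.1]; abel, hx.2⟩
  · right; right; exact ⟨by rw [hx.1, e], hx.2⟩
  · left; exact hx

theorem det_rotate {a b c : Fin 2 → ℤ} (h : det₂ a b = 1) (hc : c = -(a + b)) :
    det₂ b c = 1 ∧ a = -(b + c) := by
  subst hc
  refine ⟨?_, by abel⟩
  rw [det₂_eq] at *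
  simp only [Pi.neg_apply, Pi.add_apply]
  linarith

/-- Two of the three half-edges lie on the same side of the sweeping line, and a cyclic rotation
makes them the first two. -/
theorem tripodAt_pos {v : G.V} (hv : ¬ G.IsInf v) {k₁ k₂ k₃ : G.H} (h₁₂ : k₁ ≠ k₂)
    (h₂₃ : k₂ ≠ k₃) (h₁₃ : k₁ ≠ k₃) (hk : ∀ h, G.vert h = v ↔ h = k₁ ∨ h = k₂ ∨ h = k₃)
    (hdet : det₂ (P.dir k₁) (P.dir k₂) = 1) (hd : P.dir k₃ = -(P.dir k₁ + P.dir k₂)) :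
    P.TripodAt k₁ k₂ k₃ (P.pos v) := by
  classical
  have hW3 : ∀ (M : Type) [AddCommGroup M] (W : G.H → M), IsFlow G W →
      W k₁ + W k₂ + W k₃ = 0 := by
    intro M _ W hW
    rw [← sum_vert_three h₁₂ h₂₃ h₁₃ hk W]; exact hW.2 v hv
  -- the case of two half-edges on the same side of the sweeping line
  have key : ∀ k₁ k₂ k₃, k₁ ≠ k₂ → k₂ ≠ k₃ → k₁ ≠ k₃ →
      (∀ h, G.vert h = v ↔ h = k₁ ∨ h = k₂ ∨ h = k₃) → det₂ (P.dir k₁) (P.dir k₂) = 1 →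
      P.dir k₃ = -(P.dir k₁ + P.dir k₂) →
      0 < lev (toPlane (P.dir k₁)) * lev (toPlane (P.dir k₂)) →
      P.TripodAt k₁ k₂ k₃ (P.pos v) := by
    intro k₁ k₂ k₃ h₁₂ h₂₃ h₁₃ hk hdet hd hpos M _ W hW
    obtain ⟨c, hc⟩ := P.exists_sweep_eq_star hW hv
    have hs : W k₁ + W k₂ + W k₃ = 0 := by
      rw [← sum_vert_three h₁₂ h₂₃ h₁₃ hk W]; exact hW.2 v hv
    have hl3 : lev (toPlane (P.dir k₃)) = - (lev (toPlane (P.dir k₁)) + lev (toPlane (P.dir k₂))) := by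
      rw [hd]; simp [lev]; ring
    have ha : ∀ y, cr (P.dir k₁) y + cr (P.dir k₂) y + cr (P.dir k₃) y = 0 := by
      intro y; rw [hd]; simp [cr]; ring
    rcases lt_or_gt_of_ne (P.lev_dir_ne_zero k₁) with h0 | h0
    · have h0' : lev (toPlane (P.dir k₂)) < 0 := by nlinarith
      refine ⟨c + -W k₂, ?_⟩
      filter_upwards [hc] with x hx
      rw [hx, sum_vert_three h₁₂ h₂₃ h₁₃ hk]
      have := star_sum_eq_of_neg hs h0 h0' (ha (x - P.pos v)) (lev_eq_of_det hdet _)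
        (P.starTerm_down W h0 (P.pos v) x) (P.starTerm_down W h0' (P.pos v) x)
        (P.starTerm_up W (k := k₃) (by linarith) (P.pos v) x)
      rw [add_assoc c, add_sub_assoc c]
      simpa only [add_right_inj] using this
    · have h0' : 0 < lev (toPlane (P.dir k₂)) := by
        by_contra! h1
        nlinarith
      refine ⟨c + W k₁, ?_⟩
      filter_upwards [hc] with x hx
      rw [hx, sum_vert_three h₁₂ h₂₃ h₁₃ hk]
      have := star_sum_eq_of_pos hs h0 h0' (ha (x - P.pos v)) (lev_eq_of_det hdet _)
        (P.starTerm_up W h0 (P.pos v) x) (P.starTerm_up W h0' (P.pos v) x)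
        (P.starTerm_down W (k := k₃) (by linarith) (P.pos v) x)
      rw [add_assoc c, add_sub_assoc c]
      simpa only [add_right_inj] using this
  obtain ⟨hdet', hd'⟩ := det_rotate hdet hd
  obtain ⟨hdet'', hd''⟩ := det_rotate hdet' hd'
  by_cases c1 : 0 < lev (toPlane (P.dir k₁)) * lev (toPlane (P.dir k₂))
  · exact key _ _ _ h₁₂ h₂₃ h₁₃ hk hdet hd c1
  have hr1 : ∀ h, G.vert h = v ↔ h = k₂ ∨ h = k₃ ∨ h = k₁ := fun h => by rw [hk]; tauto
  have hr2 : ∀ h, G.vert h = v ↔ h = k₃ ∨ h = k₁ ∨ h = k₂ := fun h => by rw [hk]; tauto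
  by_cases c2 : 0 < lev (toPlane (P.dir k₂)) * lev (toPlane (P.dir k₃))
  · exact TripodAt.rotate P (key _ _ _ h₂₃ h₁₃.symm h₁₂.symm hr1 hdet' hd' c2) hW3
  -- The product of the three pairwise products is a square, so they are not all negative.
  have c3 : 0 < lev (toPlane (P.dir k₃)) * lev (toPlane (P.dir k₁)) := by
    by_contra! c3
    have n1 := P.lev_dir_ne_zero k₁
    have n2 := P.lev_dir_ne_zero k₂
    have n3 := P.lev_dir_ne_zero k₃
    have d1 := lt_of_le_of_ne (not_lt.1 c1) (mul_ne_zero n1 n2)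
    have d2 := lt_of_le_of_ne (not_lt.1 c2) (mul_ne_zero n2 n3)
    have d3 := lt_of_le_of_ne c3 (mul_ne_zero n3 n1)
    have := mul_neg_of_pos_of_neg (mul_pos_of_neg_of_neg d1 d2) d3
    nlinarith [sq_nonneg (lev (toPlane (P.dir k₁)) * lev (toPlane (P.dir k₂)) *
      lev (toPlane (P.dir k₃)))]
  refine TripodAt.rotate P (TripodAt.rotate P
    (key _ _ _ h₁₃.symm h₁₂ h₂₃.symm hr2 hdet'' hd'' c3) ?_) hW3
  intro M _ W hW
  rw [← hW3 M W hW]; abel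

end PlaneGraph

/-! ### The values of a potential beside the half-edges -/

theorem cr_toPlane (d e : Fin 2 → ℤ) : cr d (toPlane e) = det₂ d e := by
  rw [det₂_eq]; simp [cr]

theorem cr_smul (d : Fin 2 → ℤ) (t : ℝ) (y : Plane) : cr d (t • y) = t * cr d y := by
  simp [cr]; ring

theorem tendsto_add_smul (z y : Plane) :
    Tendsto (fun t : ℝ => z + t • y) (𝓝[>] 0) (𝓝 z) := by
  have hc : Continuous fun t : ℝ => z + t • y := by fun_prop
  have := hc.tendsto 0
  simp only [zero_smul, add_zero] at this
  exact this.mono_left nhdsWithin_le_nhds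

/-- Points near `z` in the open half planes and sectors at `z`. -/
theorem frequently_sector {z y : Plane} {p : Plane → Prop} (h : ∀ t : ℝ, 0 < t → p (t • y)) :
    ∃ᶠ x in 𝓝 z, p (x - z) := by
  refine (tendsto_add_smul z y).frequently ?_
  refine Eventually.frequently ?_
  filter_upwards [self_mem_nhdsWithin] with t ht
  rw [add_sub_cancel_left]
  exact h t ht

theorem frequently_cr_pos {d : Fin 2 → ℤ} (hd : IsPrimitive d) (z : Plane) :
    ∃ᶠ x in 𝓝 z, 0 < cr d (x - z) := by
  obtain ⟨w, hw⟩ := hd.exists_det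
  refine frequently_sector (y := toPlane w) (p := fun y => 0 < cr d y) fun t ht => ?_
  rw [cr_smul, cr_toPlane, hw]
  simpa using ht

namespace PlaneGraph

variable {G : AbstractTropicalCurve} (P : PlaneGraph G)

theorem eventually_mem_edge {k : G.H} (hk : ¬ G.IsInf (G.vert k)) :
    ∀ᶠ t in 𝓝[>] (0 : ℝ), P.pos (G.vert k) + t • toPlane (P.dir k) ∈ P.edge k := by
  have h1 : Tendsto (fun t : ℝ => ENNReal.ofReal t) (𝓝[>] 0) (𝓝 0) := by
    have := ENNReal.continuous_ofReal.tendsto 0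
    rw [ENNReal.ofReal_zero] at this
    exact this.mono_left nhdsWithin_le_nhds
  filter_upwards [h1.eventually_lt_const (G.len_pos k), self_mem_nhdsWithin] with t h1 h2
  rw [P.mem_edge_iff hk]
  exact ⟨t, h2, h1, rfl⟩

theorem edge_nonempty (k : G.H) : (P.edge k).Nonempty := by
  rcases P.finite_end k with h | h
  · obtain ⟨t, ht⟩ := (P.eventually_mem_edge h).exists
    exact ⟨_, ht⟩
  · obtain ⟨t, ht⟩ := (P.eventually_mem_edge h).exists
    rw [P.edge_flip] at ht
    exact ⟨_, ht⟩

variable {M : Type} [AddCommGroup M]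

/-- `m` is the value of the potential to the left of `h`. -/
def IsLeft (W : G.H → M) (h : G.H) (m : M) : Prop :=
  ∀ z ∈ P.edge h, ∀ᶠ x in 𝓝 z, 0 < cr (P.dir h) (x - z) → P.sweep W x = m

theorem convex_edge (h : G.H) : Convex ℝ (P.edge h) := by
  rintro x ⟨x1, x2, x3⟩ y ⟨y1, y2, y3⟩ a b ha hb hab
  have hlev : ∀ p : Plane, lev (a • x + b • y) - lev p = a * (lev x - lev p) + b * (lev y - lev p) := by
    intro p
    simp [lev]; linear_combination (p 0 + √2 * p 1) * hab
  have pos : ∀ u v : ℝ, 0 < u → 0 < v → 0 < a * u + b * v := by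
    intro u v hu hv
    rcases ha.eq_or_lt with rfl | ha
    · have : b = 1 := by linarith
      subst this; linarith
    · have := mul_pos ha hu
      have := mul_nonneg hb hv.le
      linarith
  refine ⟨?_, fun h1 => ?_, fun h1 => ?_⟩
  · have : P.side h (a • x + b • y) = a * P.side h x + b * P.side h y := by
      have hb' : b = 1 - a := by linarith
      subst hb'
      simp [side, cr]; ring
    rw [this, x1, y1]; ring
  · rw [hlev, mul_add, mul_left_comm, mul_left_comm _ b]
    exact pos _ _ (x2 h1) (y2 h1)
  · rw [hlev, mul_add, mul_left_comm, mul_left_comm _ b]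
    exact pos _ _ (x3 h1) (y3 h1)

/-- The value on the left is locally constant along the edge, and the edge is convex, hence
connected. -/
theorem exists_isLeft {W : G.H → M} (hW : IsFlow G W) (h : G.H) : ∃ m, P.IsLeft W h m := by
  classical
  have key : ∀ z, ∃ m, z ∈ P.edge h → ∀ᶠ x in 𝓝 z, 0 < cr (P.dir h) (x - z) → P.sweep W x = m := by
    intro z
    by_cases hz : z ∈ P.edge h
    · obtain ⟨c, hc⟩ := P.lineAt_of_mem_edge hz M W hW
      refine ⟨c + W h, fun _ => ?_⟩
      filter_upwards [hc] with x hx h0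
      rcases hx with hx | hx
      · linarith [hx.2]
      · exact hx.1
    · exact ⟨0, fun h0 => absurd h0 hz⟩
  choose m hm using key
  let _ : TopologicalSpace M := ⊥
  have : DiscreteTopology M := ⟨rfl⟩
  have hcont : ContinuousOn m (P.edge h) := by
    intro z hz
    refine ContinuousWithinAt.congr_of_eventuallyEq
      (continuousWithinAt_const (b := m z)) ?_ rfl
    have h1 := eventually_eventually_nhds.2 (hm z hz)
    filter_upwards [h1.filter_mono nhdsWithin_le_nhds, self_mem_nhdsWithin] with z' h2 hz'
    obtain ⟨x, ⟨e1, e2⟩, e3⟩ := ((frequently_cr_pos (P.dir_primitive h) z').and_eventually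
      (h2.and (hm z' hz'))).exists |>.imp fun x hx => (⟨⟨hx.2.1, hx.2.2⟩, hx.1⟩ :
        (_ ∧ _) ∧ 0 < cr (P.dir h) (x - z'))
    have e4 : cr (P.dir h) (x - z) = cr (P.dir h) (x - z') := by
      rw [← P.side_of_eq_zero hz.1, ← P.side_of_eq_zero hz'.1]
    exact (e2 e3).symm.trans (e1 (by rw [e4]; exact e3))
  obtain ⟨z₀, hz₀⟩ := P.edge_nonempty h
  refine ⟨m z₀, fun z hz => ?_⟩
  rw [(P.convex_edge h).isPreconnected.constant hcont hz₀ hz]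
  exact hm z hz

open Classical in
/-- The value of the potential to the left of a half-edge. -/
noncomputable def left (W : G.H → M) (h : G.H) : M :=
  if hm : ∃ m, P.IsLeft W h m then hm.choose else 0

theorem isLeft_left {W : G.H → M} (hW : IsFlow G W) (h : G.H) : P.IsLeft W h (P.left W h) := by
  rw [left, dif_pos (P.exists_isLeft hW h)]
  exact (P.exists_isLeft hW h).choose_spec

theorem left_eq {W : G.H → M} (hW : IsFlow G W) {h : G.H} {z : Plane} (hz : z ∈ P.edge h) {m : M}
    (hm : ∀ᶠ x in 𝓝 z, 0 < cr (P.dir h) (x - z) → P.sweep W x = m) : P.left W h = m := by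
  obtain ⟨x, h1, h2, h3⟩ := ((frequently_cr_pos (P.dir_primitive h) z).and_eventually
    (hm.and (P.isLeft_left hW h z hz))).exists
  rw [← h2 h1, h3 h1]

/-- Across a half-edge, the potential jumps by the value of the flow. -/
theorem left_sub_left_flip {W : G.H → M} (hW : IsFlow G W) (h : G.H) :
    P.left W h - P.left W (G.flip h) = W h := by
  obtain ⟨z, hz⟩ := P.edge_nonempty h
  obtain ⟨c, hc⟩ := P.lineAt_of_mem_edge hz M W hW
  have h1 : P.left W h = c + W h := P.left_eq hW hz (by
    filter_upwards [hc] with x hx h0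
    rcases hx with hx | hx
    · linarith [hx.2]
    · exact hx.1)
  have h2 : P.left W (G.flip h) = c := P.left_eq hW (z := z) (by rwa [P.edge_flip]) (by
    filter_upwards [hc] with x hx h0
    rw [P.dir_flip, cr_neg_left] at h0
    rcases hx with hx | hx
    · exact hx.1
    · linarith [hx.2])
  rw [h1, h2]; abel

/-- Points of the edge close to its vertex satisfy the open condition imposed by `e`, so that the
left side of the edge there belongs to the sector where the potential is `m`. -/
theorem left_eq_of_star {W : G.H → M} (hW : IsFlow G W) {k : G.H} (hk : ¬ G.IsInf (G.vert k))
    {e : Fin 2 → ℤ} (he : det₂ e (P.dir k) < 0) {m : M}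
    (hm : ∀ᶠ x in 𝓝 (P.pos (G.vert k)), 0 < cr (P.dir k) (x - P.pos (G.vert k)) →
      cr e (x - P.pos (G.vert k)) < 0 → P.sweep W x = m) : P.left W k = m := by
  set z := P.pos (G.vert k) with hz
  have h1 := (tendsto_add_smul z (toPlane (P.dir k))).eventually (eventually_eventually_nhds.2 hm)
  obtain ⟨t, ⟨h2, h3⟩, ht⟩ := ((h1.and (P.eventually_mem_edge hk)).and self_mem_nhdsWithin).exists
  have ht' : (0 : ℝ) < t := ht
  refine P.left_eq hW h3 ?_
  have hc : Continuous fun x : Plane => cr e (x - z) := (continuous_cr e).comp (by fun_prop)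
  have h4 : cr e (z + t • toPlane (P.dir k) - z) < 0 := by
    rw [add_sub_cancel_left, cr_smul, cr_toPlane]
    exact mul_neg_of_pos_of_neg ht' (by exact_mod_cast he)
  filter_upwards [h2, (hc.tendsto _).eventually_lt_const h4] with x h5 h6 h7
  refine h5 ?_ h6
  rw [← P.side_of_vert hk, P.side_of_eq_zero h3.1]
  exact h7

variable {P}

theorem LineAt.left_eq {k : G.H} (h : P.LineAt k (P.pos (G.vert k))) (hk : ¬ G.IsInf (G.vert k))
    {W : G.H → M} (hW : IsFlow G W) : ∀ᶠ x in 𝓝 (P.pos (G.vert k)),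
    (P.sweep W x = P.left W (G.flip k) ∧ cr (P.dir k) (x - P.pos (G.vert k)) ≤ 0) ∨
    (P.sweep W x = P.left W k ∧ 0 ≤ cr (P.dir k) (x - P.pos (G.vert k))) := by
  obtain ⟨c, hc⟩ := h M W hW
  obtain ⟨w, hw⟩ := (P.dir_primitive k).exists_det
  have h1 : P.left W k = c + W k := by
    refine P.left_eq_of_star hW hk (e := w) (by rw [det₂_eq] at *; linarith) ?_
    filter_upwards [hc] with x hx h0 _
    rcases hx with hx | hx
    · linarith [hx.2]
    · exact hx.1
  have h2 : P.left W (G.flip k) = c := by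
    have := P.left_sub_left_flip hW k
    rw [h1, sub_eq_iff_eq_add, add_comm] at this
    exact (add_left_cancel this).symm
  rw [h1, h2]
  exact hc

variable (P)

/-- The star of a finite vertex, with the potentials of the sectors. -/
theorem star_left (v : G.V) (hv : ¬ G.IsInf v) :
    (∃ k k', k' ≠ k ∧ (∀ h, G.vert h = v ↔ h = k ∨ h = k') ∧ P.dir k' = - P.dir k ∧
      P.LineAt k (P.pos v) ∧
      ∀ (M : Type) [AddCommGroup M] (W : G.H → M), IsFlow G W →
        P.left W k = P.left W (G.flip k') ∧ P.left W k' = P.left W (G.flip k)) ∨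
    (∃ k₁ k₂ k₃, k₁ ≠ k₂ ∧ k₂ ≠ k₃ ∧ k₁ ≠ k₃ ∧ (∀ h, G.vert h = v ↔ h = k₁ ∨ h = k₂ ∨ h = k₃) ∧
      det₂ (P.dir k₁) (P.dir k₂) = 1 ∧ P.dir k₃ = -(P.dir k₁ + P.dir k₂) ∧
      ∀ (M : Type) [AddCommGroup M] (W : G.H → M), IsFlow G W →
        (P.left W k₁ = P.left W (G.flip k₂) ∧ P.left W k₂ = P.left W (G.flip k₃) ∧
          P.left W k₃ = P.left W (G.flip k₁)) ∧
        ∀ᶠ x in 𝓝 (P.pos v),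
          (P.sweep W x = P.left W k₁ ∧ 0 ≤ cr (P.dir k₁) (x - P.pos v) ∧
            cr (P.dir k₂) (x - P.pos v) ≤ 0) ∨
          (P.sweep W x = P.left W k₂ ∧ 0 ≤ cr (P.dir k₂) (x - P.pos v) ∧
            cr (P.dir k₃) (x - P.pos v) ≤ 0) ∨
          (P.sweep W x = P.left W k₃ ∧ 0 ≤ cr (P.dir k₃) (x - P.pos v) ∧
            cr (P.dir k₁) (x - P.pos v) ≤ 0)) := by
  rcases P.star v hv with ⟨k, k', hne, hk, hd⟩ | ⟨k₁, k₂, k₃, h₁₂, h₂₃, h₁₃, hk, hdet, hd⟩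
  · left
    have hline := P.lineAt_pos hv hne hk hd
    have hline' := P.lineAt_pos hv hne.symm (fun h => by rw [hk, or_comm])
      (show P.dir k = - P.dir k' by rw [hd, neg_neg])
    refine ⟨k, k', hne, hk, hd, hline, ?_⟩
    intro M _ W hW
    have hkv : G.vert k = v := (hk k).2 (Or.inl rfl)
    have hkv' : G.vert k' = v := (hk k').2 (Or.inr rfl)
    have a1 := LineAt.left_eq (P := P) (k := k) (by rwa [hkv]) (by rwa [hkv]) hW
    have a2 := LineAt.left_eq (P := P) (k := k') (by rwa [hkv']) (by rwa [hkv']) hW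
    rw [hkv] at a1
    rw [hkv', hd] at a2
    constructor
    · obtain ⟨x, h1, h2, h3⟩ := ((frequently_cr_pos (P.dir_primitive k) (P.pos v)).and_eventually
        (a1.and a2)).exists
      rw [cr_neg_left] at h3
      rcases h2 with h2 | h2 <;> rcases h3 with h3 | h3
      · linarith [h2.2]
      · linarith [h2.2]
      · rw [← h2.1, h3.1]
      · linarith [h3.2]
    · obtain ⟨x, h1, h2, h3⟩ := ((frequently_cr_pos (P.dir_primitive k') (P.pos v)).and_eventually
        (a1.and a2)).exists
      rw [hd, cr_neg_left] at h1
      rw [cr_neg_left] at h3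
      rcases h2 with h2 | h2 <;> rcases h3 with h3 | h3
      · linarith [h3.2]
      · rw [← h2.1, h3.1]
      · linarith [h2.2]
      · linarith [h2.2]
  · right
    refine ⟨k₁, k₂, k₃, h₁₂, h₂₃, h₁₃, hk, hdet, hd, ?_⟩
    intro M _ W hW
    obtain ⟨hdet', hd'⟩ := det_rotate hdet hd
    obtain ⟨hdet'', hd''⟩ := det_rotate hdet' hd'
    have hk1 : G.vert k₁ = v := (hk k₁).2 (Or.inl rfl)
    have hk2 : G.vert k₂ = v := (hk k₂).2 (Or.inr (Or.inl rfl))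
    have hk3 : G.vert k₃ = v := (hk k₃).2 (Or.inr (Or.inr rfl))
    obtain ⟨c, hc⟩ := P.tripodAt_pos hv h₁₂ h₂₃ h₁₃ hk hdet hd M W hW
    have hs : W k₁ + W k₂ + W k₃ = 0 := by
      classical
      rw [← sum_vert_three h₁₂ h₂₃ h₁₃ hk W]; exact hW.2 v hv
    have l1 : P.left W k₁ = c := by
      refine P.left_eq_of_star hW (by rwa [hk1]) (e := P.dir k₂) (by rw [det₂_eq] at *; linarith) ?_
      rw [hk1]
      filter_upwards [hc] with x hx h0 h1
      rcases hx with hx | hx | hx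
      · exact hx.1
      · linarith [hx.2.1]
      · linarith [hx.2.2]
    have l2 : P.left W k₂ = c + W k₂ := by
      refine P.left_eq_of_star hW (by rwa [hk2]) (e := P.dir k₃) (by rw [det₂_eq] at *; linarith) ?_
      rw [hk2]
      filter_upwards [hc] with x hx h0 h1
      rcases hx with hx | hx | hx
      · linarith [hx.2.2]
      · exact hx.1
      · linarith [hx.2.1]
    have l3 : P.left W k₃ = c - W k₁ := by
      refine P.left_eq_of_star hW (by rwa [hk3]) (e := P.dir k₁) (by rw [det₂_eq] at *; linarith) ?_
      rw [hk3]
      filter_upwards [hc] with x hx h0 h1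
      rcases hx with hx | hx | hx
      · linarith [hx.2.1]
      · linarith [hx.2.2]
      · exact hx.1
    have f1 := P.left_sub_left_flip hW k₁
    have f2 := P.left_sub_left_flip hW k₂
    have f3 := P.left_sub_left_flip hW k₃
    rw [l1, sub_eq_iff_eq_add, ← sub_eq_iff_eq_add'] at f1
    rw [l2, sub_eq_iff_eq_add, add_comm, add_right_inj] at f2
    rw [l3, sub_eq_iff_eq_add, ← sub_eq_iff_eq_add'] at f3
    refine ⟨⟨?_, ?_, ?_⟩, ?_⟩
    · rw [l1, ← f2]
    · rw [l2, ← f3, ← sub_eq_zero, ← hs]; abel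
    · rw [l3, ← f1]
    · rw [l1, l2, l3]; exact hc

end PlaneGraph

/-! ### The convex height function -/

/-- A continuous function with the midpoint inequality at small scales is convex. -/
theorem convexOn_of_local_midpoint {f : Plane → ℝ} (hf : Continuous f)
    (hmid : ∀ z u, ∀ᶠ t in 𝓝[>] (0 : ℝ), 2 * f z ≤ f (z + t • u) + f (z - t • u)) :
    ConvexOn ℝ Set.univ f := by
  refine ⟨convex_univ, fun x _ y _ a b ha hb hab => ?_⟩
  by_contra! hlt
  -- The excess of f over its chord: zero at both ends and, by assumption, positive somewhere.
  set h : ℝ → ℝ := fun s => f (x + s • (y - x)) - (1 - s) * f x - s * f y with hh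
  have hc : Continuous h := by
    have : Continuous fun s : ℝ => f (x + s • (y - x)) := hf.comp (by fun_prop)
    simp only [hh]; fun_prop
  obtain ⟨s₀, hs₀, hmax⟩ := isCompact_Icc.exists_isMaxOn (Set.nonempty_Icc.2 zero_le_one)
    (hc.continuousOn (s := Set.Icc (0 : ℝ) 1))
  have hb1 : b ∈ Set.Icc (0 : ℝ) 1 := ⟨hb, by linarith⟩
  have hbpos : 0 < h b := by
    have e : x + b • (y - x) = a • x + b • y := by
      have : a = 1 - b := by linarith
      rw [this]; module
    simp only [hh, e]
    simp only [smul_eq_mul] at hlt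
    have : a = 1 - b := by linarith
    rw [this] at hlt ⊢
    linarith
  have hm : 0 < h s₀ := hbpos.trans_le (hmax hb1)
  have hK : IsCompact (Set.Icc (0 : ℝ) 1 ∩ h ⁻¹' {h s₀}) :=
    isCompact_Icc.inter_right (isClosed_singleton.preimage hc)
  -- At the leftmost maximum, the values on the left are strictly smaller and those on the right not
  -- larger, against the midpoint inequality.
  obtain ⟨s, ⟨hs, hseq⟩, hleast⟩ := hK.exists_isLeast ⟨s₀, hs₀, rfl⟩
  have hseq' : h s = h s₀ := hseq
  have h0 : h 0 = 0 := by simp [hh]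
  have h1 : h 1 = 0 := by simp [hh]
  have s0 : 0 < s := lt_of_le_of_ne hs.1 fun e => by rw [← e, h0] at hseq'; linarith
  have s1 : s < 1 := lt_of_le_of_ne hs.2 fun e => by rw [e, h1] at hseq'; linarith
  obtain ⟨t, ⟨⟨ht, ht1⟩, ht2⟩, ht3⟩ := (((hmid (x + s • (y - x)) (y - x)).and
    (nhdsWithin_le_nhds (Iio_mem_nhds s0))).and
    (nhdsWithin_le_nhds (Iio_mem_nhds (show 0 < 1 - s by linarith)))).and
    self_mem_nhdsWithin |>.exists
  have ht1' : t < s := ht1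
  have ht2' : t < 1 - s := ht2
  have ht3' : 0 < t := ht3
  have e1 : x + s • (y - x) + t • (y - x) = x + (s + t) • (y - x) := by module
  have e2 : x + s • (y - x) - t • (y - x) = x + (s - t) • (y - x) := by module
  rw [e1, e2] at ht
  have ht' : 2 * h s ≤ h (s + t) + h (s - t) := by simp only [hh]; linarith
  have m1 : h (s + t) ≤ h s₀ := hmax ⟨by linarith, by linarith⟩
  have m2 : h (s - t) ≤ h s₀ := hmax ⟨by linarith, by linarith⟩
  have m3 : h (s - t) ≠ h s₀ := fun e => by
    have : s ≤ s - t := hleast ⟨⟨by linarith, by linarith⟩, e⟩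
    linarith
  have := lt_of_le_of_ne m2 m3
  linarith

/-- Affine forms on the plane with integral linear part. -/
abbrev Aff : Type := (Fin 2 → ℤ) × ℝ

/-- The pairing of an integral covector with a vector. -/
def dot (n : Fin 2 → ℤ) (x : Plane) : ℝ := n 0 * x 0 + n 1 * x 1

/-- The value of an affine form at a point. -/
def Aff.eval (x : Plane) : Aff →+ ℝ where
  toFun L := dot L.1 x + L.2
  map_zero' := by simp [dot]
  map_add' := by intro L L'; simp [dot]; ring

theorem Aff.eval_apply (x : Plane) (L : Aff) : Aff.eval x L = dot L.1 x + L.2 := rfl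

theorem dot_add (n : Fin 2 → ℤ) (x y : Plane) : dot n (x + y) = dot n x + dot n y := by
  simp [dot]; ring

theorem dot_smul (n : Fin 2 → ℤ) (t : ℝ) (x : Plane) : dot n (t • x) = t * dot n x := by
  simp [dot]; ring

theorem dot_sub_left (m n : Fin 2 → ℤ) (x : Plane) : dot (m - n) x = dot m x - dot n x := by
  simp [dot]; ring

theorem Aff.eval_add_smul (x y : Plane) (t : ℝ) (L : Aff) :
    Aff.eval (x + t • y) L = Aff.eval x L + t * dot L.1 y := by
  rw [eval_apply, eval_apply, dot_add, dot_smul]; ring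

theorem Aff.continuous_eval (L : Aff) : Continuous fun x => Aff.eval x L := by
  simp only [eval_apply, dot]; fun_prop

theorem Aff.eq_of_eventuallyEq {L L' : Aff} {z : Plane}
    (h : ∀ᶠ x in 𝓝 z, Aff.eval x L = Aff.eval x L') : L = L' := by
  have hz := h.self_of_nhds
  have key : ∀ y, dot L.1 y = dot L'.1 y := by
    intro y
    obtain ⟨t, ht, ht0⟩ := (((tendsto_add_smul z y).eventually h).and self_mem_nhdsWithin).exists
    rw [Aff.eval_add_smul, Aff.eval_add_smul, hz] at ht
    have : (0 : ℝ) < t := ht0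
    exact mul_left_cancel₀ this.ne' (add_left_cancel ht)
  have e0 := key ![1, 0]
  have e1 := key ![0, 1]
  simp [dot] at e0 e1
  have h1 : L.1 = L'.1 := by funext i; fin_cases i <;> simp [e0, e1]
  refine Prod.ext h1 ?_
  rw [Aff.eval_apply, Aff.eval_apply, h1] at hz
  exact add_left_cancel hz

/-- Rotation by a right angle. -/
def rot (d : Fin 2 → ℤ) : Fin 2 → ℤ := ![-(d 1), d 0]

theorem dot_rot (d : Fin 2 → ℤ) (y : Plane) : dot (rot d) y = cr d y := by
  simp [dot, rot, cr]; ring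

namespace PlaneGraph

variable {G : AbstractTropicalCurve} (P : PlaneGraph G)

/-- The flow of affine forms whose potential is the convex function bending along the curve. -/
noncomputable def affFlow (h : G.H) : Aff := (rot (P.dir h), P.side h 0)

theorem eval_affFlow (h : G.H) (x : Plane) : Aff.eval x (P.affFlow h) = P.side h x := by
  rw [Aff.eval_apply, affFlow, dot_rot]
  have := P.side_sub h x 0
  rw [sub_zero] at this
  simp only
  linarith

theorem side_pos {h : G.H} (hh : ¬ G.IsInf (G.vert h)) : P.side h (P.pos (G.vert h)) = 0 := by
  rw [P.side_of_vert hh]; simp [cr]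

/-- The slopes add up to zero by the balancing condition of the curve, and then so do the constants,
because all the affine forms vanish at the common vertex. -/
theorem isFlow_affFlow : IsFlow G P.affFlow := by
  classical
  refine ⟨fun h => ?_, fun v hv => ?_⟩
  · rw [affFlow, affFlow, P.dir_flip, P.side_flip]
    refine Prod.ext ?_ rfl
    funext i
    fin_cases i <;> simp [rot]
  · have e : ∀ h, G.vert h = v → P.side h 0 = - cr (P.dir h) (P.pos v) := by
      rintro h rfl
      rw [P.side_of_vert hv, cr_sub]; simp [cr]
    rcases P.star v hv with ⟨k, k', hne, hk, hd⟩ | ⟨k₁, k₂, k₃, h₁₂, h₂₃, h₁₃, hk, hdet, hd⟩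
    · rw [sum_vert_two hne hk]
      simp only [affFlow]
      rw [e k ((hk _).2 (Or.inl rfl)), e k' ((hk _).2 (Or.inr rfl)), hd]
      refine Prod.ext ?_ ?_
      · funext i; fin_cases i <;> simp [rot]
      · simp [cr]
    · rw [sum_vert_three h₁₂ h₂₃ h₁₃ hk]
      simp only [affFlow]
      rw [e k₁ ((hk _).2 (Or.inl rfl)), e k₂ ((hk _).2 (Or.inr (Or.inl rfl))),
        e k₃ ((hk _).2 (Or.inr (Or.inr rfl))), hd]
      refine Prod.ext ?_ ?_
      · funext i; fin_cases i <;> simp [rot] <;> ring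
      · simp [cr]; ring

/-- The affine form of the region to the left of a half-edge. -/
noncomputable def form (h : G.H) : Aff := P.left P.affFlow h

theorem eval_form (h : G.H) (x : Plane) :
    Aff.eval x (P.form h) = Aff.eval x (P.form (G.flip h)) + P.side h x := by
  have := congrArg (Aff.eval x) (P.left_sub_left_flip P.isFlow_affFlow h)
  rw [map_sub, P.eval_affFlow] at this
  rw [form, form]; linarith

/-- The local forms of a plane graph, with the potentials of the adjacent regions. -/
theorem local_left (z : Plane) : z ∉ P.support ∨
    (∃ k, P.side k z = 0 ∧ ∀ (M : Type) [AddCommGroup M] (W : G.H → M), IsFlow G W →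
      ∀ᶠ x in 𝓝 z, (P.sweep W x = P.left W (G.flip k) ∧ cr (P.dir k) (x - z) ≤ 0) ∨
        (P.sweep W x = P.left W k ∧ 0 ≤ cr (P.dir k) (x - z))) ∨
    (∃ k₁ k₂ k₃, P.side k₁ z = 0 ∧ P.side k₂ z = 0 ∧ P.side k₃ z = 0 ∧
      det₂ (P.dir k₁) (P.dir k₂) = 1 ∧ P.dir k₃ = -(P.dir k₁ + P.dir k₂) ∧
      ∀ (M : Type) [AddCommGroup M] (W : G.H → M), IsFlow G W →
        (P.left W k₁ = P.left W (G.flip k₂) ∧ P.left W k₂ = P.left W (G.flip k₃) ∧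
          P.left W k₃ = P.left W (G.flip k₁)) ∧
        ∀ᶠ x in 𝓝 z,
          (P.sweep W x = P.left W k₁ ∧ 0 ≤ cr (P.dir k₁) (x - z) ∧ cr (P.dir k₂) (x - z) ≤ 0) ∨
          (P.sweep W x = P.left W k₂ ∧ 0 ≤ cr (P.dir k₂) (x - z) ∧ cr (P.dir k₃) (x - z) ≤ 0) ∨
          (P.sweep W x = P.left W k₃ ∧ 0 ≤ cr (P.dir k₃) (x - z) ∧
            cr (P.dir k₁) (x - z) ≤ 0)) := by
  by_cases hz : z ∈ P.support
  swap
  · exact Or.inl hz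
  right
  rcases hz with ⟨v, hv, rfl⟩ | ⟨h, hh⟩
  · have hside : ∀ k, G.vert k = v → P.side k (P.pos v) = 0 := by
      rintro k rfl; exact P.side_pos hv
    rcases P.star_left v hv with ⟨k, k', hne, hk, hd, hl, hW⟩ |
      ⟨k₁, k₂, k₃, h₁₂, h₂₃, h₁₃, hk, hdet, hd, hW⟩
    · have hkv : G.vert k = v := (hk k).2 (Or.inl rfl)
      refine Or.inl ⟨k, hside k hkv, fun M _ W hf => ?_⟩
      have := LineAt.left_eq (P := P) (k := k) (by rwa [hkv]) (by rwa [hkv]) hf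
      rwa [hkv] at this
    · exact Or.inr ⟨k₁, k₂, k₃, hside _ ((hk _).2 (Or.inl rfl)),
        hside _ ((hk _).2 (Or.inr (Or.inl rfl))), hside _ ((hk _).2 (Or.inr (Or.inr rfl))),
        hdet, hd, hW⟩
  · refine Or.inl ⟨h, hh.1, fun M _ W hf => ?_⟩
    have h2 := P.isLeft_left hf (G.flip h) z (by rwa [P.edge_flip])
    rw [P.dir_flip] at h2
    obtain ⟨c, hc⟩ := P.lineAt_of_mem_edge hh M W hf
    have e : P.left W (G.flip h) = c := P.left_eq hf (z := z) (by rwa [P.edge_flip]) (by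
      filter_upwards [hc] with x hx h0
      rw [P.dir_flip, cr_neg_left] at h0
      rcases hx with hx | hx
      · exact hx.1
      · linarith [hx.2])
    have e' : P.left W h = c + W h := by
      have := P.left_sub_left_flip hf h
      rw [e, sub_eq_iff_eq_add, add_comm] at this
      exact this
    rw [e, e']; exact hc

/-- The convex function bending along the curve. -/
noncomputable def height (x : Plane) : ℝ := Aff.eval x (P.sweep P.affFlow x)

/-- Near a point, the height is an affine form plus a nonnegative function. -/
theorem height_local (z : Plane) : ∃ (c : Aff) (g : Plane → ℝ), Continuous g ∧ g 0 = 0 ∧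
    (∀ y, 0 ≤ g y) ∧ (z ∈ P.support → ∃ y, ∀ t : ℝ, 0 < t → 0 < g (t • y)) ∧
    ∀ᶠ x in 𝓝 z, P.height x = Aff.eval x c + g (x - z) := by
  rcases P.local_left z with hz | ⟨k, hk, hW⟩ | ⟨k₁, k₂, k₃, hk₁, hk₂, hk₃, hdet, hd, hW⟩
  · obtain ⟨c, hc⟩ := P.eventually_sweep_const P.isFlow_affFlow hz
    refine ⟨c, 0, continuous_const, rfl, fun _ => le_rfl, fun h => absurd h hz, ?_⟩
    filter_upwards [hc] with x hx
    rw [height, hx]; simp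
  · refine ⟨P.form (G.flip k), fun y => max 0 (cr (P.dir k) y),
      continuous_const.max (continuous_cr _), by simp [cr], fun y => le_max_left _ _, fun _ => ?_, ?_⟩
    · obtain ⟨w, hw⟩ := (P.dir_primitive k).exists_det
      refine ⟨toPlane w, fun t ht => lt_max_of_lt_right ?_⟩
      rw [cr_smul, cr_toPlane, hw]
      simpa using ht
    · filter_upwards [hW _ _ P.isFlow_affFlow] with x hx
      rcases hx with hx | hx
      · rw [height, hx.1, max_eq_left hx.2, add_zero]; rfl
      · rw [height, hx.1, max_eq_right hx.2, ← P.side_of_eq_zero hk]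
        exact P.eval_form k x
  · obtain ⟨⟨l1, l2, l3⟩, hW⟩ := hW _ _ P.isFlow_affFlow
    -- At a tripod the height is the maximum of three affine forms; the base form belongs to the
    -- sector bordered by `k₁` and `k₂`.
    refine ⟨P.form k₁, fun y => max 0 (max (cr (P.dir k₂) y) (-cr (P.dir k₁) y)),
      continuous_const.max ((continuous_cr _).max (continuous_cr _).neg), by simp [cr],
      fun y => le_max_left _ _, fun _ => ?_, ?_⟩
    · refine ⟨- toPlane (P.dir k₁), fun t ht => ?_⟩
      refine lt_max_of_lt_right (lt_max_of_lt_left ?_)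
      have : cr (P.dir k₂) (-toPlane (P.dir k₁)) = det₂ (P.dir k₁) (P.dir k₂) := by
        rw [det₂_eq]; simp [cr]; ring
      rw [cr_smul, this, hdet]
      simpa using ht
    · have ha : ∀ y, cr (P.dir k₃) y = - cr (P.dir k₁) y - cr (P.dir k₂) y := by
        intro y; rw [hd]; simp [cr]; ring
      filter_upwards [hW] with x hx
      rw [ha] at hx
      rcases hx with hx | hx | hx
      · rw [height, hx.1, max_eq_left (max_le hx.2.2 (by linarith [hx.2.1])), add_zero]; rfl
      · rw [height, hx.1, max_eq_left (a := cr _ _) (by linarith [hx.2.2]),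
          max_eq_right hx.2.1, ← P.side_of_eq_zero hk₂, form, l1]
        exact P.eval_form k₂ x
      · rw [height, hx.1, max_eq_right (a := cr _ _) (by linarith [hx.2.1]),
          max_eq_right (by linarith [hx.2.2]), ← P.side_of_eq_zero hk₁, P.eval_form k₁, l3]
        unfold form
        ring

theorem continuous_height : Continuous P.height := by
  refine continuous_iff_continuousAt.2 fun z => ?_
  obtain ⟨c, g, hg, -, -, -, h⟩ := P.height_local z
  refine ContinuousAt.congr ?_ (h.mono fun _ => Eq.symm)
  exact ((Aff.continuous_eval c).add (hg.comp (by fun_prop))).continuousAt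

/-- In the midpoint inequality the affine part cancels, leaving a nonnegative function that vanishes
at the centre. -/
theorem convexOn_height : ConvexOn ℝ Set.univ P.height := by
  refine convexOn_of_local_midpoint P.continuous_height fun z u => ?_
  obtain ⟨c, g, -, hg0, hg, -, h⟩ := P.height_local z
  have h1 := (tendsto_add_smul z u).eventually h
  have h2 := (tendsto_add_smul z (-u)).eventually h
  filter_upwards [h1, h2] with t h1 h2
  have hz := h.self_of_nhds
  rw [sub_self, hg0, add_zero] at hz
  have e : z - t • u = z + t • (-u) := by simp [sub_eq_add_neg]
  rw [e, h1, h2, hz, Aff.eval_add_smul, Aff.eval_add_smul]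
  have e2 : dot c.1 (-u) = - dot c.1 u := by simp [dot]; ring
  rw [e2]
  have := hg (z + t • u - z)
  have := hg (z + t • (-u) - z)
  linarith

/-! ### The regions of the complement -/

/-- The open region on which the height is a given affine form. -/
def face (L : Aff) : Set Plane := interior {x | P.height x = Aff.eval x L}

theorem mem_face_iff {L : Aff} {z : Plane} :
    z ∈ P.face L ↔ ∀ᶠ x in 𝓝 z, P.height x = Aff.eval x L := mem_interior_iff_mem_nhds

/-- If the height is affine near `z`, then g(ty) + g(-ty) = 0 for the nonnegative function g of
`height_local`; at a point of the curve g is positive in some direction. -/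
theorem not_mem_support_of_mem_face {L : Aff} {z : Plane} (hz : z ∈ P.face L) : z ∉ P.support := by
  intro hs
  rw [P.mem_face_iff] at hz
  obtain ⟨c, g, -, hg0, hg, hy, h⟩ := P.height_local z
  obtain ⟨y, hy⟩ := hy hs
  have hb := hz.and h
  have h0 := hb.self_of_nhds
  rw [sub_self, hg0, add_zero] at h0
  have h1 := (tendsto_add_smul z y).eventually hb
  have h2 := (tendsto_add_smul z (-y)).eventually hb
  obtain ⟨t, ⟨h1, h2⟩, ht⟩ := ((h1.and h2).and self_mem_nhdsWithin).exists
  have e1 := h1.1.symm.trans h1.2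
  have e2 := h2.1.symm.trans h2.2
  have e0 := h0.1.symm.trans h0.2
  rw [Aff.eval_add_smul, Aff.eval_add_smul, add_sub_cancel_left, e0] at e1 e2
  have e3 : ∀ n, dot n (-y) = - dot n y := by intro n; simp [dot]; ring
  rw [e3, e3] at e2
  have := hg (t • -y)
  have := hy t ht
  linarith

theorem mem_face_of_eventually_sweep {L : Aff} {z : Plane}
    (h : ∀ᶠ x in 𝓝 z, P.sweep P.affFlow x = L) : z ∈ P.face L := by
  rw [P.mem_face_iff]
  filter_upwards [h] with x hx
  rw [height, hx]

theorem mem_face_sweep {z : Plane} (hz : z ∉ P.support) : z ∈ P.face (P.sweep P.affFlow z) := by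
  obtain ⟨c, hc⟩ := P.eventually_sweep_const P.isFlow_affFlow hz
  rw [hc.self_of_nhds]
  exact P.mem_face_of_eventually_sweep hc

theorem sweep_eq_of_mem_face {L : Aff} {z : Plane} (hz : z ∈ P.face L) :
    P.sweep P.affFlow z = L := by
  have h1 := P.mem_face_sweep (P.not_mem_support_of_mem_face hz)
  rw [P.mem_face_iff] at hz h1
  refine Aff.eq_of_eventuallyEq (z := z) ?_
  filter_upwards [hz, h1] with x hx hx'
  rw [← hx, hx']

/-- Points of the region to the left of a half-edge, close to the half-edge. -/
theorem frequently_mem_face_form {h : G.H} {z : Plane} (hz : z ∈ P.edge h) {M : Type}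
    [AddCommGroup M] {W : G.H → M} (hW : IsFlow G W) :
    ∃ᶠ x in 𝓝 z, x ∈ P.face (P.form h) ∧ P.sweep W x = P.left W h := by
  have h1 := eventually_eventually_nhds.2 (P.isLeft_left P.isFlow_affFlow h z hz)
  have h2 := P.isLeft_left hW h z hz
  refine ((frequently_cr_pos (P.dir_primitive h) z).and_eventually (h1.and h2)).mono ?_
  rintro x ⟨hx, h3, h4⟩
  refine ⟨P.mem_face_of_eventually_sweep ?_, h4 hx⟩
  have hc : Continuous fun x : Plane => cr (P.dir h) (x - z) := (continuous_cr _).comp (by fun_prop)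
  filter_upwards [h3, (hc.tendsto x).eventually_const_lt hx] with y h5 h6
  exact h5 h6

theorem face_form_nonempty (h : G.H) : (P.face (P.form h)).Nonempty := by
  obtain ⟨z, hz⟩ := P.edge_nonempty h
  obtain ⟨x, hx⟩ := (P.frequently_mem_face_form hz P.isFlow_affFlow).exists
  exact ⟨x, hx.1⟩

/-- The affine forms of the regions. -/
def forms : Set Aff := Set.range (P.sweep P.affFlow)

theorem finite_forms : P.forms.Finite := by
  classical
  refine (Set.toFinite (Set.range fun S : Finset G.H => ∑ h ∈ S, P.affFlow h)).subset ?_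
  rintro _ ⟨x, rfl⟩
  exact ⟨Finset.univ.filter fun h => P.Below h x, by simp only [sweep, Finset.sum_filter]⟩

theorem face_nonempty {L : Aff} (hL : L ∈ P.forms) : (P.face L).Nonempty := by
  obtain ⟨x, rfl⟩ := hL
  rcases P.local_left x with hz | ⟨k, -, hW⟩ | ⟨k₁, k₂, k₃, -, -, -, -, -, hW⟩
  · exact ⟨x, P.mem_face_sweep hz⟩
  · rcases (hW _ _ P.isFlow_affFlow).self_of_nhds with h | h <;> rw [h.1] <;>
      exact P.face_form_nonempty _
  · rcases (hW _ _ P.isFlow_affFlow).2.self_of_nhds with h | h | h <;> rw [h.1] <;>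
      exact P.face_form_nonempty _

theorem mem_forms_of_mem_face {L : Aff} {x : Plane} (hx : x ∈ P.face L) : L ∈ P.forms :=
  ⟨x, P.sweep_eq_of_mem_face hx⟩

theorem form_mem_forms (h : G.H) : P.form h ∈ P.forms := by
  obtain ⟨x, hx⟩ := P.face_form_nonempty h
  exact P.mem_forms_of_mem_face hx

/-- A convex function lies above each of its tangents. Hence the height is the maximum of the forms.
-/
theorem eval_le_height {L : Aff} (hL : L ∈ P.forms) (y : Plane) : Aff.eval y L ≤ P.height y := by
  obtain ⟨x, hx⟩ := P.face_nonempty hL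
  rw [P.mem_face_iff] at hx
  have h1 := (tendsto_add_smul x (y - x)).eventually hx
  obtain ⟨t, ⟨h1, ht1⟩, ht⟩ := ((h1.and (nhdsWithin_le_nhds (Iio_mem_nhds one_pos))).and
    self_mem_nhdsWithin).exists
  have ht' : (0 : ℝ) < t := ht
  have ht1' : t < 1 := ht1
  have h2 := P.convexOn_height.2 (Set.mem_univ x) (Set.mem_univ y)
    (show 0 ≤ 1 - t by linarith) ht'.le (by ring)
  have e : (1 - t) • x + t • y = x + t • (y - x) := by module
  rw [e, h1, hx.self_of_nhds, Aff.eval_add_smul] at h2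
  have e2 : dot L.1 (y - x) = Aff.eval y L - Aff.eval x L := by
    rw [Aff.eval_apply, Aff.eval_apply]; simp [dot]; ring
  rw [e2] at h2
  simp only [smul_eq_mul] at h2
  have : t * Aff.eval y L ≤ t * P.height y := by linarith
  exact le_of_mul_le_mul_left this ht'

/-- The set where a convex function touches an affine minorant is convex. -/
theorem convex_face {L : Aff} (hL : L ∈ P.forms) : Convex ℝ (P.face L) := by
  refine Convex.interior ?_
  intro x hx y hy a b ha hb hab
  have hx' : P.height x = Aff.eval x L := hx
  have hy' : P.height y = Aff.eval y L := hy
  have h2 := P.convexOn_height.2 (Set.mem_univ x) (Set.mem_univ y) ha hb hab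
  refine le_antisymm (h2.trans (le_of_eq ?_)) (P.eval_le_height hL _)
  rw [hx', hy']
  simp only [Aff.eval_apply, smul_eq_mul, dot_add, dot_smul]
  linear_combination L.2 * hab

/-- Every potential is constant on the regions. -/
theorem sweep_eq_of_face {M : Type} [AddCommGroup M] {W : G.H → M} (hW : IsFlow G W) {L : Aff}
    {x y : Plane} (hx : x ∈ P.face L) (hy : y ∈ P.face L) : P.sweep W x = P.sweep W y := by
  let _ : TopologicalSpace M := ⊥
  have : DiscreteTopology M := ⟨rfl⟩
  have hc : ContinuousOn (P.sweep W) (P.face L) := by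
    intro z hz
    obtain ⟨c, hc⟩ := P.eventually_sweep_const hW (P.not_mem_support_of_mem_face hz)
    exact (continuousAt_const.congr (hc.mono fun _ => Eq.symm)).continuousWithinAt
  exact (P.convex_face (P.mem_forms_of_mem_face hx)).isPreconnected.constant hc hx hy

theorem left_eq_sweep {M : Type} [AddCommGroup M] {W : G.H → M} (hW : IsFlow G W) {h : G.H}
    {x : Plane} (hx : x ∈ P.face (P.form h)) : P.left W h = P.sweep W x := by
  obtain ⟨z, hz⟩ := P.edge_nonempty h
  obtain ⟨y, hy, e⟩ := (P.frequently_mem_face_form hz hW).exists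
  rw [← e, P.sweep_eq_of_face hW hy hx]

/-- A function of the regions which takes equal values on adjacent regions is constant. -/
theorem eq_of_forall_flip {α : Type} (X : Aff → α) (hX : ∀ h, X (P.form h) = X (P.form (G.flip h)))
    {L L' : Aff} (hL : L ∈ P.forms) (hL' : L' ∈ P.forms) : X L = X L' := by
  obtain ⟨x, rfl⟩ := hL
  obtain ⟨x', rfl⟩ := hL'
  -- Since adjacent regions share a value, the composition is locally constant on the whole plane,
  -- also across edges and vertices.
  have : IsLocallyConstant fun x => X (P.sweep P.affFlow x) := by
    refine (IsLocallyConstant.iff_eventually_eq _).2 fun z => ?_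
    have key : ∀ {a : α}, (∀ᶠ x in 𝓝 z, X (P.sweep P.affFlow x) = a) →
        ∀ᶠ y in 𝓝 z, X (P.sweep P.affFlow y) = X (P.sweep P.affFlow z) := by
      intro a h
      rw [h.self_of_nhds]; exact h
    rcases P.local_left z with hz | ⟨k, -, hW⟩ | ⟨k₁, k₂, k₃, -, -, -, -, -, hW⟩
    · obtain ⟨c, hc⟩ := P.eventually_sweep_const P.isFlow_affFlow hz
      exact key (hc.mono fun x hx => congrArg X hx)
    · refine key (a := X (P.form k)) ?_
      filter_upwards [hW _ _ P.isFlow_affFlow] with x hx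
      rcases hx with hx | hx
      · rw [hx.1]; exact (hX k).symm
      · rw [hx.1]; rfl
    · obtain ⟨⟨l1, l2, l3⟩, hW⟩ := hW _ _ P.isFlow_affFlow
      refine key (a := X (P.form k₁)) ?_
      filter_upwards [hW] with x hx
      rcases hx with hx | hx | hx
      · rw [hx.1]; rfl
      · rw [hx.1, form, l1]; exact hX k₂
      · rw [hx.1, l3]; exact (hX k₁).symm
  exact this.apply_eq_of_isPreconnected isPreconnected_univ (Set.mem_univ _) (Set.mem_univ _)

end PlaneGraph

/-! ### Bounded regions and the basis of boundary cycles -/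

/-- The integral pairing. -/
def idot (m u : Fin 2 → ℤ) : ℤ := m 0 * u 0 + m 1 * u 1

theorem dot_toPlane (m u : Fin 2 → ℤ) : dot m (toPlane u) = idot m u := by
  simp [dot, idot]

theorem idot_rot (d u : Fin 2 → ℤ) : idot (rot d) u = det₂ d u := by
  rw [det₂_eq]; simp [idot, rot]; ring

theorem rot_ne_zero {d : Fin 2 → ℤ} (hd : IsPrimitive d) : rot d ≠ 0 := by
  intro h
  apply hd.ne_zero
  have h0 := congrFun h 0
  have h1 := congrFun h 1
  simp [rot] at h0 h1
  funext i
  fin_cases i <;> simp [h0, h1]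

theorem lev_add_smul (x y : Plane) (t : ℝ) : lev (x + t • y) = lev x + t * lev y := by
  simp [lev]; ring

namespace PlaneGraph

variable {G : AbstractTropicalCurve} (P : PlaneGraph G)

theorem forms_nonempty : P.forms.Nonempty := ⟨_, 0, rfl⟩

theorem exists_height_eq (x : Plane) : ∃ L ∈ P.forms, P.height x = Aff.eval x L :=
  ⟨_, ⟨x, rfl⟩, rfl⟩

/-- Each form is maximal on its own region, so of two forms with equal slopes neither has the
smaller constant. -/
theorem eq_of_slope_eq {L L' : Aff} (hL : L ∈ P.forms) (hL' : L' ∈ P.forms) (h : L.1 = L'.1) :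
    L = L' := by
  have key : ∀ {L L' : Aff}, L ∈ P.forms → L' ∈ P.forms → L.1 = L'.1 → L'.2 ≤ L.2 := by
    intro L L' hL hL' h
    obtain ⟨x, hx⟩ := P.face_nonempty hL
    have h1 := P.eval_le_height hL' x
    rw [((P.mem_face_iff).1 hx).self_of_nhds, Aff.eval_apply, Aff.eval_apply, h] at h1
    linarith
  exact Prod.ext h (le_antisymm (key hL' hL h.symm) (key hL hL' h))

/-- Duality between the curve and the subdivision of its Newton polygon: an edge is orthogonal to
the difference of the adjacent slopes. -/
theorem form_sub (h : G.H) : (P.form h).1 - (P.form (G.flip h)).1 = rot (P.dir h) :=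
  congrArg Prod.fst (P.left_sub_left_flip P.isFlow_affFlow h)

theorem form_ne (h : G.H) : P.form h ≠ P.form (G.flip h) := by
  intro e
  have := P.form_sub h
  rw [e, sub_self] at this
  exact rot_ne_zero (P.dir_primitive h) this.symm

theorem height_of_mem_edge {h : G.H} {z : Plane} (hz : z ∈ P.edge h) :
    P.height z = Aff.eval z (P.form h) := by
  have hc : IsClosed {x | P.height x = Aff.eval x (P.form h)} :=
    isClosed_eq P.continuous_height (Aff.continuous_eval _)
  refine hc.closure_subset (mem_closure_iff_frequently.2 ?_)
  exact (P.frequently_mem_face_form hz P.isFlow_affFlow).mono fun x hx =>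
    ((P.mem_face_iff).1 hx.1).self_of_nhds

/-- The affine forms of the bounded regions. -/
def bounded : Set Aff :=
  {L | L ∈ P.forms ∧ ∀ v : Plane, v ≠ 0 → ∃ L' ∈ P.forms, 0 < dot (L'.1 - L.1) v}

/-- A form growing faster than `L` along the ray would overtake the height. -/
theorem not_mem_bounded_of_ray {L : Aff} {p v : Plane} (hv : v ≠ 0)
    (h : ∀ t : ℝ, 0 < t → P.height (p + t • v) = Aff.eval (p + t • v) L) : L ∉ P.bounded := by
  rintro ⟨-, hb⟩
  obtain ⟨L', hL', hpos⟩ := hb v hv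
  rw [dot_sub_left] at hpos
  set s := dot L'.1 v - dot L.1 v with hs
  set A := Aff.eval p L - Aff.eval p L' with hA
  -- Past the parameter |A| / s, the form `L'` exceeds `L`.
  have ht : 0 < (|A| + 1) / s := by positivity
  have h1 := P.eval_le_height hL' (p + ((|A| + 1) / s) • v)
  rw [h _ ht, Aff.eval_add_smul, Aff.eval_add_smul] at h1
  have h2 : (|A| + 1) / s * s = |A| + 1 := by field_simp
  have := le_abs_self A
  have h3 : (|A| + 1) / s * s ≤ A := by rw [hs] at h1 ⊢; linarith
  linarith

/-- Along an infinite edge the height coincides with the forms of both sides. -/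
theorem not_mem_bounded_of_isInf {h : G.H} (hi : G.IsInf (G.vert (G.flip h))) :
    P.form h ∉ P.bounded ∧ P.form (G.flip h) ∉ P.bounded := by
  have hf : ¬ G.IsInf (G.vert h) := (P.finite_end h).resolve_right (not_not.2 hi)
  have hl : G.len h = ⊤ := by
    obtain ⟨k, hk, hk'⟩ := G.isInf_spec _ hi
    rw [← G.len_flip, (hk _).1 rfl, hk']
  have he : ∀ t : ℝ, 0 < t → P.pos (G.vert h) + t • toPlane (P.dir h) ∈ P.edge h := fun t ht =>
    (P.mem_edge_iff hf _).2 ⟨t, ht, by rw [hl]; exact ENNReal.ofReal_lt_top, rfl⟩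
  have hv := (P.dir_primitive h).toPlane_ne_zero
  exact ⟨P.not_mem_bounded_of_ray hv fun t ht => P.height_of_mem_edge (he t ht),
    P.not_mem_bounded_of_ray hv fun t ht => P.height_of_mem_edge (by
      rw [P.edge_flip]; exact he t ht)⟩

theorem len_ne_top_of_mem_bounded {h : G.H} (hb : P.form h ∈ P.bounded) : G.len h ≠ ⊤ := by
  refine len_ne_top (fun hi => ?_) fun hi => (P.not_mem_bounded_of_isInf hi).1 hb
  have := (P.not_mem_bounded_of_isInf (h := G.flip h) (by rwa [G.flip_flip])).2
  rw [G.flip_flip] at this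
  exact this hb

open Classical in
/-- The boundary cycle of a region. -/
noncomputable def loop (L : Aff) (h : G.H) : ℤ :=
  (if P.form h = L then 1 else 0) - (if P.form (G.flip h) = L then 1 else 0)

/-- Around a finite vertex, the form to the left of a half-edge is the form to the right of the next
one, so the sum telescopes. The edge of an infinite vertex has unbounded regions on both sides. -/
theorem loop_mem_cycles {L : Aff} (hL : L ∈ P.bounded) : P.loop L ∈ G.cycles := by
  classical
  refine mem_cycles.2 ⟨fun h => by simp [loop, G.flip_flip], fun v => ?_⟩
  by_cases hv : G.IsInf v
  · obtain ⟨h, hh, -⟩ := G.isInf_spec v hv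
    have hi : G.IsInf (G.vert (G.flip (G.flip h))) := by rwa [G.flip_flip, (hh h).2 rfl]
    have := P.not_mem_bounded_of_isInf hi
    rw [G.flip_flip] at this
    have e : P.loop L h = 0 := by
      rw [loop, if_neg fun (e : P.form h = L) => this.2 (by rwa [e]),
        if_neg fun (e : P.form (G.flip h) = L) => this.1 (by rwa [e]), sub_self]
    simp [hh, e]
  · rcases P.star_left v hv with ⟨k, k', hne, hk, -, -, hW⟩ |
      ⟨k₁, k₂, k₃, h₁₂, h₂₃, h₁₃, hk, -, -, hW⟩
    · obtain ⟨e1, e2⟩ := hW _ _ P.isFlow_affFlow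
      have e1' : P.form k = P.form (G.flip k') := e1
      have e2' : P.form k' = P.form (G.flip k) := e2
      rw [sum_vert_two hne hk, loop, loop, e1', e2']
      ring
    · obtain ⟨⟨e1, e2, e3⟩, -⟩ := hW _ _ P.isFlow_affFlow
      have e1' : P.form k₁ = P.form (G.flip k₂) := e1
      have e2' : P.form k₂ = P.form (G.flip k₃) := e2
      have e3' : P.form k₃ = P.form (G.flip k₁) := e3
      rw [sum_vert_three h₁₂ h₂₃ h₁₃ hk, loop, loop, loop, e1', e2', e3']
      ring

theorem isFlow_of_mem_cycles {ω : G.H → ℤ} (hω : ω ∈ G.cycles) : IsFlow G ω :=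
  ⟨hω.1, fun v _ => hω.2 v⟩

/-- Beyond the levels of all vertices, a sweeping line crosses only infinite edges, on which a cycle
vanishes. -/
theorem sweep_eq_zero_of_lev {ω : G.H → ℤ} (hω : ω ∈ G.cycles) {x : Plane}
    (hx : ∑ v, |lev (P.pos v)| < |lev x|) : P.sweep ω x = 0 := by
  classical
  refine Finset.sum_eq_zero fun h _ => ?_
  split_ifs with hb
  swap
  · rfl
  by_contra h0
  have hl : G.len h ≠ ⊤ := fun e => h0 (eq_zero_of_len_eq_top hω e)
  have h1 := hb.2.1 (not_isInf_of_len_ne_top hl)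
  have h2 := hb.2.2.1 (not_isInf_of_len_ne_top (by rwa [G.len_flip]))
  have b : ∀ v, |lev (P.pos v)| ≤ ∑ v, |lev (P.pos v)| := fun v =>
    Finset.single_le_sum (f := fun v => |lev (P.pos v)|) (fun _ _ => abs_nonneg _)
      (Finset.mem_univ v)
  have b1 := abs_le.1 (b (G.vert h))
  have b2 := abs_le.1 (b (G.vert (G.flip h)))
  have : |lev x| ≤ ∑ v, |lev (P.pos v)| := abs_le.2 ⟨by linarith, by linarith⟩
  linarith

/-- Failure of boundedness gives a recession direction v. If v lies in a sweeping line, its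
irrational slope makes the finitely many inequalities for forms other than `L` strict, so v may be
perturbed. -/
theorem exists_recession {L : Aff} (hL : L ∈ P.forms) (hb : L ∉ P.bounded) :
    ∃ v : Plane, lev v ≠ 0 ∧ ∀ L' ∈ P.forms, dot (L'.1 - L.1) v ≤ 0 := by
  have : ∃ v : Plane, v ≠ 0 ∧ ∀ L' ∈ P.forms, dot (L'.1 - L.1) v ≤ 0 := by
    by_contra! h
    exact hb ⟨hL, h⟩
  obtain ⟨v, hv, hd⟩ := this
  by_cases h0 : lev v = 0
  swap
  · exact ⟨v, h0, hd⟩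
  have hs : ∀ᶠ t in 𝓝[>] (0 : ℝ), ∀ L' ∈ P.forms, dot (L'.1 - L.1) (v + t • ![1, 0]) ≤ 0 := by
    refine (eventually_all_finite P.finite_forms).2 fun L' hL' => ?_
    by_cases he : L' = L
    · subst he; simp [dot]
    have hm : L'.1 - L.1 ≠ 0 := fun e => he (P.eq_of_slope_eq hL' hL (sub_eq_zero.1 e))
    set m := L'.1 - L.1
    have hlt : dot m v < 0 := by
      refine lt_of_le_of_ne (hd L' hL') fun e => ?_
      have hm' : (![m 1, - m 0] : Fin 2 → ℤ) ≠ 0 := by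
        intro e
        apply hm
        have e0 := congrFun e 0
        have e1 := congrFun e 1
        simp at e0 e1
        funext i
        fin_cases i <;> simp [e0, e1]
      have h1 := lev_toPlane_ne_zero hm'
      have hv0 : v 0 = - √2 * v 1 := by rw [lev] at h0; linarith
      have hv1 : v 1 ≠ 0 := by
        intro e
        apply hv
        rw [e, mul_zero] at hv0
        funext i
        fin_cases i <;> simp [e, hv0]
      apply h1
      rw [dot, hv0] at e
      have e2 : v 1 * (m 1 - √2 * m 0) = 0 := by linear_combination e
      have := (mul_eq_zero.1 e2).resolve_left hv1
      simp [lev]; linarith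
    have hc : Continuous fun t : ℝ => dot m (v + t • ![1, 0]) := by
      simp only [dot_add, dot_smul]; fun_prop
    have h2 := hc.tendsto 0
    rw [zero_smul, add_zero] at h2
    exact ((h2.mono_left nhdsWithin_le_nhds).eventually_lt_const hlt).mono fun _ => le_of_lt
  obtain ⟨t, ht, ht0⟩ := (hs.and self_mem_nhdsWithin).exists
  have ht' : (0 : ℝ) < t := ht0
  refine ⟨_, ?_, ht⟩
  rw [lev_add_smul, h0]
  simp [lev, ht'.ne']

/-- No form grows faster than `L` along `v`, so `L` stays the maximum. -/
theorem add_smul_mem_face {L : Aff} {v : Plane} (hv : ∀ L' ∈ P.forms, dot (L'.1 - L.1) v ≤ 0)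
    {x : Plane} (hx : x ∈ P.face L) {t : ℝ} (ht : 0 ≤ t) : x + t • v ∈ P.face L := by
  have hL := P.mem_forms_of_mem_face hx
  rw [P.mem_face_iff] at hx ⊢
  have hc : Tendsto (fun w : Plane => w - t • v) (𝓝 (x + t • v)) (𝓝 x) := by
    have : Continuous fun w : Plane => w - t • v := by fun_prop
    have := this.tendsto (x + t • v)
    rwa [add_sub_cancel_right] at this
  filter_upwards [hc.eventually hx] with w hw
  refine le_antisymm ?_ (P.eval_le_height hL w)
  obtain ⟨L', hL', e⟩ := P.exists_height_eq w
  have h1 := P.eval_le_height hL' (w - t • v)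
  have e2 : w = (w - t • v) + t • v := by abel
  rw [e, e2, Aff.eval_add_smul, Aff.eval_add_smul, ← hw]
  have := hv L' hL'
  rw [dot_sub_left] at this
  have := mul_le_mul_of_nonneg_left (sub_nonpos.1 this) ht
  linarith

/-- The potential is constant on the region, and moving in a recession direction leads past the
levels of all vertices. -/
theorem sweep_eq_zero_of_face {ω : G.H → ℤ} (hω : ω ∈ G.cycles) {L : Aff} (hL : L ∉ P.bounded)
    {x : Plane} (hx : x ∈ P.face L) : P.sweep ω x = 0 := by
  obtain ⟨v, hv, hd⟩ := P.exists_recession (P.mem_forms_of_mem_face hx) hL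
  set R := ∑ v, |lev (P.pos v)|
  have hR : 0 ≤ R := Finset.sum_nonneg fun _ _ => abs_nonneg _
  set t := (R + |lev x| + 1) / |lev v| with ht
  have ht0 : 0 ≤ t := by positivity
  have h1 := P.add_smul_mem_face hd hx ht0
  rw [P.sweep_eq_of_face (isFlow_of_mem_cycles hω) hx h1]
  refine P.sweep_eq_zero_of_lev hω ?_
  rw [lev_add_smul]
  have e : |t * lev v| = R + |lev x| + 1 := by
    rw [abs_mul, abs_of_nonneg ht0, ht]
    have : |lev v| ≠ 0 := abs_ne_zero.2 hv
    field_simp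
  have := abs_sub_abs_le_abs_sub (t * lev v) (-lev x)
  rw [abs_neg, e, sub_neg_eq_add, add_comm (t * lev v)] at this
  linarith

theorem finite_bounded : P.bounded.Finite := P.finite_forms.subset fun _ h => h.1

/-- A form of maximal slope in the direction e₁ cannot be surpassed in that direction. -/
theorem exists_not_mem_bounded : ∃ L ∈ P.forms, L ∉ P.bounded := by
  obtain ⟨L, hL, hmax⟩ := Set.exists_max_image P.forms (fun L => dot L.1 ![1, 0]) P.finite_forms
    P.forms_nonempty
  refine ⟨L, hL, fun hb => ?_⟩
  obtain ⟨L', hL', hlt⟩ := hb.2 ![1, 0] (by intro h; simpa using congrFun h 0)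
  have := hmax L' hL'
  rw [dot_sub_left] at hlt
  linarith

theorem sum_loop {I : Finset Aff} {X : Aff → ℤ} (hX : ∀ L ∉ I, X L = 0) (h : G.H) :
    ∑ L ∈ I, X L * P.loop L h = X (P.form h) - X (P.form (G.flip h)) := by
  classical
  have key : ∀ k, ∑ L ∈ I, X L * (if P.form k = L then 1 else 0) = X (P.form k) := by
    intro k
    simp only [mul_ite, mul_one, mul_zero, Finset.sum_ite_eq]
    split_ifs with hk
    · rfl
    · exact (hX _ hk).symm
  simp only [loop, mul_sub, Finset.sum_sub_distrib, key]

/-- Every cycle is a combination of the boundary cycles of the bounded regions. -/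
theorem exists_eq_sum_loop {I : Finset Aff} (hI : (I : Set Aff) = P.bounded) {ω : G.H → ℤ}
    (hω : ω ∈ G.cycles) : ∃ X : Aff → ℤ, ∀ h, ω h = ∑ L ∈ I, X L * P.loop L h := by
  classical
  have hf := isFlow_of_mem_cycles hω
  -- The coefficient of a region is the constant value there of the potential of the cycle; it
  -- vanishes on unbounded regions.
  set X : Aff → ℤ := fun L => if hx : (P.face L).Nonempty then P.sweep ω hx.some else 0 with hXdef
  have h0 : ∀ L ∉ I, X L = 0 := by
    intro L hL
    simp only [hXdef]
    split_ifs with hx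
    · exact P.sweep_eq_zero_of_face hω (fun h => hL (by rwa [← hI] at h)) hx.some_mem
    · rfl
  have h1 : ∀ h, P.left ω h = X (P.form h) := by
    intro h
    simp only [hXdef]
    rw [dif_pos (P.face_form_nonempty h)]
    exact P.left_eq_sweep hf (P.face_form_nonempty h).some_mem
  refine ⟨X, fun h => ?_⟩
  rw [P.sum_loop h0, ← h1, ← h1, P.left_sub_left_flip hf]

/-- If the combination vanishes, then `X` agrees across every edge and is constant on the regions;
on an unbounded region it is zero. -/
theorem eq_zero_of_sum_loop {I : Finset Aff} (hI : (I : Set Aff) = P.bounded) {X : Aff → ℤ}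
    (hX : ∀ L ∉ I, X L = 0) (h : ∀ h, ∑ L ∈ I, X L * P.loop L h = 0) : X = 0 := by
  obtain ⟨L₀, hL₀, hb⟩ := P.exists_not_mem_bounded
  funext L
  by_cases hL : L ∈ I
  swap
  · exact hX L hL
  have hL' : L ∈ P.bounded := by rw [← hI]; exact hL
  rw [P.eq_of_forall_flip X (fun k => sub_eq_zero.1 (by rw [← P.sum_loop hX, h])) hL'.1 hL₀]
  exact hX _ fun h => hb (by rw [← hI]; exact h)

/-- The boundary cycles of the bounded regions form a basis of the group of cycles, so their number
is its rank. -/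
theorem card_bounded {n : ℕ} (e : (Fin n → ℤ) ≃+ G.cycles) {I : Finset Aff}
    (hI : (I : Set Aff) = P.bounded) : I.card = n := by
  classical
  let b : I → G.cycles := fun L => ⟨P.loop L, P.loop_mem_cycles (by rw [← hI]; exact L.2)⟩
  let Φ : (I → ℤ) →+ G.cycles :=
    { toFun := fun x => ∑ L : I, x L • b L
      map_zero' := by simp
      map_add' := fun x y => by simp [add_smul, Finset.sum_add_distrib] }
  have hΦ : ∀ (X : Aff → ℤ) (h : G.H),
      (Φ fun L => X L : G.H → ℤ) h = ∑ L ∈ I, X L * P.loop L h := by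
    intro X h
    simp only [Φ, b, AddMonoidHom.coe_mk, ZeroHom.coe_mk]
    rw [← Finset.sum_coe_sort I]
    simp [Finset.sum_apply]
  have hinj : Function.Injective Φ := by
    rw [injective_iff_map_eq_zero]
    intro x hx
    let X : Aff → ℤ := fun L => if h : L ∈ I then x ⟨L, h⟩ else 0
    have hX : x = fun L : I => X L := by funext L; simp [X]
    have := P.eq_zero_of_sum_loop hI (X := X) (fun L hL => by simp [X, hL]) fun h => by
      rw [← hΦ, ← hX, hx]; rfl
    rw [hX, this]; rfl
  have hsurj : Function.Surjective Φ := by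
    rintro ⟨ω, hω⟩
    obtain ⟨X, hX⟩ := P.exists_eq_sum_loop hI hω
    exact ⟨fun L => X L, Subtype.ext (funext fun h => by rw [hΦ]; exact (hX h).symm)⟩
  have E := (AddEquiv.ofBijective Φ ⟨hinj, hsurj⟩).trans e.symm
  have := E.toIntLinearEquiv.finrank_eq
  simpa using this

end PlaneGraph

/-! ### Lattice points of the Newton polygon and dual covectors -/

theorem idot_sub_left (m n u : Fin 2 → ℤ) : idot (m - n) u = idot m u - idot n u := by
  simp [idot]; ring

theorem dot_neg_toPlane (u : Fin 2 → ℤ) (m : Fin 2 → ℤ) : dot m (-toPlane u) = -(idot m u : ℝ) := by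
  simp [dot, idot]; ring

theorem eq_of_idot_eq {d e m n : Fin 2 → ℤ} (h : det₂ d e = 1) (hd : idot m d = idot n d)
    (he : idot m e = idot n e) : m = n := by
  rw [det₂_eq] at h
  simp only [idot] at hd he
  funext i
  fin_cases i
  · show m 0 = n 0
    linear_combination e 1 * hd - d 1 * he - (m 0 - n 0) * h
  · show m 1 = n 1
    linear_combination d 0 * he - e 0 * hd - (m 1 - n 1) * h

theorem det₂_self (d : Fin 2 → ℤ) : det₂ d d = 0 := by rw [det₂_eq]; ring

theorem det₂_swap (d e : Fin 2 → ℤ) : det₂ e d = - det₂ d e := by rw [det₂_eq, det₂_eq]; ring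

namespace PlaneGraph

variable {G : AbstractTropicalCurve} (P : PlaneGraph G)

/-- The slope of a supporting affine form is the slope of a region. -/
theorem exists_slope_of_min {n : Fin 2 → ℤ} {z : Plane}
    (hmin : ∀ x, P.height z - dot n z ≤ P.height x - dot n x) : ∃ L ∈ P.forms, L.1 = n := by
  -- Minimality puts n into the convex hull of the slopes at `z`: in every direction, one of these
  -- slopes is at least n.
  have key : ∀ p : Aff → Prop, (∀ L, p L → Aff.eval z L = P.height z) →
      (∀ᶠ x in 𝓝 z, ∃ L, p L ∧ P.height x = Aff.eval x L) →
      ∀ y, ∃ L, p L ∧ 0 ≤ dot (L.1 - n) y := by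
    intro p hz hx y
    obtain ⟨t, ⟨L, hL, e⟩, ht⟩ :=
      (((tendsto_add_smul z y).eventually hx).and self_mem_nhdsWithin).exists
    have ht' : (0 : ℝ) < t := ht
    refine ⟨L, hL, ?_⟩
    have h1 := hmin (z + t • y)
    rw [e, Aff.eval_add_smul, hz L hL, dot_add, dot_smul] at h1
    rw [dot_sub_left]
    refine le_of_mul_le_mul_left ?_ ht'
    linarith
  have keyZ : ∀ p : Aff → Prop, (∀ L, p L → Aff.eval z L = P.height z) →
      (∀ᶠ x in 𝓝 z, ∃ L, p L ∧ P.height x = Aff.eval x L) →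
      ∀ u, (∃ L, p L ∧ idot n u ≤ idot L.1 u) ∧ ∃ L, p L ∧ idot L.1 u ≤ idot n u := by
    intro p hz hx u
    obtain ⟨L, hL, h⟩ := key p hz hx (toPlane u)
    obtain ⟨L', hL', h'⟩ := key p hz hx (-toPlane u)
    rw [dot_toPlane, idot_sub_left] at h
    rw [dot_neg_toPlane, idot_sub_left] at h'
    refine ⟨⟨L, hL, ?_⟩, L', hL', ?_⟩
    · have : (0 : ℤ) ≤ idot L.1 u - idot n u := by exact_mod_cast h
      linarith
    · have : (0 : ℤ) ≤ -(idot L'.1 u - idot n u) := by exact_mod_cast h'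
      linarith
  have hform : ∀ k, (P.form k).1 = (P.form (G.flip k)).1 + rot (P.dir k) := fun k => by
    rw [← P.form_sub]; abel
  have idot_add : ∀ a b u : Fin 2 → ℤ, idot (a + b) u = idot a u + idot b u := by
    intro a b u; simp [idot]; ring
  rcases P.local_left z with hz | ⟨k, hk, hW⟩ | ⟨k₁, k₂, k₃, hk₁, hk₂, hk₃, hdet, hd, hW⟩
  · obtain ⟨c, hc⟩ := P.eventually_sweep_const P.isFlow_affFlow hz
    have hc' : ∀ᶠ x in 𝓝 z, P.height x = Aff.eval x c := hc.mono fun x hx => by rw [height, hx]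
    have h := keyZ (fun L => L = c) (fun L hL => by rw [hL, hc'.self_of_nhds])
      (hc'.mono fun x hx => ⟨c, rfl, hx⟩)
    refine ⟨c, ⟨z, hc.self_of_nhds⟩, ?_⟩
    refine eq_of_idot_eq (d := ![1, 0]) (e := ![0, 1]) (by simp [det₂_eq]) ?_ ?_
    · obtain ⟨⟨_, rfl, h1⟩, _, rfl, h2⟩ := h ![1, 0]
      exact le_antisymm h2 h1
    · obtain ⟨⟨_, rfl, h1⟩, _, rfl, h2⟩ := h ![0, 1]
      exact le_antisymm h2 h1
  · have hev := P.eval_form k z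
    rw [hk, add_zero] at hev
    have hx : ∀ᶠ x in 𝓝 z, ∃ L, (L = P.form (G.flip k) ∨ L = P.form k) ∧
        P.height x = Aff.eval x L := by
      filter_upwards [hW _ _ P.isFlow_affFlow] with x hx
      rcases hx with hx | hx
      · exact ⟨_, Or.inl rfl, by rw [height, hx.1]; rfl⟩
      · exact ⟨_, Or.inr rfl, by rw [height, hx.1]; rfl⟩
    have hz : ∀ L, (L = P.form (G.flip k) ∨ L = P.form k) → Aff.eval z L = P.height z := by
      obtain ⟨L, hL, e⟩ := hx.self_of_nhds
      rw [e]
      rcases hL with rfl | rfl <;> rintro _ (rfl | rfl) <;> simp [hev]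
    have h := keyZ _ hz hx
    obtain ⟨w, hw⟩ := (P.dir_primitive k).exists_det
    have e1 : idot (P.form k).1 (P.dir k) = idot (P.form (G.flip k)).1 (P.dir k) := by
      rw [hform, idot_add, idot_rot, det₂_self, add_zero]
    have e2 : idot (P.form k).1 w = idot (P.form (G.flip k)).1 w + 1 := by
      rw [hform, idot_add, idot_rot, hw]
    have hn : idot n (P.dir k) = idot (P.form (G.flip k)).1 (P.dir k) := by
      obtain ⟨⟨L, hL, h1⟩, L', hL', h2⟩ := h (P.dir k)
      have : idot L.1 (P.dir k) = idot (P.form (G.flip k)).1 (P.dir k) := by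
        rcases hL with rfl | rfl
        · rfl
        · exact e1
      have : idot L'.1 (P.dir k) = idot (P.form (G.flip k)).1 (P.dir k) := by
        rcases hL' with rfl | rfl
        · rfl
        · exact e1
      omega
    -- The two slopes differ by 1 on `w`, so the segment between them has no further lattice point.
    have hw' : idot n w = idot (P.form (G.flip k)).1 w ∨ idot n w = idot (P.form k).1 w := by
      obtain ⟨⟨L, hL, h1⟩, L', hL', h2⟩ := h w
      have a1 : idot L.1 w ≤ idot (P.form (G.flip k)).1 w + 1 := by
        rcases hL with rfl | rfl <;> omega
      have a2 : idot (P.form (G.flip k)).1 w ≤ idot L'.1 w := by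
        rcases hL' with rfl | rfl <;> omega
      omega
    rcases hw' with e | e
    · exact ⟨_, P.form_mem_forms _, (eq_of_idot_eq hw hn e).symm⟩
    · exact ⟨_, P.form_mem_forms _, (eq_of_idot_eq hw (hn.trans e1.symm) e).symm⟩
  · obtain ⟨⟨l1, l2, l3⟩, hW⟩ := hW _ _ P.isFlow_affFlow
    have l1' : P.form k₁ = P.form (G.flip k₂) := l1
    have l3' : P.form k₃ = P.form (G.flip k₁) := l3
    have hev1 := P.eval_form k₁ z
    have hev2 := P.eval_form k₂ z
    rw [hk₁, add_zero, ← l3'] at hev1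
    rw [hk₂, add_zero, ← l1'] at hev2
    have hx : ∀ᶠ x in 𝓝 z, ∃ L, (L = P.form k₁ ∨ L = P.form k₂ ∨ L = P.form k₃) ∧
        P.height x = Aff.eval x L := by
      filter_upwards [hW] with x hx
      rcases hx with hx | hx | hx
      · exact ⟨_, Or.inl rfl, by rw [height, hx.1]; rfl⟩
      · exact ⟨_, Or.inr (Or.inl rfl), by rw [height, hx.1]; rfl⟩
      · exact ⟨_, Or.inr (Or.inr rfl), by rw [height, hx.1]; rfl⟩
    have hz : ∀ L, (L = P.form k₁ ∨ L = P.form k₂ ∨ L = P.form k₃) →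
        Aff.eval z L = P.height z := by
      obtain ⟨L, hL, e⟩ := hx.self_of_nhds
      rw [e]
      rcases hL with rfl | rfl | rfl <;> rintro _ (rfl | rfl | rfl) <;> simp [hev1, hev2]
    have h := keyZ _ hz hx
    have s2 := hform k₂
    have s1 := hform k₁
    rw [← l1'] at s2
    rw [← l3'] at s1
    have a1 : idot (P.form k₂).1 (P.dir k₁) = idot (P.form k₁).1 (P.dir k₁) - 1 := by
      rw [s2, idot_add, idot_rot, det₂_swap, hdet]; ring
    have a2 : idot (P.form k₂).1 (P.dir k₂) = idot (P.form k₁).1 (P.dir k₂) := by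
      rw [s2, idot_add, idot_rot, det₂_self]; ring
    have b1 : idot (P.form k₁).1 (P.dir k₁) = idot (P.form k₃).1 (P.dir k₁) := by
      rw [s1, idot_add, idot_rot, det₂_self]; ring
    have b2 : idot (P.form k₁).1 (P.dir k₂) = idot (P.form k₃).1 (P.dir k₂) + 1 := by
      rw [s1, idot_add, idot_rot, hdet]
    have u1 : idot n (P.dir k₁) ≤ idot (P.form k₁).1 (P.dir k₁) := by
      obtain ⟨⟨L, hL, h1⟩, -⟩ := h (P.dir k₁)
      rcases hL with rfl | rfl | rfl <;> omega
    have u2 : idot n (P.dir k₂) ≤ idot (P.form k₁).1 (P.dir k₂) := by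
      obtain ⟨⟨L, hL, h1⟩, -⟩ := h (P.dir k₂)
      rcases hL with rfl | rfl | rfl <;> omega
    have u3 : idot (P.form k₁).1 (P.dir k₁) + idot (P.form k₁).1 (P.dir k₂) - 1 ≤
        idot n (P.dir k₁) + idot n (P.dir k₂) := by
      have e : ∀ m, idot m (P.dir k₁ + P.dir k₂) = idot m (P.dir k₁) + idot m (P.dir k₂) := by
        intro m; simp [idot]; ring
      obtain ⟨-, L, hL, h1⟩ := h (P.dir k₁ + P.dir k₂)
      rw [e, e] at h1
      rcases hL with rfl | rfl | rfl <;> omega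
    -- Paired with `dir k₁` and `dir k₂`, the three slopes have coordinates (α, β), (α - 1, β), (α,
    -- β - 1). The bounds `u1`, `u2`, `u3` cut out this unimodular triangle, whose only lattice
    -- points are its corners.
    have : (idot n (P.dir k₁) = idot (P.form k₁).1 (P.dir k₁) ∧
        idot n (P.dir k₂) = idot (P.form k₁).1 (P.dir k₂)) ∨
      (idot n (P.dir k₁) = idot (P.form k₂).1 (P.dir k₁) ∧
        idot n (P.dir k₂) = idot (P.form k₂).1 (P.dir k₂)) ∨
      (idot n (P.dir k₁) = idot (P.form k₃).1 (P.dir k₁) ∧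
        idot n (P.dir k₂) = idot (P.form k₃).1 (P.dir k₂)) := by omega
    rcases this with e | e | e <;>
      exact ⟨_, P.form_mem_forms _, (eq_of_idot_eq hdet e.1 e.2).symm⟩

/-- An affine form which grows slower than the height in all directions has the slope of a
region. -/
theorem exists_slope {n : Fin 2 → ℤ}
    (hn : ∀ v : Plane, v ≠ 0 → ∃ L ∈ P.forms, 0 < dot (L.1 - n) v) : ∃ L ∈ P.forms, L.1 = n := by
  classical
  set S := P.finite_forms.toFinset with hS
  -- φ is homogeneous and positive off the origin, hence bounds the norm. It is bounded where the
  -- height minus n is at most its value at the origin, so that difference attains a minimum, and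
  -- `exists_slope_of_min` applies.
  set φ : Plane → ℝ := fun x => ∑ L ∈ S, max 0 (dot (L.1 - n) x) with hφ
  have hdot : ∀ m, Continuous (dot m) := fun m => by unfold dot; fun_prop
  have hcφ : Continuous φ := continuous_finsetSum _ fun L _ => continuous_const.max (hdot _)
  have hpos : ∀ v, v ≠ 0 → 0 < φ v := by
    intro v hv
    obtain ⟨L, hL, h⟩ := hn v hv
    exact Finset.sum_pos' (fun _ _ => le_max_left _ _)
      ⟨L, by rwa [hS, Set.Finite.mem_toFinset], lt_max_of_lt_right h⟩
  have hhom : ∀ (t : ℝ) x, 0 ≤ t → φ (t • x) = t * φ x := by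
    intro t x ht
    simp only [hφ, Finset.mul_sum]
    refine Finset.sum_congr rfl fun L _ => ?_
    rw [dot_smul, mul_max_of_nonneg _ _ ht, mul_zero]
  obtain ⟨e, he, hmin⟩ := (isCompact_sphere (0 : Plane) 1).exists_isMinOn
    (NormedSpace.sphere_nonempty.2 zero_le_one) hcφ.continuousOn
  have hε : 0 < φ e := hpos e (by
    rintro rfl
    simp at he)
  have hlow : ∀ x, φ e * ‖x‖ ≤ φ x := by
    intro x
    by_cases hx : x = 0
    · subst hx; simp [hφ, dot]
    have hx' : ‖x‖ ≠ 0 := norm_ne_zero_iff.2 hx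
    have h1 : φ e ≤ φ (‖x‖⁻¹ • x) := hmin (by simp [norm_smul, hx'])
    rw [hhom _ _ (by positivity)] at h1
    calc φ e * ‖x‖ ≤ ‖x‖⁻¹ * φ x * ‖x‖ := by gcongr
      _ = φ x := by field_simp
  set f : Plane → ℝ := fun x => P.height x - dot n x with hf
  have hcf : Continuous f := P.continuous_height.sub (hdot n)
  set C := ∑ L ∈ S, (|f 0| + |L.2|) with hC
  have hup : ∀ x, f x ≤ f 0 → φ x ≤ C := by
    intro x hx
    refine Finset.sum_le_sum fun L hL => max_le (by positivity) ?_
    have h1 := P.eval_le_height ((Set.Finite.mem_toFinset _).1 hL) x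
    rw [Aff.eval_apply] at h1
    rw [dot_sub_left]
    simp only [hf] at hx
    have := le_abs_self (P.height 0 - dot n 0)
    have := neg_abs_le L.2
    simp only [hf]
    linarith
  have hev : ∀ᶠ x in cocompact Plane, f 0 ≤ f x := by
    filter_upwards [(tendsto_norm_cocompact_atTop (E := Plane)).eventually_gt_atTop (C / φ e)]
      with x hx
    by_contra! hlt
    have h1 := (hlow x).trans (hup x hlt.le)
    rw [div_lt_iff₀ hε] at hx
    linarith
  obtain ⟨z, hz⟩ := hcf.exists_forall_le' 0 hev
  exact P.exists_slope_of_min hz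

/-- If there are exactly two bounded regions, then some covector is at most one on all slopes,
where the slope of the first region is zero, and is one on the direction from the second to the
first. -/
theorem exists_dual {L₁ L₂ : Aff} (hb : P.bounded = {L₁, L₂}) (hne : L₁ ≠ L₂) :
    ∃ v : Plane, dot (L₁.1 - L₂.1) v = 1 ∧ ∀ L ∈ P.forms, dot (L.1 - L₁.1) v ≤ 1 := by
  have h1 : L₁ ∈ P.bounded := by rw [hb]; simp
  have h2 : L₂ ∈ P.bounded := by rw [hb]; simp
  have hs : L₁.1 ≠ L₂.1 := fun e => hne (P.eq_of_slope_eq h1.1 h2.1 e)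
  -- The reflection 2n₁ - n₂ of the second slope in the first. In the interior of the Newton polygon
  -- it would be the slope of a third bounded region; otherwise a half-plane bounded by a line
  -- through it contains all slopes.
  set n : Fin 2 → ℤ := L₁.1 + L₁.1 - L₂.1 with hn
  by_cases hc : ∀ v : Plane, v ≠ 0 → ∃ L ∈ P.forms, 0 < dot (L.1 - n) v
  · exfalso
    obtain ⟨L, hL, e⟩ := P.exists_slope hc
    have : L ∈ P.bounded := ⟨hL, by rw [e]; exact hc⟩
    rw [hb] at this
    rcases this with rfl | rfl
    · apply hs
      rw [hn] at e
      funext i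
      have := congrFun e i
      simp at this; omega
    · apply hs
      rw [hn] at e
      funext i
      have := congrFun e i
      simp at this; omega
  · push Not at hc
    obtain ⟨v, hv, hd⟩ := hc
    have hnv : ∀ L : Aff, dot (L.1 - n) v = dot (L.1 - L₁.1) v - dot (L₁.1 - L₂.1) v := by
      intro L; simp [hn, dot]; ring
    set s := dot (L₁.1 - L₂.1) v with hsdef
    have hs0 : 0 ≤ s := by
      have := hd _ h1.1
      rw [hnv] at this
      simp [dot] at this
      exact this
    have hs1 : 0 < s := by
      refine lt_of_le_of_ne hs0 fun e => ?_
      obtain ⟨L, hL, hlt⟩ := h1.2 v hv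
      have := hd L hL
      rw [hnv, ← e] at this
      linarith
    refine ⟨s⁻¹ • v, ?_, fun L hL => ?_⟩
    · rw [dot_smul, ← hsdef]; field_simp
    · rw [dot_smul, ← div_eq_inv_mul, div_le_one hs1]
      have := hd L hL
      rw [hnv] at this
      linarith

/-! ### Perimeters, common boundaries and energies -/

theorem sum_flip {M : Type} [AddCommMonoid M] (f : G.H → M) : ∑ h, f (G.flip h) = ∑ h, f h :=
  Equiv.sum_comp (Function.Involutive.toPerm G.flip G.flip_flip) f

/-- A cycle is a closed curve. -/
theorem sum_len_mul_dir {ω : G.H → ℤ} (hω : ω ∈ G.cycles) (v : Plane) :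
    ∑ h, (G.len h).toReal * ω h * dot (rot (P.dir h)) v = 0 := by
  classical
  -- Length times direction is the difference of the end points. Regrouped by vertices, the sum
  -- vanishes by balance.
  have e : ∀ h, (G.len h).toReal * ω h * dot (rot (P.dir h)) v =
      -((ω (G.flip h) : ℝ) * (P.pos (G.vert (G.flip h)) 0 * v 1 - P.pos (G.vert (G.flip h)) 1 * v 0))
      - ω h * (P.pos (G.vert h) 0 * v 1 - P.pos (G.vert h) 1 * v 0) := by
    intro h
    by_cases hl : G.len h = ⊤
    · rw [hω.1, eq_zero_of_len_eq_top hω hl]; simp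
    · rw [P.pos_flip h hl, hω.1]
      simp [dot, rot]; ring
  have hz : ∑ h, (ω h : ℝ) * (P.pos (G.vert h) 0 * v 1 - P.pos (G.vert h) 1 * v 0) = 0 := by
    have : ∀ h, (ω h : ℝ) * (P.pos (G.vert h) 0 * v 1 - P.pos (G.vert h) 1 * v 0) =
        ∑ w, ((if G.vert h = w then ω h else 0 : ℤ) : ℝ) * (P.pos w 0 * v 1 - P.pos w 1 * v 0) := by
      intro h; simp
    simp only [this]
    rw [Finset.sum_comm]
    refine Finset.sum_eq_zero fun w _ => ?_
    rw [← Finset.sum_mul, ← Int.cast_sum, hω.2 w]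
    simp
  simp only [e, Finset.sum_sub_distrib, Finset.sum_neg_distrib]
  rw [sum_flip fun h => (ω h : ℝ) * (P.pos (G.vert h) 0 * v 1 - P.pos (G.vert h) 1 * v 0), hz]
  simp

open Classical in
/-- The length of the boundary of a region. -/
noncomputable def perimeter (L : Aff) : ℝ := ∑ h, if P.form h = L then (G.len h).toReal else 0

open Classical in
/-- The length of the common boundary of two regions. -/
noncomputable def shared (L L' : Aff) : ℝ :=
  ∑ h, if P.form h = L ∧ P.form (G.flip h) = L' then (G.len h).toReal else 0

theorem shared_nonneg (L L' : Aff) : 0 ≤ P.shared L L' := by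
  classical
  exact Finset.sum_nonneg fun h _ => by split_ifs <;> positivity

theorem shared_comm (L L' : Aff) : P.shared L L' = P.shared L' L := by
  classical
  rw [shared, ← sum_flip]
  refine Finset.sum_congr rfl fun h _ => ?_
  rw [G.flip_flip, G.len_flip]
  exact if_congr and_comm rfl rfl

open Classical in
/-- The boundary of a bounded region is closed. -/
theorem sum_boundary {L : Aff} (hL : L ∈ P.bounded) (v : Plane) :
    ∑ h, (if P.form h = L then (G.len h).toReal * dot ((P.form (G.flip h)).1 - L.1) v else 0)
      = 0 := by
  have h1 := P.sum_len_mul_dir (P.loop_mem_cycles hL) v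
  have e : ∀ h, (G.len h).toReal * P.loop L h * dot (rot (P.dir h)) v =
      -(if P.form h = L then (G.len h).toReal * dot ((P.form (G.flip h)).1 - L.1) v else 0) +
      -(if P.form (G.flip h) = L then (G.len (G.flip h)).toReal *
        dot ((P.form (G.flip (G.flip h))).1 - L.1) v else 0) := by
    intro h
    rw [← P.form_sub, loop, G.flip_flip, G.len_flip]
    split_ifs with a b b
    · exact absurd (a.trans b.symm) (P.form_ne h)
    · rw [a]; simp [dot_sub_left]; ring
    · rw [b]; simp [dot_sub_left]
    · simp
  simp only [e, Finset.sum_add_distrib, Finset.sum_neg_distrib] at h1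
  rw [sum_flip fun h => if P.form h = L then
    (G.len h).toReal * dot ((P.form (G.flip h)).1 - L.1) v else 0] at h1
  linarith

/-- The common boundary is at most half of the boundary, and if it is exactly half, then the dual
covector is one on the slopes of all other adjacent regions. -/
theorem two_mul_shared_le {L L' : Aff} (hL : L ∈ P.bounded) {v : Plane}
    (hv : dot (L.1 - L'.1) v = 1) (hv' : ∀ K ∈ P.forms, dot (K.1 - L.1) v ≤ 1) :
    2 * P.shared L L' ≤ P.perimeter L ∧ (2 * P.shared L L' = P.perimeter L →
      ∀ h, P.form h = L → P.form (G.flip h) ≠ L' → dot ((P.form (G.flip h)).1 - L.1) v = 1) := by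
  classical
  have hv2 : dot (L'.1 - L.1) v = -1 := by
    rw [dot_sub_left] at hv ⊢; linarith
  -- The slack of v ≤ 1 along the rest of the boundary. As v is -1 along the common boundary and the
  -- boundary is closed, the total slack is the perimeter minus twice the common length.
  set f : G.H → ℝ := fun h => if P.form h = L ∧ P.form (G.flip h) ≠ L' then
    (G.len h).toReal * (1 - dot ((P.form (G.flip h)).1 - L.1) v) else 0 with hf
  have hf0 : ∀ h ∈ Finset.univ, 0 ≤ f h := by
    intro h _
    simp only [hf]
    split_ifs
    · have := hv' _ (P.form_mem_forms (G.flip h))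
      exact mul_nonneg ENNReal.toReal_nonneg (by linarith)
    · exact le_rfl
  have hsum : ∑ h, f h = P.perimeter L - 2 * P.shared L L' := by
    have h1 := P.sum_boundary hL v
    have : ∀ h, f h = (if P.form h = L then (G.len h).toReal else 0) -
        2 * (if P.form h = L ∧ P.form (G.flip h) = L' then (G.len h).toReal else 0) -
        (if P.form h = L then (G.len h).toReal * dot ((P.form (G.flip h)).1 - L.1) v else 0) := by
      intro h
      simp only [hf]
      by_cases a : P.form h = L
      · by_cases b : P.form (G.flip h) = L'
        · simp [a, b, hv2]; ring
        · simp [a, b]; ring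
      · simp [a]
    simp only [this, Finset.sum_sub_distrib, ← Finset.mul_sum, h1, sub_zero]
    rfl
  refine ⟨by linarith [Finset.sum_nonneg hf0], fun he h h1 h2 => ?_⟩
  have h3 := (Finset.sum_eq_zero_iff_of_nonneg hf0).1 (by rw [hsum, he, sub_self]) h
    (Finset.mem_univ h)
  simp only [hf] at h3
  rw [if_pos ⟨h1, h2⟩] at h3
  have hl : (G.len h).toReal ≠ 0 := (ENNReal.toReal_pos (G.len_pos h).ne'
    (P.len_ne_top_of_mem_bounded (by rwa [h1]))).ne'
  have := (mul_eq_zero.1 h3).resolve_left hl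
  linarith

/-- By `form_ne` no edge has the same region on both sides, so the loop is ±1 on the boundary edges;
each has two half-edges. -/
theorem energy_loop (L : Aff) : G.energy (P.loop L) = 2 * P.perimeter L := by
  classical
  have e : ∀ h, (G.len h).toReal * (P.loop L h : ℝ) ^ 2 =
      (if P.form h = L then (G.len h).toReal else 0) +
      (if P.form (G.flip h) = L then (G.len (G.flip h)).toReal else 0) := by
    intro h
    rw [loop, G.len_flip]
    split_ifs with a b b
    · exact absurd (a.trans b.symm) (P.form_ne h)
    all_goals simp
  simp only [energy, e, Finset.sum_add_distrib]
  rw [sum_flip fun h => if P.form h = L then (G.len h).toReal else 0, perimeter]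
  ring

/-- The two loops run in opposite directions along the common boundary and cancel there. -/
theorem energy_loop_add {L L' : Aff} (hne : L ≠ L') : G.energy (P.loop L + P.loop L') =
    2 * P.perimeter L + 2 * P.perimeter L' - 4 * P.shared L L' := by
  classical
  have e : ∀ h, (G.len h).toReal * ((P.loop L + P.loop L') h : ℝ) ^ 2 =
      (G.len h).toReal * (P.loop L h : ℝ) ^ 2 + (G.len h).toReal * (P.loop L' h : ℝ) ^ 2 -
      2 * ((if P.form h = L ∧ P.form (G.flip h) = L' then (G.len h).toReal else 0) +
      (if P.form h = L' ∧ P.form (G.flip h) = L then (G.len h).toReal else 0)) := by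
    intro h
    have hn := P.form_ne h
    rw [Pi.add_apply]
    simp only [loop]
    generalize P.form h = A at *
    generalize P.form (G.flip h) = B at *
    by_cases a : A = L
    · subst a
      by_cases b : B = L'
      · subst b
        simp [hne, hne.symm]; ring
      · simp [hne, b, hn.symm]
    · by_cases a' : A = L'
      · subst a'
        by_cases b : B = L
        · subst b; simp [hn, hn.symm]; ring
        · simp [a, b, hn.symm]
      · simp [a, a']
        split_ifs <;> simp_all
  have h1 := P.energy_loop L
  have h2 := P.energy_loop L'
  simp only [energy] at h1 h2 ⊢
  simp only [e, Finset.sum_add_distrib, Finset.sum_sub_distrib, ← Finset.mul_sum, h1, h2]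
  have h3 := P.shared_comm L L'
  simp only [shared] at h3 ⊢
  rw [← h3]
  ring

end PlaneGraph

/-! ### The contradiction with the hexagonal lattice -/

theorem det₂_rot (d e : Fin 2 → ℤ) : det₂ (rot d) (rot e) = det₂ d e := by
  rw [det₂_eq, det₂_eq]; simp [rot]; ring

/-- Two vectors at the ends of a common boundary cannot satisfy the relations of a pair of dual
covectors. -/
theorem no_dual_pair {n₁ n₂ t t' : Fin 2 → ℤ} {v₁ v₂ : Plane}
    (h₁ : dot (n₁ - n₂) v₁ = 1) (h₂ : dot (n₂ - n₁) v₂ = 1)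
    (a₁ : dot (t - n₁) v₁ = 1) (a₂ : dot (t - n₂) v₂ = 1) (a : det₂ (n₁ - n₂) (t - n₁) = 1)
    (b₂ : dot (t' - n₂) v₂ = 1) (b₁ : dot (t' - n₁) v₁ = 1) (b : det₂ (n₂ - n₁) (t' - n₂) = 1) :
    False := by
  rw [det₂_eq] at a b
  have ha : ((n₁ 0 : ℝ) - n₂ 0) * (t 1 - n₁ 1) - (n₁ 1 - n₂ 1) * (t 0 - n₁ 0) = 1 := by
    exact_mod_cast (by simpa using (by linear_combination a :
      (n₁ - n₂) 0 * (t - n₁) 1 - (n₁ - n₂) 1 * (t - n₁) 0 = 1))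
  have hb : ((n₂ 0 : ℝ) - n₁ 0) * (t' 1 - n₂ 1) - (n₂ 1 - n₁ 1) * (t' 0 - n₂ 0) = 1 := by
    exact_mod_cast (by simpa using (by linear_combination b :
      (n₂ - n₁) 0 * (t' - n₂) 1 - (n₂ - n₁) 1 * (t' - n₂) 0 = 1))
  simp only [dot, Pi.sub_apply, Int.cast_sub] at h₁ h₂ a₁ a₂ b₁ b₂
  generalize (n₁ 0 : ℝ) = p0 at *
  generalize (n₁ 1 : ℝ) = p1 at *
  generalize (n₂ 0 : ℝ) = q0 at *
  generalize (n₂ 1 : ℝ) = q1 at *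
  generalize (t 0 : ℝ) = t0 at *
  generalize (t 1 : ℝ) = t1 at *
  generalize (t' 0 : ℝ) = s0 at *
  generalize (t' 1 : ℝ) = s1 at *
  -- The corners lie at opposite lattice distances from the line through n₁ and n₂, so t + t' - 2n₁
  -- is a multiple of n₁ - n₂; its value 2 on v₁ makes it 2(n₁ - n₂).
  have e : (p0 - q0) * (t1 + s1 - 2 * p1) - (p1 - q1) * (t0 + s0 - 2 * p0) = 0 := by
    linear_combination ha - hb
  have e1 : (t0 + s0 - 2 * p0) * v₁ 0 + (t1 + s1 - 2 * p1) * v₁ 1 = 2 := by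
    linear_combination a₁ + b₁
  have c0 : t0 + s0 - 2 * p0 = 2 * (p0 - q0) := by
    linear_combination (p0 - q0) * e1 - (t0 + s0 - 2 * p0) * h₁ - v₁ 1 * e
  have c1 : t1 + s1 - 2 * p1 = 2 * (p1 - q1) := by
    linear_combination (p1 - q1) * e1 - (t1 + s1 - 2 * p1) * h₁ + v₁ 0 * e
  -- Then t + t' - 2n₂ = 4(n₁ - n₂), which takes the value -4 on v₂ instead of 2.
  have : (6 : ℝ) = 0 := by
    linear_combination v₂ 0 * c0 + v₂ 1 * c1 - a₂ - b₂ - 4 * h₂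
  norm_num at this

/-- The bounds give Q² ≤ N₁N₂, hence 3N₁N₂ ≤ 3, while 4N₁N₂ = 3 + Q² is positive. -/
theorem energy_relation {N₁ N₂ Q : ℤ} (h : 4 * (N₁ * N₂) - Q ^ 2 = 3) (h₁ : 0 ≤ N₁) (h₂ : 0 ≤ N₂)
    (hQ : Q ≤ 0) (h₃ : -Q ≤ N₁) (h₄ : -Q ≤ N₂) : N₁ = 1 ∧ N₂ = 1 ∧ Q = -1 := by
  have h5 : N₁ * N₂ ≤ 1 := by nlinarith
  have h6 : N₁ * N₂ = 1 := by nlinarith [sq_nonneg Q]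
  rcases Int.mul_eq_one_iff_eq_one_or_neg_one.1 h6 with ⟨a, b⟩ | ⟨a, b⟩
  · subst a; subst b
    refine ⟨rfl, rfl, ?_⟩
    have : (Q - 1) * (Q + 1) = 0 := by linarith
    rcases mul_eq_zero.1 this with h | h <;> omega
  · omega

namespace PlaneGraph

variable {G : AbstractTropicalCurve} (P : PlaneGraph G)

/-- The corner at the initial vertex of the common boundary of two bounded regions. -/
theorem exists_corner {L₁ L₂ : Aff} (hb : L₁ ∈ P.bounded) {v₁ v₂ : Plane}
    (hs : 0 < P.shared L₁ L₂)
    (h₁ : ∀ h, P.form h = L₁ → P.form (G.flip h) ≠ L₂ →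
      dot ((P.form (G.flip h)).1 - L₁.1) v₁ = 1)
    (h₂ : ∀ h, P.form h = L₂ → P.form (G.flip h) ≠ L₁ →
      dot ((P.form (G.flip h)).1 - L₂.1) v₂ = 1) :
    ∃ t : Fin 2 → ℤ, dot (t - L₁.1) v₁ = 1 ∧ dot (t - L₂.1) v₂ = 1 ∧
      det₂ (L₁.1 - L₂.1) (t - L₁.1) = 1 := by
  classical
  have hne : {h | P.form h = L₁ ∧ P.form (G.flip h) = L₂}.Nonempty := by
    by_contra hcon
    rw [Set.not_nonempty_iff_eq_empty] at hcon
    refine hs.ne' (Finset.sum_eq_zero fun h _ => if_neg fun hh => ?_)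
    exact (Set.eq_empty_iff_forall_notMem.1 hcon h) hh
  -- All half-edges between these two regions have the same direction, dual to the difference of the
  -- slopes; the minimum picks the first one along it.
  obtain ⟨k, ⟨hk1, hk2⟩, hmin⟩ := Set.exists_min_image _
    (fun h => lev (toPlane (P.dir h)) * lev (P.pos (G.vert h))) (Set.toFinite _) hne
  have hlen : ∀ h, P.form h = L₁ → G.len h ≠ ⊤ := fun h e =>
    P.len_ne_top_of_mem_bounded (by rwa [e])
  -- At a vertex of degree two the common boundary would continue backwards, against minimality.
  have hbiv : ∀ k', G.vert k' = G.vert k → P.dir k' = - P.dir k →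
      P.form k = P.form (G.flip k') → P.form k' = P.form (G.flip k) → False := by
    intro k' hv hd e1 e2
    have hf := e1.symm.trans hk1
    have h3 := hmin (G.flip k') ⟨hf, by rw [G.flip_flip, e2, hk2]⟩
    have hl := hlen _ hf
    have h4 := P.pos_flip _ hl
    rw [G.flip_flip, hv, P.dir_flip, hd, neg_neg] at h4
    rw [P.dir_flip, hd, neg_neg, h4, lev_add_smul] at h3
    have h5 : 0 < (G.len (G.flip k')).toReal := ENNReal.toReal_pos (G.len_pos _).ne' hl
    have h6 := P.lev_dir_ne_zero k
    have h7 : 0 < lev (toPlane (P.dir k)) ^ 2 := by positivity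
    have := mul_pos h5 h7
    nlinarith
  -- At a vertex of degree three, t is the slope of the third region, which is adjacent to both
  -- others.
  have htri : ∀ a b, det₂ (P.dir k) (P.dir a) = 1 → P.form k = P.form (G.flip a) →
      P.form a = P.form (G.flip b) → P.form b = P.form (G.flip k) →
      ∃ t : Fin 2 → ℤ, dot (t - L₁.1) v₁ = 1 ∧ dot (t - L₂.1) v₂ = 1 ∧
        det₂ (L₁.1 - L₂.1) (t - L₁.1) = 1 := by
    intro a b hdet e1 e2 e3
    refine ⟨(P.form a).1, ?_, ?_, ?_⟩
    · have := h₁ (G.flip a) (by rw [← e1, hk1]) (by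
        rw [G.flip_flip, ← hk2, ← e3, e2]; exact (P.form_ne b).symm)
      rwa [G.flip_flip] at this
    · have := h₂ b (by rw [e3, hk2]) (by
        rw [← e2, ← hk1, e1]; exact P.form_ne a)
      rwa [← e2] at this
    · have e4 := P.form_sub k
      have e5 := P.form_sub a
      rw [hk1, hk2] at e4
      rw [← e1, hk1] at e5
      rw [e4, e5, det₂_rot, hdet]
  rcases P.star_left (G.vert k) (not_isInf_of_len_ne_top (hlen k hk1)) with
    ⟨p, p', hne', hp, hd, -, hW⟩ | ⟨k₁, k₂, k₃, h₁₂, h₂₃, h₁₃, hp, hdet, hd, hW⟩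
  · exfalso
    obtain ⟨e1, e2⟩ := hW _ _ P.isFlow_affFlow
    rcases (hp k).1 rfl with rfl | rfl
    · exact hbiv p' ((hp _).2 (Or.inr rfl)) hd e1 e2
    · exact hbiv p ((hp _).2 (Or.inl rfl)) (by rw [hd, neg_neg]) e2 e1
  · obtain ⟨⟨e1, e2, e3⟩, -⟩ := hW _ _ P.isFlow_affFlow
    have d2 : det₂ (P.dir k₂) (P.dir k₃) = 1 := by
      rw [hd]; rw [det₂_eq] at hdet ⊢; simp only [Pi.neg_apply, Pi.add_apply]; linarith
    have d3 : det₂ (P.dir k₃) (P.dir k₁) = 1 := by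
      rw [hd]; rw [det₂_eq] at hdet ⊢; simp only [Pi.neg_apply, Pi.add_apply]; linarith
    rcases (hp k).1 rfl with rfl | rfl | rfl
    · exact htri k₂ k₃ hdet e1 e2 e3
    · exact htri k₃ k₁ d2 e2 e3 e1
    · exact htri k₁ k₂ d3 e3 e1 e2

/-- The cycles of a plane graph do not form a hexagonal lattice. -/
theorem not_hexagonal {G : AbstractTropicalCurve} (P : PlaneGraph G) (e : (ℤ × ℤ) ≃+ G.cycles) {l : ℝ} (hl : 0 < l)
    (he : ∀ x y : ℤ, G.energy (e (x, y)) = 4 * l * ((x : ℝ) ^ 2 - x * y + (y : ℝ) ^ 2)) :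
    False := by
  classical
  have hI : ((P.finite_bounded.toFinset : Finset Aff) : Set Aff) = P.bounded := by simp
  have hcard := P.card_bounded ((LinearEquiv.finTwoArrow ℤ ℤ).toAddEquiv.trans e) hI
  obtain ⟨L₁, L₂, hne, hI2⟩ := Finset.card_eq_two.1 hcard
  rw [hI2] at hI
  have hb : P.bounded = {L₁, L₂} := by rw [← hI]; simp
  have hb' : P.bounded = {L₂, L₁} := by rw [hb, Set.pair_comm]
  have b1 : L₁ ∈ P.bounded := by rw [hb]; simp
  have b2 : L₂ ∈ P.bounded := by rw [hb]; simp
  obtain ⟨v₁, hv1, hv1'⟩ := P.exists_dual hb hne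
  obtain ⟨v₂, hv2, hv2'⟩ := P.exists_dual hb' hne.symm
  obtain ⟨i1, q1⟩ := P.two_mul_shared_le b1 hv1 hv1'
  obtain ⟨i2, q2⟩ := P.two_mul_shared_le b2 hv2 hv2'
  rw [P.shared_comm L₂ L₁] at i2 q2
  -- the coordinates of the boundary cycles
  set γ₁ : G.cycles := ⟨P.loop L₁, P.loop_mem_cycles b1⟩ with hγ₁
  set γ₂ : G.cycles := ⟨P.loop L₂, P.loop_mem_cycles b2⟩ with hγ₂
  obtain ⟨⟨a, b⟩, hab⟩ := e.surjective γ₁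
  obtain ⟨⟨c, d⟩, hcd⟩ := e.surjective γ₂
  have hspan : ∀ w : ℤ × ℤ, ∃ p q : ℤ, w = (p * a + q * c, p * b + q * d) := by
    intro w
    obtain ⟨X, hX⟩ := P.exists_eq_sum_loop hI (e w).2
    refine ⟨X L₁, X L₂, ?_⟩
    have : e w = X L₁ • γ₁ + X L₂ • γ₂ := by
      refine Subtype.ext (funext fun h => ?_)
      rw [hX h, Finset.sum_pair hne]
      simp [hγ₁, hγ₂]
    rw [← hab, ← hcd, ← map_zsmul, ← map_zsmul, ← map_add] at this
    rw [e.injective this]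
    simp
  obtain ⟨p, q, h10⟩ := hspan (1, 0)
  obtain ⟨r, s, h01⟩ := hspan (0, 1)
  rw [Prod.mk.injEq] at h10 h01
  -- The loops generate all cycles, so their coordinate matrix is invertible over the integers.
  have hdet : (p * s - q * r) * (a * d - b * c) = 1 := by
    obtain ⟨x1, x2⟩ := h10
    obtain ⟨x3, x4⟩ := h01
    linear_combination -x1 * (r * b + s * d) + (r * a + s * c) * x2 - x4
  have hdet2 : (a * d - b * c) ^ 2 = 1 := by
    rcases Int.mul_eq_one_iff_eq_one_or_neg_one.1 hdet with h | h <;> rw [h.2] <;> norm_num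
  have E1 : 2 * P.perimeter L₁ = 4 * l * ((a : ℝ) ^ 2 - a * b + (b : ℝ) ^ 2) := by
    rw [← he, hab, ← P.energy_loop]
  have E2 : 2 * P.perimeter L₂ = 4 * l * ((c : ℝ) ^ 2 - c * d + (d : ℝ) ^ 2) := by
    rw [← he, hcd, ← P.energy_loop]
  have E3 : 2 * P.perimeter L₁ + 2 * P.perimeter L₂ - 4 * P.shared L₁ L₂ =
      4 * l * (((a + c : ℤ) : ℝ) ^ 2 - (a + c : ℤ) * (b + d : ℤ) + ((b + d : ℤ) : ℝ) ^ 2) := by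
    rw [← he, ← Prod.mk_add_mk, map_add, hab, hcd, ← P.energy_loop_add hne]; rfl
  push_cast at E3
  set N₁ : ℤ := a ^ 2 - a * b + b ^ 2 with hN₁
  set N₂ : ℤ := c ^ 2 - c * d + d ^ 2 with hN₂
  -- The polar form: Q = N(a + c, b + d) - N₁ - N₂ for N(x, y) = x² - xy + y², and 4N₁N₂ - Q² is
  -- three times the squared determinant.
  set Q : ℤ := 2 * a * c - a * d - b * c + 2 * b * d with hQ
  have F1 : P.perimeter L₁ = 2 * l * N₁ := by rw [hN₁]; push_cast; linarith
  have F2 : P.perimeter L₂ = 2 * l * N₂ := by rw [hN₂]; push_cast; linarith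
  have F3 : P.shared L₁ L₂ = -(l * Q) := by rw [hQ]; push_cast; linarith
  have hrel : 4 * (N₁ * N₂) - Q ^ 2 = 3 := by
    rw [hN₁, hN₂, hQ]; linear_combination 3 * hdet2
  have g1 : 0 ≤ N₁ := by nlinarith [sq_nonneg (a - b), sq_nonneg a, sq_nonneg b]
  have g2 : 0 ≤ N₂ := by nlinarith [sq_nonneg (c - d), sq_nonneg c, sq_nonneg d]
  have g3 : Q ≤ 0 := by
    have := P.shared_nonneg L₁ L₂
    rw [F3] at this
    have : l * (Q : ℝ) ≤ l * 0 := by linarith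
    exact_mod_cast le_of_mul_le_mul_left this hl
  have g4 : -Q ≤ N₁ := by
    rw [F1, F3] at i1
    have : l * (-Q : ℝ) ≤ l * N₁ := by linarith
    exact_mod_cast le_of_mul_le_mul_left this hl
  have g5 : -Q ≤ N₂ := by
    rw [F2, F3] at i2
    have : l * (-Q : ℝ) ≤ l * N₂ := by linarith
    exact_mod_cast le_of_mul_le_mul_left this hl
  obtain ⟨n1, n2, n3⟩ := energy_relation hrel g1 g2 g3 g4 g5
  rw [n1] at F1
  rw [n2] at F2
  rw [n3] at F3
  push_cast at F1 F2 F3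
  -- The common boundary has length l and both perimeters are 2l, so the equality case applies to
  -- both regions.
  have r1 := q1 (by rw [F1, F3]; ring)
  have r2 := q2 (by rw [F2, F3]; ring)
  have hs : 0 < P.shared L₁ L₂ := by rw [F3]; linarith
  obtain ⟨t, t1, t2, t3⟩ := P.exists_corner b1 hs r1 r2
  obtain ⟨t', t1', t2', t3'⟩ := P.exists_corner b2 (by rwa [P.shared_comm]) r2 r1
  exact no_dual_pair hv1 hv2 t1 t2 t3 t1' t2' t3'

end PlaneGraph

/-- A realization of a theta graph with equal lengths is not smooth. -/
theorem not_smooth_of_realizes {ℓ : Fin 3 → ℝ} {hℓ : ∀ i, 0 < ℓ i} (heq : ∀ i j, ℓ i = ℓ j)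
    {C : Set Plane} (hC : Realizes C (theta ℓ hℓ)) : ¬ ∀ p ∈ C, IsSmoothAt C p := by
  intro hs
  obtain ⟨G, hG, ⟨R⟩⟩ := hC
  obtain ⟨e, he⟩ := exists_addEquiv_cycles_theta ℓ hℓ heq
  obtain ⟨e', he'⟩ := hG.cycleIsometric
  exact (R.toPlaneGraph hs).not_hexagonal (e.trans e') (hℓ 0) fun x y => by
    rw [← he x y, ← he']; rfl

/-- A node has positive multiplicity. -/
theorem IsNode.nodeMultiplicity_pos {C : Set Plane} {p : Plane} (h : IsNode C p) :
    0 < nodeMultiplicity C p := by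
  obtain ⟨u, v, h⟩ := h
  have hne : {m | ∃ u v, IsNodeWith C p u v ∧ m = (det₂ u v).natAbs}.Nonempty :=
    ⟨_, u, v, h, rfl⟩
  obtain ⟨u', v', h', e⟩ := Nat.sInf_mem hne
  rw [nodeMultiplicity, e]
  exact Int.natAbs_pos.2 h'.2.2.1

/-- A nodal curve that is not smooth at some point has a node there. -/
theorem one_le_nodeCount {ℓ : Fin 3 → ℝ} {hℓ : ∀ i, 0 < ℓ i} (heq : ∀ i j, ℓ i = ℓ j)
    {C : Set Plane} (hC : IsImmersion (theta ℓ hℓ) C) : 1 ≤ nodeCount C := by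
  have h := not_smooth_of_realizes heq hC.2
  push Not at h
  obtain ⟨p, hp, hns⟩ := h
  have hn := (hC.1.2 p hp).resolve_left hns
  have h1 : (1 : ℕ∞) ≤ ∑ q ∈ ({p} : Finset Plane), (nodeMultiplicity C q : ℕ∞) := by
    rw [Finset.sum_singleton]
    exact_mod_cast hn.nodeMultiplicity_pos
  exact h1.trans (le_iSup (fun S : Finset Plane => ∑ q ∈ S, (nodeMultiplicity C q : ℕ∞)) {p})

/-! ### Explicit subdivisions, attached edges and renumberings -/

namespace AbstractTropicalCurve

/-- The subdivision of an edge of finite length `a + b`. -/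
noncomputable def subdivide (G : AbstractTropicalCurve) [dec : DecidableEq G.H] (h₀ : G.H)
    {a b : ℝ}
    (ha : 0 < a) (hb : 0 < b) (hl : G.len h₀ = ENNReal.ofReal (a + b)) :
    AbstractTropicalCurve where
  V := Option G.V
  H := G.H ⊕ Bool
  finite_V := haveI := G.finite_V; inferInstance
  finite_H := haveI := G.finite_H; inferInstance
  nonempty_V := inferInstance
  vert := Sum.elim (fun h => some (G.vert h)) (fun _ => none)
  flip := Sum.elim (fun h => if h = h₀ then Sum.inr false else if h = G.flip h₀ then Sum.inr true
    else Sum.inl (G.flip h)) (fun c => Sum.inl (cond c (G.flip h₀) h₀))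
  flip_flip := by
    have e0 := G.flip_ne h₀
    rintro (h | c)
    · simp only [Sum.elim_inl]
      by_cases h1 : h = h₀
      · subst h1; simp
      by_cases h2 : h = G.flip h₀
      · subst h2; simp [e0]
      have h3 : G.flip h ≠ h₀ := fun e => h2 (by rw [← e, G.flip_flip])
      have h4 : G.flip h ≠ G.flip h₀ := fun e => h1 (by rw [← G.flip_flip h, e, G.flip_flip])
      simp [h1, h2, h3, h4, G.flip_flip]
    · cases c <;> simp [e0]
  flip_ne := by
    rintro (h | c)
    · simp only [Sum.elim_inl]
      split_ifs <;> simp [G.flip_ne]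
    · simp
  connected := by
    set R : Option G.V → Option G.V → Prop := fun v w => ∃ h : G.H ⊕ Bool,
      Sum.elim (fun h => some (G.vert h)) (fun _ => none) h = v ∧
      Sum.elim (fun h => some (G.vert h)) (fun _ => none) (Sum.elim (fun h => if h = h₀ then
        Sum.inr false else if h = G.flip h₀ then Sum.inr true else Sum.inl (G.flip h))
        (fun c => Sum.inl (cond c (G.flip h₀) h₀)) h) = w with hR
    have e0 := G.flip_ne h₀
    have r1 : R (some (G.vert h₀)) none := ⟨Sum.inl h₀, by simp⟩
    have r2 : R (some (G.vert (G.flip h₀))) none := ⟨Sum.inl (G.flip h₀), by simp [e0]⟩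
    have r3 : R none (some (G.vert h₀)) := ⟨Sum.inr false, by simp⟩
    have r4 : R none (some (G.vert (G.flip h₀))) := ⟨Sum.inr true, by simp⟩
    have key : ∀ v w, Relation.ReflTransGen R (some v) (some w) := by
      intro v w
      refine Relation.ReflTransGen.lift' some ?_ _ _ (G.connected v w)
      rintro _ _ ⟨h, rfl, rfl⟩
      by_cases h1 : h = h₀
      · subst h1; exact .tail (.single r1) r4
      by_cases h2 : h = G.flip h₀
      · subst h2; rw [G.flip_flip]; exact .tail (.single r2) r3
      exact .single ⟨Sum.inl h, by simp [h1, h2]⟩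
    rintro (_ | v) (_ | w)
    · exact .refl
    · exact .head r3 (key _ _)
    · exact .tail (key _ _) r1
    · exact key v w
  len := Sum.elim (fun h => if h = h₀ then ENNReal.ofReal a else if h = G.flip h₀ then
    ENNReal.ofReal b else G.len h) (fun c => cond c (ENNReal.ofReal b) (ENNReal.ofReal a))
  len_flip := by
    have e0 := G.flip_ne h₀
    rintro (h | c)
    · simp only [Sum.elim_inl]
      by_cases h1 : h = h₀
      · subst h1; simp
      by_cases h2 : h = G.flip h₀
      · subst h2; simp [e0]
      have h3 : G.flip h ≠ h₀ := fun e => h2 (by rw [← e, G.flip_flip])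
      have h4 : G.flip h ≠ G.flip h₀ := fun e => h1 (by rw [← G.flip_flip h, e, G.flip_flip])
      simp [h1, h2, h3, h4, G.len_flip]
    · cases c <;> simp [e0]
  len_pos := by
    rintro (h | c)
    · simp only [Sum.elim_inl]
      split_ifs
      · simpa using ha
      · simpa using hb
      · exact G.len_pos h
    · cases c <;> simpa
  IsInf v := v.elim False G.IsInf
  isInf_of_len := by
    have e0 := G.flip_ne h₀
    rintro (h | c)
    · simp only [Sum.elim_inl]
      split_ifs with h1 h2
      · simp
      · simp
      · intro h; simpa using G.isInf_of_len _ h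
    · cases c <;> simp
  isInf_spec := by
    rintro (_ | v) hv
    · exact hv.elim
    · obtain ⟨h, hh, hl'⟩ := G.isInf_spec v hv
      have h1 : h ≠ h₀ := by
        rintro rfl; rw [hl] at hl'; exact ENNReal.ofReal_ne_top hl'
      have h2 : h ≠ G.flip h₀ := by
        rintro rfl; rw [G.len_flip, hl] at hl'; exact ENNReal.ofReal_ne_top hl'
      refine ⟨Sum.inl h, ?_, by simp [h1, h2, hl']⟩
      rintro (k | c)
      · simp [hh]
      · simp

/-- Equality of half-edges of a subdivision is decidable. -/
def decidableEqSubdivide {G : AbstractTropicalCurve} {dec : DecidableEq G.H} {h₀ : G.H} {a b : ℝ}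
    {ha : 0 < a} {hb : 0 < b} {hl : G.len h₀ = ENNReal.ofReal (a + b)} :
    DecidableEq (G.subdivide h₀ ha hb hl).H :=
  inferInstanceAs (DecidableEq (G.H ⊕ Bool))

theorem isSubdivision_subdivide (G : AbstractTropicalCurve) {dec : DecidableEq G.H} (h₀ : G.H)
    {a b : ℝ}
    (ha : 0 < a) (hb : 0 < b) (hl : G.len h₀ = ENNReal.ofReal (a + b)) :
    G.IsSubdivision (G.subdivide h₀ ha hb hl) := by
  have e0 := G.flip_ne h₀
  refine ⟨h₀, Equiv.refl _, Equiv.refl _, fun _ => rfl, fun _ => rfl, if_pos rfl,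
    (if_neg e0).trans (if_pos rfl), fun h h1 h2 => ⟨(if_neg h1).trans (if_neg h2),
    (if_neg h1).trans (if_neg h2)⟩, ?_, fun _ => Iff.rfl, fun h => h⟩
  rw [hl, ENNReal.ofReal_add ha.le hb.le]
  exact congrArg₂ (· + ·) (if_pos rfl) ((if_neg e0).trans (if_pos rfl))

/-- The elementary modification at a finite vertex. -/
noncomputable def attach (G : AbstractTropicalCurve) (v₀ : G.V) (hv₀ : ¬ G.IsInf v₀) :
    AbstractTropicalCurve where
  V := Option G.V
  H := G.H ⊕ Bool
  finite_V := haveI := G.finite_V; inferInstance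
  finite_H := haveI := G.finite_H; inferInstance
  nonempty_V := inferInstance
  vert := Sum.elim (fun h => some (G.vert h)) (fun c => cond c none (some v₀))
  flip := Sum.elim (fun h => Sum.inl (G.flip h)) (fun c => Sum.inr (!c))
  flip_flip := by rintro (h | c) <;> simp [G.flip_flip]
  flip_ne := by rintro (h | c) <;> simp [G.flip_ne]
  connected := by
    set R : Option G.V → Option G.V → Prop := fun v w => ∃ h : G.H ⊕ Bool,
      Sum.elim (fun h => some (G.vert h)) (fun c => cond c none (some v₀)) h = v ∧
      Sum.elim (fun h => some (G.vert h)) (fun c => cond c none (some v₀))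
        (Sum.elim (fun h => Sum.inl (G.flip h)) (fun c => Sum.inr (!c)) h) = w with hR
    have r1 : R (some v₀) none := ⟨Sum.inr false, by simp⟩
    have r2 : R none (some v₀) := ⟨Sum.inr true, by simp⟩
    have key : ∀ v w, Relation.ReflTransGen R (some v) (some w) := by
      intro v w
      refine Relation.ReflTransGen.lift some ?_ _ _ (G.connected v w)
      rintro _ _ ⟨h, rfl, rfl⟩
      exact ⟨Sum.inl h, by simp⟩
    rintro (_ | v) (_ | w)
    · exact .refl
    · exact .head r2 (key _ _)
    · exact .tail (key _ _) r1
    · exact key v w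
  len := Sum.elim G.len (fun _ => ⊤)
  len_flip := by rintro (h | c) <;> simp [G.len_flip]
  len_pos := by rintro (h | c) <;> simp [G.len_pos]
  IsInf v := v.elim True G.IsInf
  isInf_of_len := by
    rintro (h | c)
    · simpa using G.isInf_of_len h
    · cases c <;> simp
  isInf_spec := by
    rintro (_ | v) hv
    · refine ⟨Sum.inr true, ?_, rfl⟩
      rintro (k | c)
      · simp
      · cases c <;> simp
    · obtain ⟨h, hh, hl⟩ := G.isInf_spec v hv
      refine ⟨Sum.inl h, ?_, hl⟩
      rintro (k | c)
      · simp [hh]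
      · cases c
        · simp only [Sum.elim_inr, cond_false, Option.some.injEq, reduceCtorEq, iff_false]
          rintro rfl; exact hv₀ hv
        · simp

theorem isElementaryModification_attach (G : AbstractTropicalCurve) (v₀ : G.V)
    (hv₀ : ¬ G.IsInf v₀) : G.IsElementaryModification (G.attach v₀ hv₀) :=
  ⟨v₀, Equiv.refl _, Equiv.refl _, hv₀, fun _ => rfl, rfl, rfl, fun _ => rfl, rfl, fun _ => rfl, rfl,
    fun _ => Iff.rfl, trivial⟩

/-- Transport of an abstract tropical curve along bijections of the vertices and half-edges. -/
def ofEquiv (G : AbstractTropicalCurve) {V H : Type} (φ : G.V ≃ V) (ψ : G.H ≃ H) (vert : H → V)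
    (flip : H → H) (len : H → ℝ≥0∞) (IsInf : V → Prop) (hvert : ∀ h, vert (ψ h) = φ (G.vert h))
    (hflip : ∀ h, flip (ψ h) = ψ (G.flip h)) (hlen : ∀ h, len (ψ h) = G.len h)
    (hinf : ∀ v, IsInf (φ v) ↔ G.IsInf v) : AbstractTropicalCurve where
  V := V
  H := H
  finite_V := haveI := G.finite_V; Finite.of_equiv _ φ
  finite_H := haveI := G.finite_H; Finite.of_equiv _ ψ
  nonempty_V := haveI := G.nonempty_V; φ.symm.nonempty
  vert := vert
  flip := flip
  flip_flip h := by
    obtain ⟨h, rfl⟩ := ψ.surjective h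
    rw [hflip, hflip, G.flip_flip]
  flip_ne h := by
    obtain ⟨h, rfl⟩ := ψ.surjective h
    rw [hflip]
    exact fun e => G.flip_ne h (ψ.injective e)
  connected v w := by
    obtain ⟨v, rfl⟩ := φ.surjective v
    obtain ⟨w, rfl⟩ := φ.surjective w
    refine Relation.ReflTransGen.lift φ ?_ _ _ (G.connected v w)
    rintro _ _ ⟨h, rfl, rfl⟩
    exact ⟨ψ h, hvert h, by rw [hflip, hvert]⟩
  len := len
  len_flip h := by
    obtain ⟨h, rfl⟩ := ψ.surjective h
    rw [hflip, hlen, hlen, G.len_flip]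
  len_pos h := by
    obtain ⟨h, rfl⟩ := ψ.surjective h
    rw [hlen]; exact G.len_pos h
  IsInf := IsInf
  isInf_of_len h := by
    obtain ⟨h, rfl⟩ := ψ.surjective h
    rw [hflip, hlen, hvert, hvert, hinf, hinf]
    exact G.isInf_of_len h
  isInf_spec v hv := by
    obtain ⟨v, rfl⟩ := φ.surjective v
    obtain ⟨h, hh, hl⟩ := G.isInf_spec v ((hinf v).1 hv)
    refine ⟨ψ h, fun k => ?_, by rw [hlen, hl]⟩
    obtain ⟨k, rfl⟩ := ψ.surjective k
    rw [hvert, φ.injective.eq_iff, hh, ψ.injective.eq_iff]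

theorem iso_ofEquiv (G : AbstractTropicalCurve) {V H : Type} (φ : G.V ≃ V) (ψ : G.H ≃ H)
    (vert : H → V) (flip : H → H) (len : H → ℝ≥0∞) (IsInf : V → Prop)
    (hvert : ∀ h, vert (ψ h) = φ (G.vert h)) (hflip : ∀ h, flip (ψ h) = ψ (G.flip h))
    (hlen : ∀ h, len (ψ h) = G.len h) (hinf : ∀ v, IsInf (φ v) ↔ G.IsInf v) :
    G.Iso (G.ofEquiv φ ψ vert flip len IsInf hvert hflip hlen hinf) :=
  ⟨φ, ψ, hvert, hflip, hlen, hinf⟩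

end AbstractTropicalCurve

/-! ### Recognizing local models and counting nodes -/

/-- The image of a fan under an integral matrix. -/
theorem image_fan (A : Matrix (Fin 2) (Fin 2) ℤ) (S : Set (Fin 2 → ℤ)) :
    (fun x => A.map (Int.cast : ℤ → ℝ) *ᵥ x) '' fan S = fan ((fun u => A *ᵥ u) '' S) := by
  have hmap : ∀ u : Fin 2 → ℤ, A.map (Int.cast : ℤ → ℝ) *ᵥ toPlane u = toPlane (A *ᵥ u) := by
    intro u; ext i
    fin_cases i <;> simp [Matrix.mulVec, dotProduct, Fin.sum_univ_two]
  ext x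
  constructor
  · rintro ⟨_, ⟨u, hu, t, ht, rfl⟩, rfl⟩
    exact ⟨_, ⟨u, hu, rfl⟩, t, ht, by simp only [Matrix.mulVec_smul, hmap]⟩
  · rintro ⟨_, ⟨u, hu, rfl⟩, t, ht, rfl⟩
    exact ⟨_, ⟨u, hu, t, ht, rfl⟩, by simp only [Matrix.mulVec_smul, hmap]⟩

theorem exists_GL {a b : Fin 2 → ℤ} (h : det₂ a b = 1) : ∃ A : GL (Fin 2) ℤ,
    ((A : Matrix (Fin 2) (Fin 2) ℤ) *ᵥ ![1, 0] = a) ∧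
    ((A : Matrix (Fin 2) (Fin 2) ℤ) *ᵥ ![0, 1] = b) := by
  refine ⟨Matrix.GeneralLinearGroup.mk'' !![a 0, b 0; a 1, b 1] (by
    rw [det₂] at h; exact h ▸ isUnit_one), ?_, ?_⟩ <;>
  · change !![a 0, b 0; a 1, b 1] *ᵥ _ = _
    funext i
    fin_cases i <;> simp [Matrix.mulVec, dotProduct]

theorem isSmoothAt_of_line {C : Set Plane} {p : Plane} {a : Fin 2 → ℤ} (ha : IsPrimitive a)
    (h : LocallyAt C p (fan {a, -a})) : IsSmoothAt C p := by
  obtain ⟨b, hab⟩ := ha.exists_det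
  obtain ⟨A, hA, -⟩ := exists_GL hab
  refine ⟨_, A, Or.inl rfl, ?_⟩
  rw [image_fan, Set.image_pair, hA]
  have : (![-1, 0] : Fin 2 → ℤ) = -![1, 0] := by simp
  rwa [this, Matrix.mulVec_neg, hA]

theorem isSmoothAt_of_tripod {C : Set Plane} {p : Plane} {a b : Fin 2 → ℤ} (hab : det₂ a b = 1)
    (h : LocallyAt C p (fan {a, b, -(a + b)})) : IsSmoothAt C p := by
  obtain ⟨A, hA, hB⟩ := exists_GL hab
  refine ⟨_, A, Or.inr rfl, ?_⟩
  rw [image_fan, Set.image_insert_eq, Set.image_pair, hA, hB]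
  have : (![-1, -1] : Fin 2 → ℤ) = -(![1, 0] + ![0, 1]) := by simp
  rwa [this, Matrix.mulVec_neg, Matrix.mulVec_add, hA, hB]

theorem isNodeWith_of_cross {C : Set Plane} {p : Plane} {u v : Fin 2 → ℤ} (hu : IsPrimitive u)
    (hv : IsPrimitive v) (huv : det₂ u v ≠ 0) (h : LocallyAt C p (fan {u, -u, v, -v})) :
    IsNodeWith C p u v := by
  refine ⟨hu, hv, huv, ?_⟩
  convert h using 1
  ext x
  constructor
  · rintro ⟨t, ht⟩
    rcases le_total 0 t with h0 | h0 <;> rcases ht with rfl | rfl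
    · exact ⟨u, by simp, t, h0, rfl⟩
    · exact ⟨v, by simp, t, h0, rfl⟩
    · exact ⟨-u, by simp, -t, by linarith, by rw [toPlane_neg]; simp⟩
    · exact ⟨-v, by simp, -t, by linarith, by rw [toPlane_neg]; simp⟩
  · rintro ⟨w, hw, t, -, rfl⟩
    rcases hw with rfl | rfl | rfl | rfl
    · exact ⟨t, Or.inl rfl⟩
    · exact ⟨-t, Or.inl (by rw [toPlane_neg]; simp)⟩
    · exact ⟨t, Or.inr rfl⟩
    · exact ⟨-t, Or.inr (by rw [toPlane_neg]; simp)⟩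

theorem IsNode.mem {C : Set Plane} {p : Plane} (h : IsNode C p) : p ∈ C := by
  obtain ⟨u, v, -, -, -, h⟩ := h
  exact h.self_of_nhds.2 ⟨0, by simp⟩

theorem nodeMultiplicity_eq_zero {C : Set Plane} {p : Plane} (h : ¬ IsNode C p) :
    nodeMultiplicity C p = 0 := by
  have : {m | ∃ u v, IsNodeWith C p u v ∧ m = (det₂ u v).natAbs} = ∅ := by
    rw [Set.eq_empty_iff_forall_notMem]
    rintro m ⟨u, v, hn, -⟩
    exact h ⟨u, v, hn⟩
  rw [nodeMultiplicity, this, Nat.sInf_empty]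

/-- The multiplicity is an infimum, so a single pair of directions with determinant ±1 bounds it by
one. -/
theorem nodeCount_le_one {C : Set Plane} {z : Plane} (hz : ∀ p, IsNode C p → p = z)
    {u v : Fin 2 → ℤ} (h : IsNodeWith C z u v) (huv : (det₂ u v).natAbs = 1) : nodeCount C ≤ 1 := by
  classical
  refine iSup_le fun S => ?_
  have : ∀ p ∈ S, (nodeMultiplicity C p : ℕ∞) ≤ if p = z then 1 else 0 := by
    intro p _
    split_ifs with hp
    · subst hp
      have : nodeMultiplicity C p ≤ 1 := Nat.sInf_le ⟨u, v, h, huv.symm⟩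
      exact_mod_cast this
    · rw [nodeMultiplicity_eq_zero fun hn => hp (hz p hn)]
      simp
  refine (Finset.sum_le_sum this).trans ?_
  rw [Finset.sum_ite_eq']
  split_ifs <;> simp

/-- The coordinate along an integral direction. -/
noncomputable def along (d : Fin 2 → ℤ) (y : Plane) : ℝ := dot d y / dot d (toPlane d)

theorem continuous_along (d : Fin 2 → ℤ) : Continuous (along d) := by
  unfold along dot; fun_prop

theorem along_smul {d : Fin 2 → ℤ} (hd : d ≠ 0) (t : ℝ) : along d (t • toPlane d) = t := by
  have : dot d (toPlane d) ≠ 0 := by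
    intro h
    apply hd
    simp only [dot, toPlane_apply] at h
    have h0 : (d 0 : ℝ) = 0 := by nlinarith [mul_self_nonneg (d 0 : ℝ), mul_self_nonneg (d 1 : ℝ)]
    have h1 : (d 1 : ℝ) = 0 := by nlinarith [mul_self_nonneg (d 0 : ℝ), mul_self_nonneg (d 1 : ℝ)]
    funext i
    fin_cases i
    · exact_mod_cast h0
    · exact_mod_cast h1
  rw [along, dot_smul]; field_simp

/-! ### Drawings and their local structure -/

/-- A plane drawing of an abstract tropical curve in which distinct edges are disjoint, and
contain no vertex. -/
structure Drawing (G : AbstractTropicalCurve) where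
  pos : G.V → Plane
  dir : G.H → Fin 2 → ℤ
  dir_primitive : ∀ h, IsPrimitive (dir h)
  dir_flip : ∀ h, dir (G.flip h) = - dir h
  finite_end : ∀ h, ¬ G.IsInf (G.vert h) ∨ ¬ G.IsInf (G.vert (G.flip h))
  pos_flip : ∀ h, G.len h ≠ ⊤ →
    pos (G.vert (G.flip h)) = pos (G.vert h) + (G.len h).toReal • toPlane (dir h)
  edge_disjoint : ∀ h k, ¬ G.IsInf (G.vert h) → ¬ G.IsInf (G.vert k) → k ≠ h → k ≠ G.flip h →
    Disjoint (openEdge G pos dir h) (openEdge G pos dir k)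
  vert_not_mem_edge : ∀ v h, ¬ G.IsInf v → ¬ G.IsInf (G.vert h) → pos v ∉ openEdge G pos dir h

namespace Drawing

variable {G : AbstractTropicalCurve} (D : Drawing G)

/-- The relative interior of an edge. -/
abbrev edge (h : G.H) : Set Plane := openEdge G D.pos D.dir h

/-- The underlying set of a drawing. -/
def curve : Set Plane := {x | ∃ v, ¬ G.IsInf v ∧ x = D.pos v} ∪
  {x | ∃ h, ¬ G.IsInf (G.vert h) ∧ x ∈ D.edge h}

/-- An edge with its end points. -/
def closedEdge (h : G.H) : Set Plane :=
  {x | ∃ t : ℝ, 0 ≤ t ∧ ENNReal.ofReal t ≤ G.len h ∧ x = D.pos (G.vert h) + t • toPlane (D.dir h)}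

theorem closedEdge_cases {h : G.H} {x : Plane} (hx : x ∈ D.closedEdge h) : x = D.pos (G.vert h) ∨
    (G.len h ≠ ⊤ ∧ x = D.pos (G.vert (G.flip h))) ∨ x ∈ D.edge h := by
  obtain ⟨t, ht, hl, rfl⟩ := hx
  rcases ht.eq_or_lt with rfl | ht
  · left; simp
  rcases hl.eq_or_lt with hl | hl
  · right; left
    have hn : G.len h ≠ ⊤ := by rw [← hl]; exact ENNReal.ofReal_ne_top
    refine ⟨hn, ?_⟩
    rw [D.pos_flip h hn, ← hl, ENNReal.toReal_ofReal ht.le]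
  · right; right
    exact ⟨t, ht, hl, rfl⟩

theorem closedEdge_subset {h : G.H} (hh : ¬ G.IsInf (G.vert h)) : D.closedEdge h ⊆ D.curve := by
  intro x hx
  rcases D.closedEdge_cases hx with rfl | ⟨hl, rfl⟩ | hx
  · exact Or.inl ⟨_, hh, rfl⟩
  · exact Or.inl ⟨_, not_isInf_of_len_ne_top (by rwa [G.len_flip]), rfl⟩
  · exact Or.inr ⟨h, hh, hx⟩

theorem isFiniteUnion_curve : IsFiniteUnion D.curve := by
  have := G.finite_V
  have := G.finite_H
  -- Vertices enter as degenerate segments, closed edges as segments or rays.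
  refine ⟨{s | ∃ v, ¬ G.IsInf v ∧ {D.pos v} = s} ∪
    {s | ∃ h, ¬ G.IsInf (G.vert h) ∧ D.closedEdge h = s}, ?_, ?_, ?_⟩
  · refine Set.Finite.union ?_ ?_
    · exact (Set.finite_range fun v => ({D.pos v} : Set Plane)).subset (by
        rintro _ ⟨v, -, rfl⟩; exact ⟨v, rfl⟩)
    · exact (Set.finite_range D.closedEdge).subset (by rintro _ ⟨v, -, rfl⟩; exact ⟨v, rfl⟩)
  · rintro s (⟨v, -, rfl⟩ | ⟨h, -, rfl⟩)
    · exact Or.inl ⟨D.pos v, D.pos v, (segment_same ℝ _).symm⟩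
    · by_cases hl : G.len h = ⊤
      · exact Or.inr ⟨D.pos (G.vert h), toPlane (D.dir h), (D.dir_primitive h).toPlane_ne_zero, by
          simp [closedEdge, hl]⟩
      · refine Or.inl ⟨D.pos (G.vert h), D.pos (G.vert (G.flip h)), ?_⟩
        have hl0 : 0 < (G.len h).toReal := ENNReal.toReal_pos (G.len_pos h).ne' hl
        rw [segment_eq_image', D.pos_flip h hl]
        ext x
        constructor
        · rintro ⟨t, ht, ht', rfl⟩
          refine ⟨t / (G.len h).toReal, ⟨by positivity, ?_⟩, ?_⟩
          · rw [div_le_one hl0]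
            exact (ENNReal.ofReal_le_iff_le_toReal hl).1 ht'
          · simp only [add_sub_cancel_left, smul_smul]
            rw [div_mul_cancel₀ _ hl0.ne']
        · rintro ⟨θ, ⟨h0, h1⟩, rfl⟩
          refine ⟨θ * (G.len h).toReal, by positivity, ?_, ?_⟩
          · rw [ENNReal.ofReal_le_iff_le_toReal hl]
            nlinarith
          · simp only [add_sub_cancel_left, smul_smul]
  · ext x
    constructor
    · rintro (⟨v, hv, rfl⟩ | ⟨h, hh, t, ht, hl, rfl⟩)
      · exact ⟨_, Or.inl ⟨v, hv, rfl⟩, rfl⟩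
      · exact ⟨_, Or.inr ⟨h, hh, rfl⟩, t, ht.le, hl.le, rfl⟩
    · rintro ⟨_, ⟨v, hv, rfl⟩ | ⟨h, hh, rfl⟩, hx⟩
      · exact Or.inl ⟨v, hv, hx⟩
      · exact D.closedEdge_subset hh hx

theorem eventually_mem_edge_of_mem {h : G.H} {z : Plane} (hz : z ∈ D.edge h) :
    ∀ᶠ x in 𝓝 z, ((∃ s : ℝ, x - z = s • toPlane (D.dir h)) ↔ x ∈ D.edge h) := by
  have hd := (D.dir_primitive h).ne_zero
  obtain ⟨τ, h0, h1, rfl⟩ := hz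
  set a := D.pos (G.vert h) with ha
  have hc : Continuous fun x => along (D.dir h) (x - a) :=
    (continuous_along _).comp (by fun_prop)
  have hc1 := hc.tendsto (a + τ • toPlane (D.dir h))
  have hc2 := (ENNReal.continuous_ofReal.comp hc).tendsto (a + τ • toPlane (D.dir h))
  simp only [Function.comp_apply, add_sub_cancel_left, along_smul hd] at hc1 hc2
  filter_upwards [hc1.eventually_const_lt h0, hc2.eventually_lt_const h1] with x hx1 hx2
  constructor
  · rintro ⟨s, hs⟩
    have e : x = a + (τ + s) • toPlane (D.dir h) := by
      rw [sub_eq_iff_eq_add] at hs; rw [hs]; module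
    simp only [Function.comp_apply] at hx2
    rw [e, add_sub_cancel_left, along_smul hd] at hx1 hx2
    exact ⟨_, hx1, hx2, e⟩
  · rintro ⟨s, -, -, rfl⟩
    exact ⟨s - τ, by module⟩

theorem eventually_mem_edge_of_vert (h : G.H) : ∀ᶠ x in 𝓝 (D.pos (G.vert h)),
    ((∃ s : ℝ, 0 < s ∧ x - D.pos (G.vert h) = s • toPlane (D.dir h)) ↔ x ∈ D.edge h) := by
  have hd := (D.dir_primitive h).ne_zero
  set a := D.pos (G.vert h) with ha
  have hc : Continuous fun x => ENNReal.ofReal (along (D.dir h) (x - a)) :=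
    ENNReal.continuous_ofReal.comp ((continuous_along _).comp (by fun_prop))
  have hc2 := hc.tendsto a
  have e0 : along (D.dir h) (a - a) = 0 := by simp [along, dot]
  rw [e0, ENNReal.ofReal_zero] at hc2
  filter_upwards [hc2.eventually_lt_const (G.len_pos h)] with x hx2
  constructor
  · rintro ⟨s, hs0, hs⟩
    rw [hs, along_smul hd] at hx2
    exact ⟨s, hs0, hx2, by rw [← hs]; abel⟩
  · rintro ⟨s, hs, -, rfl⟩
    exact ⟨s, hs, by rw [add_sub_cancel_left]⟩

theorem isClosed_closedEdge (h : G.H) : IsClosed (D.closedEdge h) := by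
  have hd := (D.dir_primitive h).ne_zero
  have e : D.closedEdge h = {x | 0 ≤ along (D.dir h) (x - D.pos (G.vert h))} ∩
      {x | ENNReal.ofReal (along (D.dir h) (x - D.pos (G.vert h))) ≤ G.len h} ∩
      {x | x = D.pos (G.vert h) +
        along (D.dir h) (x - D.pos (G.vert h)) • toPlane (D.dir h)} := by
    ext x
    constructor
    · rintro ⟨t, h0, h1, rfl⟩
      refine ⟨⟨?_, ?_⟩, ?_⟩ <;>
        simp only [Set.mem_ofPred_eq, add_sub_cancel_left, along_smul hd]
      · exact h0
      · exact h1
    · rintro ⟨⟨h0, h1⟩, h2⟩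
      exact ⟨_, h0, h1, h2⟩
  have hc : Continuous fun x => along (D.dir h) (x - D.pos (G.vert h)) :=
    (continuous_along _).comp (by fun_prop)
  rw [e]
  exact ((isClosed_le continuous_const hc).inter (isClosed_le (ENNReal.continuous_ofReal.comp hc)
    continuous_const)).inter (isClosed_eq continuous_id (by fun_prop))

theorem edge_flip {h : G.H} (hl : G.len h ≠ ⊤) : D.edge (G.flip h) = D.edge h := by
  have key : ∀ h, G.len h ≠ ⊤ → D.edge h ⊆ D.edge (G.flip h) := by
    rintro h hl _ ⟨t, h0, h1, rfl⟩
    have h2 : t < (G.len h).toReal := (ENNReal.ofReal_lt_iff_lt_toReal h0.le hl).1 h1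
    refine ⟨(G.len h).toReal - t, by linarith, ?_, ?_⟩
    · rw [G.len_flip, ENNReal.ofReal_lt_iff_lt_toReal (by linarith) hl]; linarith
    · rw [D.pos_flip h hl, D.dir_flip, toPlane_neg]; module
  refine (Set.Subset.antisymm (key h hl) ?_).symm
  have := key (G.flip h) (by rwa [G.len_flip])
  rwa [G.flip_flip] at this

/-- The directions of the rays of which a drawing consists near a point. -/
def star (z : Plane) : Set (Fin 2 → ℤ) :=
  {d | ∃ h, ¬ G.IsInf (G.vert h) ∧
    ((D.pos (G.vert h) = z ∧ d = D.dir h) ∨ (z ∈ D.edge h ∧ (d = D.dir h ∨ d = - D.dir h)))}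

/-- Closed edges are closed and finite in number, so near `z` only those through `z` matter. Each of
them is locally a ray from `z` or a line through `z`. -/
theorem locallyAt_star {z : Plane} (hz : z ∈ D.curve) (hs : (D.star z).Nonempty) :
    LocallyAt D.curve z (fan (D.star z)) := by
  have := G.finite_V
  have := G.finite_H
  have h1 : ∀ᶠ x in 𝓝 z, ∀ h, z ∈ D.edge h →
      ((∃ s : ℝ, x - z = s • toPlane (D.dir h)) ↔ x ∈ D.edge h) := by
    refine eventually_all.2 fun h => ?_
    by_cases hh : z ∈ D.edge h
    · exact (D.eventually_mem_edge_of_mem hh).mono fun x hx _ => hx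
    · exact Eventually.of_forall fun x h => absurd h hh
  have h2 : ∀ᶠ x in 𝓝 z, ∀ h, D.pos (G.vert h) = z →
      ((∃ s : ℝ, 0 < s ∧ x - z = s • toPlane (D.dir h)) ↔ x ∈ D.edge h) := by
    refine eventually_all.2 fun h => ?_
    by_cases hh : D.pos (G.vert h) = z
    · rw [← hh]
      exact (D.eventually_mem_edge_of_vert h).mono fun x hx _ => hx
    · exact Eventually.of_forall fun x h => absurd h hh
  have h3 : ∀ᶠ x in 𝓝 z, ∀ h, x ∈ D.closedEdge h → z ∈ D.closedEdge h := by
    refine eventually_all.2 fun h => ?_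
    by_cases hh : z ∈ D.closedEdge h
    · exact Eventually.of_forall fun x _ => hh
    · filter_upwards [(D.isClosed_closedEdge h).isOpen_compl.mem_nhds hh] with x hx hx'
      exact absurd hx' hx
  have h4 : ∀ᶠ x in 𝓝 z, ∀ v, x = D.pos v → z = D.pos v := by
    refine eventually_all.2 fun v => ?_
    by_cases hh : z = D.pos v
    · exact Eventually.of_forall fun x _ => hh
    · filter_upwards [isOpen_ne.mem_nhds hh] with x hx hx'
      exact absurd hx' hx
  filter_upwards [h1, h2, h3, h4] with x h1 h2 h3 h4
  constructor
  · rintro (⟨v, hv, hx⟩ | ⟨h, hh, hx⟩)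
    · obtain ⟨d, hd⟩ := hs
      exact ⟨d, hd, 0, le_rfl, by rw [zero_smul, sub_eq_zero, hx, h4 v hx]⟩
    · have hcl : x ∈ D.closedEdge h := by
        obtain ⟨t, ht, hl, e⟩ := hx
        exact ⟨t, ht.le, hl.le, e⟩
      rcases D.closedEdge_cases (h3 h hcl) with e | ⟨hl, e⟩ | hze
      · obtain ⟨s, hs0, e'⟩ := (h2 h e.symm).2 hx
        exact ⟨_, ⟨h, hh, Or.inl ⟨e.symm, rfl⟩⟩, s, hs0.le, e'⟩
      · rw [← D.edge_flip hl] at hx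
        obtain ⟨s, hs0, e'⟩ := (h2 _ e.symm).2 hx
        exact ⟨_, ⟨_, not_isInf_of_len_ne_top (by rwa [G.len_flip]), Or.inl ⟨e.symm, rfl⟩⟩, s,
          hs0.le, e'⟩
      · obtain ⟨s, e'⟩ := (h1 h hze).2 hx
        rcases le_total 0 s with hs0 | hs0
        · exact ⟨_, ⟨h, hh, Or.inr ⟨hze, Or.inl rfl⟩⟩, s, hs0, e'⟩
        · exact ⟨_, ⟨h, hh, Or.inr ⟨hze, Or.inr rfl⟩⟩, -s, by linarith, by
            rw [e', toPlane_neg]; simp⟩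
  · rintro ⟨d, ⟨h, hh, hd⟩, t, ht, e⟩
    rcases ht.eq_or_lt with rfl | ht
    · rw [zero_smul, sub_eq_zero] at e
      rwa [e]
    · refine Or.inr ⟨h, hh, ?_⟩
      rcases hd with ⟨hp, rfl⟩ | ⟨hze, rfl | rfl⟩
      · exact (h2 h hp).1 ⟨t, ht, e⟩
      · exact (h1 h hze).1 ⟨t, e⟩
      · exact (h1 h hze).1 ⟨-t, by rw [e, toPlane_neg]; simp⟩

theorem isSmoothAt_of_mem_edge {h : G.H} (hh : ¬ G.IsInf (G.vert h)) {z : Plane}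
    (hz : z ∈ D.edge h) : IsSmoothAt D.curve z := by
  have hstar : D.star z = {D.dir h, - D.dir h} := by
    ext d
    constructor
    · rintro ⟨k, hk, ⟨rfl, -⟩ | ⟨hzk, hd⟩⟩
      · exact absurd hz (D.vert_not_mem_edge _ h hk hh)
      · have : k = h ∨ k = G.flip h := by
          by_contra! hne
          exact Set.disjoint_left.1 (D.edge_disjoint h k hh hk hne.1 hne.2) hz hzk
        rcases this with rfl | rfl
        · exact hd
        · rw [D.dir_flip, neg_neg] at hd
          exact hd.symm
    · intro hd
      exact ⟨h, hh, Or.inr ⟨hz, hd⟩⟩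
  refine isSmoothAt_of_line (D.dir_primitive h) ?_
  rw [← hstar]
  exact D.locallyAt_star (Or.inr ⟨h, hh, hz⟩) ⟨D.dir h, by rw [hstar]; simp⟩

theorem star_pos {v : G.V} (hv : ¬ G.IsInf v) : D.star (D.pos v) =
    {d | ∃ h, ¬ G.IsInf (G.vert h) ∧ D.pos (G.vert h) = D.pos v ∧ d = D.dir h} := by
  ext d
  constructor
  · rintro ⟨k, hk, h | ⟨hzk, -⟩⟩
    · exact ⟨k, hk, h⟩
    · exact absurd hzk (D.vert_not_mem_edge v k hv hk)
  · rintro ⟨k, hk, h⟩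
    exact ⟨k, hk, Or.inl h⟩

theorem isSmoothAt_pos {v : G.V} (hv : ¬ G.IsInf v) {a b : Fin 2 → ℤ} (hab : det₂ a b = 1)
    (h : D.star (D.pos v) = {a, b, -(a + b)}) : IsSmoothAt D.curve (D.pos v) := by
  refine isSmoothAt_of_tripod hab ?_
  rw [← h]
  exact D.locallyAt_star (Or.inl ⟨v, hv, rfl⟩) ⟨a, by rw [h]; simp⟩

end Drawing

/-! ### An immersed theta graph with one node: combinatorics and coordinates -/

instance (ℓ : Fin 3 → ℝ) (hℓ : ∀ i, 0 < ℓ i) : DecidableEq (theta ℓ hℓ).H :=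
  inferInstanceAs (DecidableEq (Fin 3 × Bool))

theorem natCast_mul_pos {t : ℝ} (ht : 0 < t) {n : ℕ} (hn : 0 < n) : 0 < (n : ℝ) * t := by
  positivity

theorem ofReal_eq_ofReal_add {l t : ℝ} {k : ℕ} (hl : l = k * t) {m n : ℕ} (hk : k = m + n) :
    ENNReal.ofReal l = ENNReal.ofReal (m * t + n * t) := by
  rw [hl, hk]; congr 1; push_cast; ring

/-- A half-edge of the theta graph. -/
def thetaHalfEdge {ℓ : Fin 3 → ℝ} {hℓ : ∀ i, 0 < ℓ i} (i : Fin 3) (b : Bool) : (theta ℓ hℓ).H :=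
  (i, b)

section Inclusions

variable {G : AbstractTropicalCurve} {dec : DecidableEq G.H} {h₀ : G.H} {a b : ℝ}
    {ha : 0 < a} {hb : 0 < b} {hl : G.len h₀ = ENNReal.ofReal (a + b)}

/-- The half-edge of a subdivision at the vertex of a half-edge. -/
def oldHalfEdge (h : G.H) : (G.subdivide h₀ ha hb hl).H := Sum.inl h

/-- The second half-edge at the new vertex of a subdivision. -/
def newHalfEdge : (G.subdivide h₀ ha hb hl).H := Sum.inr true

/-- The new vertex of a subdivision. -/
def newVertex : (G.subdivide h₀ ha hb hl).V := none

/-- A vertex as a vertex of a subdivision. -/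
def oldVertex (v : G.V) : (G.subdivide h₀ ha hb hl).V := some v

/-- A vertex as a vertex of an elementary modification. -/
def attachVertex {G : AbstractTropicalCurve} {v₀ : G.V} {hv₀ : ¬ G.IsInf v₀} (v : G.V) :
    (G.attach v₀ hv₀).V := some v

end Inclusions

section Refine

variable (ℓ : Fin 3 → ℝ) (hℓ : ∀ i, 0 < ℓ i) {t : ℝ} (ht : 0 < t) (h : ∀ i, ℓ i = (15 : ℕ) * t)

/-- The theta graph with the three edges subdivided into four, three and two edges. -/
noncomputable def subdividedTheta : AbstractTropicalCurve :=
  -- The edges 0, 2 and 1 of the theta graph are cut, in this order, into 2 + 5 + 2 + 6, 6 + 6 + 3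
  -- and 12 + 3 units.
  ((((((theta ℓ hℓ).subdivide (thetaHalfEdge 0 false)
    (natCast_mul_pos ht (n := 2) (Nat.succ_pos _)) (natCast_mul_pos ht (n := 13) (Nat.succ_pos _))
    (ofReal_eq_ofReal_add (h 0) rfl)).subdivide (dec := decidableEqSubdivide)
    newHalfEdge
    (natCast_mul_pos ht (n := 5) (Nat.succ_pos _)) (natCast_mul_pos ht (n := 8) (Nat.succ_pos _))
    (ofReal_eq_ofReal_add (k := 13) rfl rfl)).subdivide (dec := decidableEqSubdivide)
    newHalfEdge
    (natCast_mul_pos ht (n := 2) (Nat.succ_pos _)) (natCast_mul_pos ht (n := 6) (Nat.succ_pos _))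
    (ofReal_eq_ofReal_add (k := 8) rfl rfl)).subdivide (dec := decidableEqSubdivide)
    (oldHalfEdge (oldHalfEdge (oldHalfEdge (thetaHalfEdge 2 true))))
    (natCast_mul_pos ht (n := 6) (Nat.succ_pos _)) (natCast_mul_pos ht (n := 9) (Nat.succ_pos _))
    (ofReal_eq_ofReal_add (h 2) rfl)).subdivide (dec := decidableEqSubdivide)
    newHalfEdge
    (natCast_mul_pos ht (n := 6) (Nat.succ_pos _)) (natCast_mul_pos ht (n := 3) (Nat.succ_pos _))
    (ofReal_eq_ofReal_add (k := 9) rfl rfl)).subdivide (dec := decidableEqSubdivide)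
    (oldHalfEdge (oldHalfEdge (oldHalfEdge (oldHalfEdge (oldHalfEdge (thetaHalfEdge 1 false))))))
    (natCast_mul_pos ht (n := 12) (Nat.succ_pos _)) (natCast_mul_pos ht (n := 3) (Nat.succ_pos _))
    (ofReal_eq_ofReal_add (h 1) rfl)

/-- The subdivided theta graph with infinite edges attached at four vertices. -/
noncomputable def modifiedTheta : AbstractTropicalCurve :=
  -- In the numbering of `thetaVertex`, infinite edges are attached at the vertices 3, 2, 5 and 7.
  -- The vertices 4 and 6, which will meet at the node, keep degree two.
  ((((subdividedTheta ℓ hℓ ht h).attach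
    (oldVertex (oldVertex (oldVertex (oldVertex newVertex)))) (fun h => h)).attach
    (attachVertex (oldVertex (oldVertex (oldVertex (oldVertex (oldVertex newVertex))))))
      (fun h => h)).attach
    (attachVertex (attachVertex (oldVertex (oldVertex newVertex)))) (fun h => h)).attach
    (attachVertex (attachVertex (attachVertex newVertex))) (fun h => h)

theorem isModification_modifiedTheta :
    (theta ℓ hℓ).IsModification (modifiedTheta ℓ hℓ ht h) := by
  unfold modifiedTheta subdividedTheta
  iterate 4 refine .tail ?_ (Or.inr (Or.inr (Or.inr (isElementaryModification_attach _ _ _))))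
  iterate 6 refine .tail ?_ (Or.inr (Or.inl (isSubdivision_subdivide _ _ _ _ _)))
  exact .refl

end Refine

/-- The vertices of an immersed theta graph. -/
def thetaVertex : Fin 12 → Fin 2 → ℤ :=
  -- The vertices 4 and 6 both lie at the origin, the node. The entries for the infinite vertices 8
  -- to 11 are arbitrary.
  ![![0, -3], ![-6, 0], ![2, -5], ![2, 0], ![0, 0], ![0, 6], ![0, 0], ![-12, -3], 0, 0, 0, 0]

/-- The initial vertices of the edges of an immersed theta graph. -/
def thetaSource : Fin 13 → Fin 12 := ![0, 2, 3, 4, 1, 5, 6, 0, 7, 3, 2, 5, 7]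

/-- The final vertices of the edges of an immersed theta graph. -/
def thetaTarget : Fin 13 → Fin 12 := ![2, 3, 4, 1, 5, 6, 0, 7, 1, 8, 9, 10, 11]

/-- The directions of the edges of an immersed theta graph. -/
def thetaDir : Fin 13 → Fin 2 → ℤ :=
  ![![1, -1], ![0, 1], ![-1, 0], ![-1, 0], ![1, 1], ![0, -1], ![0, -1], ![-1, 0], ![2, 1],
    ![1, 1], ![1, -2], ![1, 2], ![-3, -1]]

/-- The lengths of the finite edges of an immersed theta graph. -/
def thetaLength : Fin 13 → ℕ := ![2, 5, 2, 6, 6, 6, 3, 12, 3, 0, 0, 0, 0]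

/-- The half-edges of the modified theta graph. -/
abbrev ThetaHalfEdge : Type := (((((((((((Fin 3 × Bool) ⊕ Bool) ⊕ Bool) ⊕ Bool) ⊕ Bool) ⊕ Bool)
  ⊕ Bool) ⊕ Bool) ⊕ Bool) ⊕ Bool) ⊕ Bool)

/-- The vertices of the modified theta graph. -/
abbrev ThetaVertex : Type := Option (Option (Option (Option (Option (Option (Option (Option
  (Option (Option Bool)))))))))

/-- The edge and the end of a half-edge. -/
def thetaEdge : ThetaHalfEdge → Fin 13 × Bool :=
  Sum.elim (Sum.elim (Sum.elim (Sum.elim (Sum.elim (Sum.elim (Sum.elim (Sum.elim (Sum.elim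
    (Sum.elim (fun h => ![cond h.2 (3, true) (0, false), cond h.2 (8, true) (7, false),
      cond h.2 (4, false) (6, true)] h.1)
    (fun b => cond b (1, false) (0, true))) (fun b => cond b (2, false) (1, true)))
    (fun b => cond b (3, false) (2, true))) (fun b => cond b (5, false) (4, true)))
    (fun b => cond b (6, false) (5, true))) (fun b => cond b (8, false) (7, true)))
    (fun b => (9, b))) (fun b => (10, b))) (fun b => (11, b))) (fun b => (12, b))

/-- The numbering of the vertices. -/
def thetaIndex (v : ThetaVertex) : Fin 12 :=
  v.elim 11 fun v => v.elim 10 fun v => v.elim 9 fun v => v.elim 8 fun v => v.elim 7 fun v =>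
    v.elim 6 fun v => v.elim 5 fun v => v.elim 4 fun v => v.elim 3 fun v => v.elim 2 fun v =>
      cond v 1 0

theorem bijective_thetaEdge : Function.Bijective thetaEdge := by decide +kernel

theorem bijective_thetaIndex : Function.Bijective thetaIndex := by decide +kernel

section Immersion

variable (ℓ : Fin 3 → ℝ) (hℓ : ∀ i, 0 < ℓ i) {t : ℝ} (ht : 0 < t) (h : ∀ i, ℓ i = (15 : ℕ) * t)

/-- The abstract tropical curve of an immersed theta graph. -/
noncomputable def immersedTheta : AbstractTropicalCurve :=
  -- Renumbering by `Fin 12` and `Fin 13 × Bool` turns the later checks into finite computations.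
  (modifiedTheta ℓ hℓ ht h).ofEquiv (Equiv.ofBijective thetaIndex bijective_thetaIndex)
    (Equiv.ofBijective thetaEdge bijective_thetaEdge)
    (fun k => cond k.2 (thetaTarget k.1) (thetaSource k.1)) (fun k => (k.1, !k.2))
    (fun k => if k.1.val < 9 then ENNReal.ofReal (thetaLength k.1 * t) else ⊤)
    (fun v => 8 ≤ v.val)
    (by
      rintro ((((((((((⟨i, b⟩ | b) | b) | b) | b) | b) | b) | b) | b) | b) | b)
      · fin_cases i <;> cases b <;> rfl
      all_goals cases b <;> rfl)
    (by
      rintro ((((((((((⟨i, b⟩ | b) | b) | b) | b) | b) | b) | b) | b) | b) | b)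
      · fin_cases i <;> cases b <;> rfl
      all_goals cases b <;> rfl)
    (by
      rintro ((((((((((⟨i, b⟩ | b) | b) | b) | b) | b) | b) | b) | b) | b) | b)
      · fin_cases i <;> cases b <;> rfl
      all_goals cases b <;> rfl)
    (by
      have hlt : ∀ n, Nat.ble 8 n = false → ¬ 8 ≤ n := fun n h h' => by
        rw [Nat.ble_eq_true_of_le h'] at h; exact Bool.noConfusion h
      rintro (_ | _ | _ | _ | _ | _ | _ | _ | _ | _ | b)
      iterate 4 exact iff_of_true (Nat.le_of_ble_eq_true rfl) trivial
      iterate 6 exact iff_of_false (hlt _ rfl) (fun h => h)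
      cases b <;> exact iff_of_false (hlt _ rfl) (fun h => h))

theorem isModification_immersedTheta :
    (theta ℓ hℓ).IsModification (immersedTheta ℓ hℓ ht h) :=
  (isModification_modifiedTheta ℓ hℓ ht h).tail (Or.inl (iso_ofEquiv ..))

end Immersion

/-! ### Verification that the drawn curve is nodal with a single node -/

/-- The direction of a half-edge of an immersed theta graph. -/
def thetaHalfDir (k : Fin 13 × Bool) : Fin 2 → ℤ := cond k.2 (-thetaDir k.1) (thetaDir k.1)

/-- The initial vertex of a half-edge of an immersed theta graph. -/
def thetaHalfSource (k : Fin 13 × Bool) : Fin 12 := cond k.2 (thetaTarget k.1) (thetaSource k.1)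

theorem isPrimitive_thetaDir (i : Fin 13) : IsPrimitive (thetaDir i) := by
  refine Int.isCoprime_iff_gcd_eq_one.2 ?_
  revert i
  decide

theorem thetaVertex_thetaTarget : ∀ i : Fin 13, i.val < 9 →
    thetaVertex (thetaTarget i) = thetaVertex (thetaSource i) + (thetaLength i : ℤ) • thetaDir i := by
  decide +kernel

/-- The edges of an immersed theta graph do not meet. -/
theorem thetaDir_cross : ∀ i j : Fin 13, i < j →
    (idot (rot (thetaDir i)) (thetaDir j) ≠ 0 ∧
      ¬ (0 < idot (rot (thetaVertex (thetaSource j) - thetaVertex (thetaSource i))) (thetaDir j) *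
          idot (rot (thetaDir i)) (thetaDir j) ∧
        (i.val < 9 → idot (rot (thetaVertex (thetaSource j) - thetaVertex (thetaSource i)))
          (thetaDir j) * idot (rot (thetaDir i)) (thetaDir j) <
          thetaLength i * idot (rot (thetaDir i)) (thetaDir j) ^ 2) ∧
        0 < idot (rot (thetaVertex (thetaSource j) - thetaVertex (thetaSource i))) (thetaDir i) *
          idot (rot (thetaDir i)) (thetaDir j) ∧
        (j.val < 9 → idot (rot (thetaVertex (thetaSource j) - thetaVertex (thetaSource i)))
          (thetaDir i) * idot (rot (thetaDir i)) (thetaDir j) <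
          thetaLength j * idot (rot (thetaDir i)) (thetaDir j) ^ 2))) ∨
    (idot (rot (thetaDir i)) (thetaDir j) = 0 ∧
      idot (rot (thetaVertex (thetaSource j) - thetaVertex (thetaSource i))) (thetaDir j) ≠ 0) ∨
    (thetaDir j = thetaDir i ∧ i.val < 9 ∧ thetaLength i * idot (thetaDir i) (thetaDir i) ≤
      idot (thetaDir i) (thetaVertex (thetaSource j) - thetaVertex (thetaSource i))) := by
  decide +kernel

/-- The edges of an immersed theta graph contain no vertex. -/
theorem thetaVertex_cross : ∀ (v : Fin 12) (i : Fin 13), ¬ 8 ≤ v.val →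
    idot (rot (thetaDir i)) (thetaVertex v - thetaVertex (thetaSource i)) ≠ 0 ∨
    idot (thetaDir i) (thetaVertex v - thetaVertex (thetaSource i)) ≤ 0 ∨
    (i.val < 9 ∧ thetaLength i * idot (thetaDir i) (thetaDir i) ≤
      idot (thetaDir i) (thetaVertex v - thetaVertex (thetaSource i))) := by
  decide +kernel

theorem idot_self_pos {d : Fin 2 → ℤ} (hd : IsPrimitive d) : 0 < idot d d := by
  have h1 : 0 ≤ idot d d := by
    simp only [idot]; nlinarith [mul_self_nonneg (d 0), mul_self_nonneg (d 1)]
  refine lt_of_le_of_ne h1 fun e => hd.ne_zero ?_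
  simp only [idot] at e
  have h0 : d 0 = 0 := by nlinarith [mul_self_nonneg (d 0), mul_self_nonneg (d 1)]
  have h1 : d 1 = 0 := by nlinarith [mul_self_nonneg (d 0), mul_self_nonneg (d 1)]
  funext i
  fin_cases i <;> assumption

/-- The points of an edge of an immersed theta graph, scaled by the unit of length. -/
def thetaOpenEdge (i : Fin 13) : Set Plane := {x | ∃ s : ℝ, 0 < s ∧
  (i.val < 9 → s < thetaLength i) ∧
  x = toPlane (thetaVertex (thetaSource i)) + s • toPlane (thetaDir i)}

theorem disjoint_thetaOpenEdge_of_lt {i j : Fin 13} (hij : i < j) :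
    Disjoint (thetaOpenEdge i) (thetaOpenEdge j) := by
  rw [Set.disjoint_left]
  rintro x ⟨s, hs, hs', rfl⟩ ⟨r, hr, hr', e⟩
  have e0 := congrFun e 0
  have e1 := congrFun e 1
  have hc := thetaDir_cross i j hij
  have hpos := idot_self_pos (isPrimitive_thetaDir i)
  simp only [Pi.add_apply, Pi.smul_apply, toPlane_apply, smul_eq_mul] at e0 e1
  generalize thetaLength i = n at *
  generalize thetaLength j = m at *
  generalize thetaDir i = d at *
  generalize thetaDir j = d' at *
  generalize thetaVertex (thetaSource i) = a at *
  generalize thetaVertex (thetaSource j) = b at *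
  -- Cramer's rule: at a common point, both parameters times the determinant of the two directions
  -- are integral determinants. The certificate `thetaDir_cross` states the resulting bounds times
  -- that determinant, which avoids a division.
  have E1 : (idot (rot (b - a)) d' : ℝ) = s * idot (rot d) d' := by
    simp [idot, rot]; linear_combination (d' 0 : ℝ) * e1 - (d' 1 : ℝ) * e0
  have E2 : (idot (rot (b - a)) d : ℝ) = r * idot (rot d) d' := by
    simp [idot, rot]; linear_combination (d 0 : ℝ) * e1 - (d 1 : ℝ) * e0
  rcases hc with ⟨hne, hc⟩ | ⟨h0, hne⟩ | ⟨rfl, hi, hle⟩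
  · have hne' : (idot (rot d) d' : ℝ) ≠ 0 := by exact_mod_cast hne
    have hsq : 0 < (idot (rot d) d' : ℝ) ^ 2 := by positivity
    refine hc ⟨?_, fun hi => ?_, ?_, fun hj => ?_⟩
    · have : (0 : ℝ) < idot (rot (b - a)) d' * idot (rot d) d' := by
        rw [E1]; nlinarith [mul_pos hs hsq]
      exact_mod_cast this
    · have : (idot (rot (b - a)) d' * idot (rot d) d' : ℝ) < n * (idot (rot d) d' : ℝ) ^ 2 := by
        rw [E1]; nlinarith [mul_lt_mul_of_pos_right (hs' hi) hsq]
      exact_mod_cast this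
    · have : (0 : ℝ) < idot (rot (b - a)) d * idot (rot d) d' := by
        rw [E2]; nlinarith [mul_pos hr hsq]
      exact_mod_cast this
    · have : (idot (rot (b - a)) d * idot (rot d) d' : ℝ) < m * (idot (rot d) d' : ℝ) ^ 2 := by
        rw [E2]; nlinarith [mul_lt_mul_of_pos_right (hr' hj) hsq]
      exact_mod_cast this
  · rw [h0, Int.cast_zero, mul_zero] at E1
    exact hne (by exact_mod_cast E1)
  · have E3 : (idot d' (b - a) : ℝ) = (s - r) * idot d' d' := by
      simp [idot]; linear_combination -(d' 0 : ℝ) * e0 - (d' 1 : ℝ) * e1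
    have hle' : (n * idot d' d' : ℝ) ≤ idot d' (b - a) := by exact_mod_cast hle
    have hpos' : (0 : ℝ) < idot d' d' := by exact_mod_cast hpos
    rw [E3] at hle'
    have := le_of_mul_le_mul_right hle' hpos'
    linarith [hs' hi]

theorem disjoint_thetaOpenEdge {i j : Fin 13} (hij : i ≠ j) :
    Disjoint (thetaOpenEdge i) (thetaOpenEdge j) := by
  rcases lt_or_gt_of_ne hij with h | h
  · exact disjoint_thetaOpenEdge_of_lt h
  · exact (disjoint_thetaOpenEdge_of_lt h).symm

theorem thetaVertex_not_mem {v : Fin 12} (hv : ¬ 8 ≤ v.val) (i : Fin 13) :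
    toPlane (thetaVertex v) ∉ thetaOpenEdge i := by
  rintro ⟨s, hs, hs', e⟩
  have e0 := congrFun e 0
  have e1 := congrFun e 1
  have hc := thetaVertex_cross v i hv
  have hpos := idot_self_pos (isPrimitive_thetaDir i)
  simp only [Pi.add_apply, Pi.smul_apply, toPlane_apply, smul_eq_mul] at e0 e1
  generalize thetaLength i = n at *
  generalize thetaDir i = d at *
  generalize thetaVertex (thetaSource i) = a at *
  generalize thetaVertex v = b at *
  have hpos' : (0 : ℝ) < idot d d := by exact_mod_cast hpos
  have E1 : (idot (rot d) (b - a) : ℝ) = 0 := by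
    simp [idot, rot]; linear_combination (d 0 : ℝ) * e1 - (d 1 : ℝ) * e0
  have E3 : (idot d (b - a) : ℝ) = s * idot d d := by
    simp [idot]; linear_combination (d 0 : ℝ) * e0 + (d 1 : ℝ) * e1
  rcases hc with h | h | ⟨hi, h⟩
  · exact h (by exact_mod_cast E1)
  · have : (idot d (b - a) : ℝ) ≤ 0 := by exact_mod_cast h
    rw [E3] at this
    linarith [mul_pos hs hpos']
  · have : (n * idot d d : ℝ) ≤ idot d (b - a) := by exact_mod_cast h
    rw [E3] at this
    linarith [le_of_mul_le_mul_right this hpos', hs' hi]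

section Drawing

variable (ℓ : Fin 3 → ℝ) (hℓ : ∀ i, 0 < ℓ i) {t : ℝ} (ht : 0 < t) (h : ∀ i, ℓ i = (15 : ℕ) * t)

/-- The length of an edge of an immersed theta graph. -/
noncomputable def thetaLen (t : ℝ) (i : Fin 13) : ℝ≥0∞ :=
  if i.val < 9 then ENNReal.ofReal (thetaLength i * t) else ⊤

theorem toPlane_thetaTarget {i : Fin 13} (hi : i.val < 9) : toPlane (thetaVertex (thetaTarget i)) =
    toPlane (thetaVertex (thetaSource i)) + (thetaLength i : ℝ) • toPlane (thetaDir i) := by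
  rw [thetaVertex_thetaTarget i hi]
  ext j
  simp

theorem exists_mem_thetaOpenEdge {t : ℝ} (ht : 0 < t) {k : Fin 13 × Bool} (hk : ¬ 8 ≤ (thetaHalfSource k).val) {τ : ℝ}
    (h0 : 0 < τ) (h1 : ENNReal.ofReal τ < thetaLen t k.1) :
    ∃ y ∈ thetaOpenEdge k.1, t • toPlane (thetaVertex (thetaHalfSource k)) +
      τ • toPlane (thetaHalfDir k) = t • y := by
  have hlt : k.1.val < 9 → τ / t < thetaLength k.1 := by
    intro hi
    rw [thetaLen, if_pos hi] at h1
    have := (ENNReal.ofReal_lt_ofReal_iff_of_nonneg h0.le).1 h1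
    rwa [div_lt_iff₀ ht]
  have e : t * (τ / t) = τ := by field_simp
  obtain ⟨i, b⟩ := k
  cases b
  · exact ⟨_, ⟨τ / t, by positivity, hlt, rfl⟩, by
      rw [smul_add, smul_smul, e]; rfl⟩
  -- A half-edge starting at a finite final vertex belongs to a finite edge, and runs through it
  -- backwards.
  · have hi : i.val < 9 := by
      have : ∀ i : Fin 13, ¬ 8 ≤ (thetaTarget i).val → i.val < 9 := by decide
      exact this i hk
    refine ⟨_, ⟨thetaLength i - τ / t, by linarith [hlt hi], fun _ => ?_, rfl⟩, ?_⟩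
    · have : 0 < τ / t := by positivity
      linarith
    · show t • toPlane (thetaVertex (thetaTarget i)) + τ • toPlane (-thetaDir i) = _
      rw [toPlane_thetaTarget hi, toPlane_neg, smul_add, smul_add, smul_smul, smul_smul, mul_sub, e]
      module

/-- A drawing of the immersed theta graph. -/
noncomputable def thetaDrawing : Drawing (immersedTheta ℓ hℓ ht h) where
  pos := fun v : Fin 12 => t • toPlane (thetaVertex v)
  dir := thetaHalfDir
  dir_primitive := by
    rintro ⟨i, b⟩
    cases b
    · exact isPrimitive_thetaDir i
    · exact isPrimitive_neg (isPrimitive_thetaDir i)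
  dir_flip := by
    rintro ⟨i, b⟩
    cases b
    · rfl
    · exact (neg_neg _).symm
  finite_end := by
    have : ∀ i : Fin 13, ¬ 8 ≤ (thetaSource i).val := by decide
    rintro ⟨i, b⟩
    cases b
    · exact Or.inl (this i)
    · exact Or.inr (this i)
  pos_flip := by
    rintro ⟨i, b⟩ hl
    have hl' : thetaLen t i ≠ ⊤ := hl
    have hi : i.val < 9 := by
      by_contra hi
      exact hl' (if_neg hi)
    have e : (thetaLen t i).toReal = thetaLength i * t := by
      rw [thetaLen, if_pos hi, ENNReal.toReal_ofReal (by positivity)]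
    cases b
    · show t • toPlane (thetaVertex (thetaTarget i)) = t • toPlane (thetaVertex (thetaSource i)) +
        (thetaLen t i).toReal • toPlane (thetaDir i)
      rw [e, toPlane_thetaTarget hi]; module
    · show t • toPlane (thetaVertex (thetaSource i)) = t • toPlane (thetaVertex (thetaTarget i)) +
        (thetaLen t i).toReal • toPlane (-thetaDir i)
      rw [e, toPlane_thetaTarget hi, toPlane_neg]; module
  edge_disjoint := by
    intro k k' hk hk' h1 h2
    rw [Set.disjoint_left]
    rintro x ⟨τ, a, b, rfl⟩ ⟨τ', a', b', e'⟩
    obtain ⟨y, hy, e⟩ := exists_mem_thetaOpenEdge ht hk a b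
    obtain ⟨y', hy', e''⟩ := exists_mem_thetaOpenEdge ht hk' a' b'
    have hyy : y = y' := smul_right_injective Plane ht.ne' (e.symm.trans (e'.trans e''))
    subst hyy
    have hne : k.1 ≠ k'.1 := by
      intro he
      obtain ⟨i, c⟩ := k
      obtain ⟨i', c'⟩ := k'
      obtain rfl : i = i' := he
      cases c <;> cases c' <;> first | exact h1 rfl | exact h2 rfl
    exact Set.disjoint_left.1 (disjoint_thetaOpenEdge hne) hy hy'
  vert_not_mem_edge := by
    rintro v k hv hk ⟨τ, a, b, e'⟩
    obtain ⟨y, hy, e⟩ := exists_mem_thetaOpenEdge ht hk a b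
    have := smul_right_injective Plane ht.ne' (e'.trans e)
    exact thetaVertex_not_mem hv k.1 (by rw [← this] at hy; exact hy)

theorem star_thetaDrawing {v : Fin 12} (hv : ¬ 8 ≤ v.val) {S : List (Fin 2 → ℤ)}
    (h1 : ∀ k : Fin 13 × Bool, ¬ 8 ≤ (thetaHalfSource k).val →
      thetaVertex (thetaHalfSource k) = thetaVertex v → thetaHalfDir k ∈ S)
    (h2 : ∀ d ∈ S, ∃ k : Fin 13 × Bool, ¬ 8 ≤ (thetaHalfSource k).val ∧
      thetaVertex (thetaHalfSource k) = thetaVertex v ∧ d = thetaHalfDir k) :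
    (thetaDrawing ℓ hℓ ht h).star (t • toPlane (thetaVertex v)) = {d | d ∈ S} := by
  refine ((thetaDrawing ℓ hℓ ht h).star_pos (v := v) hv).trans ?_
  ext d
  constructor
  · rintro ⟨k, hk, e, rfl⟩
    refine h1 k hk ?_
    have e' : toPlane (thetaVertex (thetaHalfSource k)) = toPlane (thetaVertex v) :=
      smul_right_injective Plane ht.ne' e
    funext i
    have := congrFun e' i
    simpa using this
  · intro hd
    obtain ⟨k, hk, e, rfl⟩ := h2 d hd
    exact ⟨k, hk, congrArg (fun u => t • toPlane u) e, rfl⟩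

end Drawing

section Nodal

variable (ℓ : Fin 3 → ℝ) (hℓ : ∀ i, 0 < ℓ i) {t : ℝ} (ht : 0 < t) (h : ∀ i, ℓ i = (15 : ℕ) * t)

/-- All finite vertices except 4 and 6 are tripods; for each, a positively oriented unimodular pair
of directions is supplied. -/
theorem isSmoothAt_thetaVertex {v : Fin 12} (hv : ¬ 8 ≤ v.val) (h4 : v ≠ 4) (h6 : v ≠ 6) :
    IsSmoothAt (thetaDrawing ℓ hℓ ht h).curve (t • toPlane (thetaVertex v)) := by
  have key : ∀ a b : Fin 2 → ℤ, idot (rot a) b = 1 →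
      (∀ k : Fin 13 × Bool, ¬ 8 ≤ (thetaHalfSource k).val →
        thetaVertex (thetaHalfSource k) = thetaVertex v → thetaHalfDir k ∈ [a, b, -(a + b)]) →
      (∀ d ∈ [a, b, -(a + b)], ∃ k : Fin 13 × Bool, ¬ 8 ≤ (thetaHalfSource k).val ∧
        thetaVertex (thetaHalfSource k) = thetaVertex v ∧ d = thetaHalfDir k) →
      IsSmoothAt (thetaDrawing ℓ hℓ ht h).curve (t • toPlane (thetaVertex v)) := by
    intro a b hab h1 h2
    rw [idot_rot] at hab
    refine (thetaDrawing ℓ hℓ ht h).isSmoothAt_pos (v := v) hv hab ?_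
    refine (star_thetaDrawing ℓ hℓ ht h hv h1 h2).trans ?_
    ext d
    simp
  revert key
  fin_cases v <;> intro key
  · exact key ![1, -1] ![0, 1] (by decide +kernel) (by decide +kernel) (by decide +kernel)
  · exact key ![1, 0] ![1, 1] (by decide +kernel) (by decide +kernel) (by decide +kernel)
  · exact key ![0, 1] ![-1, 1] (by decide +kernel) (by decide +kernel) (by decide +kernel)
  · exact key ![-1, 0] ![0, -1] (by decide +kernel) (by decide +kernel) (by decide +kernel)
  · exact absurd rfl h4
  · exact key ![-1, -1] ![0, -1] (by decide +kernel) (by decide +kernel) (by decide +kernel)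
  · exact absurd rfl h6
  · exact key ![1, 0] ![2, 1] (by decide +kernel) (by decide +kernel) (by decide +kernel)
  all_goals exact absurd (by decide) hv

/-- The edges 2 and 3 form a horizontal line through vertex 4, the edges 5 and 6 a vertical line
through vertex 6. -/
theorem isNodeWith_zero :
    IsNodeWith (thetaDrawing ℓ hℓ ht h).curve 0 ![1, 0] ![0, 1] := by
  have h0 : t • toPlane (thetaVertex 4) = 0 := by
    ext i
    fin_cases i <;> simp [thetaVertex]
  have hs := star_thetaDrawing ℓ hℓ ht h (v := 4) (by decide)
    (S := [![1, 0], -![1, 0], ![0, 1], -![0, 1]]) (by decide +kernel) (by decide +kernel)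
  rw [h0] at hs
  have hs' : (thetaDrawing ℓ hℓ ht h).star 0 = {![1, 0], -![1, 0], ![0, 1], -![0, 1]} := by
    rw [hs]
    ext d
    simp
  refine isNodeWith_of_cross (Int.isCoprime_iff_gcd_eq_one.2 (by decide))
    (Int.isCoprime_iff_gcd_eq_one.2 (by decide)) (by rw [det₂_eq]; decide) ?_
  rw [← hs']
  refine (thetaDrawing ℓ hℓ ht h).locallyAt_star (Or.inl ⟨(4 : Fin 12), ?_, h0.symm⟩)
    ⟨![1, 0], by rw [hs']; simp⟩
  exact show ¬ 8 ≤ (4 : Fin 12).val by decide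

theorem isSmoothAt_thetaDrawing {p : Plane} (hp : p ∈ (thetaDrawing ℓ hℓ ht h).curve)
    (h0 : p ≠ 0) : IsSmoothAt (thetaDrawing ℓ hℓ ht h).curve p := by
  rcases hp with ⟨v, hv, rfl⟩ | ⟨k, hk, hp⟩
  · refine isSmoothAt_thetaVertex ℓ hℓ ht h hv ?_ ?_ <;> rintro rfl <;> apply h0 <;>
    · show t • toPlane (thetaVertex _) = 0
      ext i
      fin_cases i <;> simp [thetaVertex]
  · exact (thetaDrawing ℓ hℓ ht h).isSmoothAt_of_mem_edge hk hp

theorem isNode_thetaDrawing {p : Plane} (hp : IsNode (thetaDrawing ℓ hℓ ht h).curve p) : p = 0 := by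
  by_contra h0
  exact (isSmoothAt_thetaDrawing ℓ hℓ ht h hp.mem h0).not_isNode hp

/-- The curve of the drawing is resolved by the immersed theta graph. -/
noncomputable def thetaResolution :
    Resolution (immersedTheta ℓ hℓ ht h) (thetaDrawing ℓ hℓ ht h).curve where
  pos := (thetaDrawing ℓ hℓ ht h).pos
  dir := (thetaDrawing ℓ hℓ ht h).dir
  dir_primitive := (thetaDrawing ℓ hℓ ht h).dir_primitive
  dir_flip := (thetaDrawing ℓ hℓ ht h).dir_flip
  finite_end := (thetaDrawing ℓ hℓ ht h).finite_end
  pos_flip := (thetaDrawing ℓ hℓ ht h).pos_flip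
  image_eq := rfl
  edge_disjoint := (thetaDrawing ℓ hℓ ht h).edge_disjoint
  vert_not_mem_edge := (thetaDrawing ℓ hℓ ht h).vert_not_mem_edge
  isNode_of_pos_eq := by
    intro v w hv hw hne e
    have e' : toPlane (thetaVertex v) = toPlane (thetaVertex w) :=
      smul_right_injective Plane ht.ne' e
    have e2 : thetaVertex v = thetaVertex w := by
      funext i
      have := congrFun e' i
      simpa using this
    -- Finite vertices coincide only at the origin.
    have key : ∀ v w : Fin 12, ¬ 8 ≤ v.val → ¬ 8 ≤ w.val → v ≠ w →
        thetaVertex v = thetaVertex w → thetaVertex v = 0 := by decide +kernel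
    have e3 : (thetaDrawing ℓ hℓ ht h).pos v = 0 := by
      show t • toPlane (thetaVertex v) = 0
      rw [key v w hv hw hne e2]
      ext i
      simp
    rw [e3]
    exact ⟨_, _, isNodeWith_zero ℓ hℓ ht h⟩
  resolved := by
    intro v hv hn
    have e : t • toPlane (thetaVertex v) = 0 := isNode_thetaDrawing ℓ hℓ ht h hn
    have e2 : thetaVertex v = 0 := by
      funext i
      have := congrFun e i
      simpa [ht.ne'] using this
    have key : ∀ v : Fin 12, ¬ 8 ≤ v.val → thetaVertex v = 0 → ∃ k k' : Fin 13 × Bool, k ≠ k' ∧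
        (∀ l, thetaHalfSource l = v ↔ l = k ∨ l = k') ∧ thetaHalfDir k' = - thetaHalfDir k := by
      decide +kernel
    exact key v hv e2

end Nodal

theorem exists_immersion {ℓ : Fin 3 → ℝ} {hℓ : ∀ i, 0 < ℓ i} (heq : ∀ i j, ℓ i = ℓ j) :
    ∃ C, IsImmersion (theta ℓ hℓ) C ∧ nodeCount C ≤ 1 := by
  -- Each of the three edges of the model measures 15 units.
  have ht : 0 < ℓ 0 / 15 := by linarith [hℓ 0]
  have h : ∀ i, ℓ i = (15 : ℕ) * (ℓ 0 / 15) := fun i => by rw [heq i 0]; push_cast; ring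
  refine ⟨(thetaDrawing ℓ hℓ ht h).curve, ⟨⟨(thetaDrawing ℓ hℓ ht h).isFiniteUnion_curve,
    fun p hp => ?_⟩, _, isModification_immersedTheta ℓ hℓ ht h, ⟨thetaResolution ℓ hℓ ht h⟩⟩,
    nodeCount_le_one (z := 0) (fun p hp => isNode_thetaDrawing ℓ hℓ ht h hp)
      (isNodeWith_zero ℓ hℓ ht h) (by rw [det₂_eq]; decide)⟩
  by_cases h0 : p = 0
  · subst h0
    exact Or.inr ⟨_, _, isNodeWith_zero ℓ hℓ ht h⟩
  · exact Or.inl (isSmoothAt_thetaDrawing ℓ hℓ ht h hp h0)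

theorem crossingNumber_theta_le {ℓ : Fin 3 → ℝ} {hℓ : ∀ i, 0 < ℓ i} (heq : ∀ i j, ℓ i = ℓ j) :
    crossingNumber (theta ℓ hℓ) ≤ 1 := by
  obtain ⟨C, hC, h1⟩ := exists_immersion (hℓ := hℓ) heq
  exact (iInf₂_le C hC).trans h1

end TropicalCrossing

theorem mainTheorem10 (ℓ : Fin 3 → ℝ) (hℓ : ∀ i, 0 < ℓ i) (heq : ∀ i j, ℓ i = ℓ j) :
    TropicalCrossing.crossingNumber (TropicalCrossing.theta ℓ hℓ) = 1 ∧
      ¬ ∃ C : Set TropicalCrossing.Plane,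
        TropicalCrossing.IsPlanarEmbedding (TropicalCrossing.theta ℓ hℓ) C := by
  refine ⟨le_antisymm ?_ (le_iInf₂ fun C hC => TropicalCrossing.one_le_nodeCount heq hC), ?_⟩
  · exact TropicalCrossing.crossingNumber_theta_le heq
  · rintro ⟨C, hC, hR⟩
    exact TropicalCrossing.not_smooth_of_realizes heq hR hC.2
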